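/- **Continuous tree-mining game (CTM).** Fix an integer $k\ge 2$. The state of the game is a finite rooted weighted tree $T$, in which $d_u$ denotes the length of the edge from $u\neq r$ to its parent and in which no node except possibly the root $r$ has exactly one child, together with a configuration $x\in\mathbb N^{\mathcal L(T)}$ of $k$ robots on the leaves, $\sum_\ell x_\ell=k$; put $x_u=\sum_{\ell\preceq u}x_\ell$ for every node $u$, where $\ell\preceq u$ means that $\ell$ is $u$ or a descendant of $u$. Moving from $x$ to $x'$ costs $\mathrm{OT}_T(x,x')=\sum_{u\ne r}d_u|x_u-x'_u|$. Initially $T$ consists of the root and one leaf, at distance $0$, that hosts all robots. The adversary may (i) elongate continuously the edge of a leaf $\ell$ as long as $x_\ell\ge2$, at a cost of $x_\ell$ per unit of length; (ii) give $m$ children to a leaf $\ell$ with $x_\ell\ge3$, where $2\le m\le x_\ell-1$, through edges of a common length $\delta\in(0,1]$ chosen by the player; (iii) kill a leaf, if it is not the only one (if its parent is not the root and has a single other child, the parent is suppressed and its two remaining edges are merged). A strategy of the player chooses the lengths $\delta$ and returns, for any state $(T,x)$ and any modified tree $T'$, a configuration $x'$ on $T'$, the transport from $x$ to $x'$ being added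 to the cost; taking $T'=T$ at every instant of an elongation tells when and how robots are moved during it, and it is part of the definition of a strategy that if it reacts to an elongation, then there is a first instant at which it does. For $f:\mathbb N\times\mathbb R\to\mathbb R$ the strategy is *$f(k,D)$-bounded* if, whatever the adversary does, all robots attain depth $D$ with a cost of at most $f(k,D)$; that is, for every reachable state and every $D$ that is at least the depth of the highest (closest to the root) leaf, the cost incurred so far is at most $f(k,D)$. **Collective tree exploration (CTE).** $k$ robots start at the root of an unknown finite rooted tree with edges of length $1$. In each synchronous round each robot stays or moves along one edge; visiting a node reveals its adjacent edges to the whole team, and the algorithm determines all moves from what has been revealed so far. $\mathtt{Runtime}(\mathcal A,T)$ is the first number of rounds after which all edges have been traversed and all robots are at the root. **Layered tree traversal (LTT).** $T$ is a finite rooted tree with edge lengths in $\{0,1\}$ and a target in its last layer; layer $i$ is the set of nodes with $i$ edges to the root. A searcher starts at the root. At step $i$, layer $i$ and the edges leading to it are revealed, and the searcher moves to a node of layer $i$, chosen by a deterministic algorithm as a function of the revealed layers and of its current position; at the end it goes from the last layer to the target. The cost is the distance travelled. A randomized algorithm is a probability distribution over deterministic ones. The length $L$ is the sum of all edge lengths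 and the depth $D$ is the distance from the root to the target. **Theorem.** Let $k\ge2$, $f:\mathbb N\times\mathbb R\to\mathbb R$, and suppose that the player has an $f(k,D)$-bounded strategy for the continuous tree-mining game with $k$ robots. Then: 1. there is a CTE algorithm $\mathcal A$ for $k$ robots that terminates on every finite rooted tree $T$, and, if $T$ has $n$ nodes and depth $D$ (the maximal number of edges from the root to a node), $$\mathtt{Runtime}(\mathcal A,T)\le\frac{2n+f(k,D)}{k}+D+1;$$ 2. there is a randomized LTT algorithm $\mathcal A_k$ such that, for every layered tree $T$ with edge lengths in $\{0,1\}$, length $L$ and depth $D$, $$\mathbb E\big(\mathtt{Cost}(\mathcal A_k,T)\big)\le\frac{2L+f(k,D)}{k}+1.$$ -/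

import Mathlib

noncomputable section

open scoped ENNReal
open Classical

namespace TreeMining

/-! ## The continuous tree-mining game -/

/-- Data of a finite weighted tree rooted at the node `0`: its nodes, the parent `p(u)` of each node
and the length `d_u` of the edge between `u` and `p(u)`. Values outside `verts` and the value
`len 0` carry no meaning. -/
structure GameTree where
  verts : Finset ℕ
  parent : ℕ → ℕ
  len : ℕ → ℝ

namespace GameTree

/-- The children of a node. -/
def children (T : GameTree) (v : ℕ) : Finset ℕ :=
  T.verts.filter fun u => u ≠ 0 ∧ T.parent u = v

/-- The leaves, i.e. the nodes without children. -/
def leaves (T : GameTree) : Finset ℕ :=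
  T.verts.filter fun v => T.children v = ∅

/-- `T` is a simple weighted tree rooted at `0`: iterating the parent function leads from every node
to the root, and no node other than the root has exactly one child (i.e. has degree two). -/
structure IsSimple (T : GameTree) : Prop where
  root_mem : 0 ∈ T.verts
  parent_root : T.parent 0 = 0
  parent_mem : ∀ v ∈ T.verts, T.parent v ∈ T.verts
  reaches_root : ∀ v ∈ T.verts, ∃ i : ℕ, T.parent^[i] v = 0
  len_nonneg : ∀ v ∈ T.verts, v ≠ 0 → 0 ≤ T.len v
  card_children : ∀ v ∈ T.verts, v ≠ 0 → (T.children v).card ≠ 1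

/-- `u ≼ v`: the node `v` is obtained from `u` by iterating the parent function. -/
def IsDesc (T : GameTree) (u v : ℕ) : Prop := ∃ i : ℕ, T.parent^[i] u = v

/-- Distance from the root to `v`. -/
def depth (T : GameTree) (v : ℕ) : ℝ :=
  ∑ u ∈ T.verts.filter (fun u => u ≠ 0 ∧ T.IsDesc v u), T.len u

/-- The extension `x_u = ∑_{v ≼ u} x_v` of a distribution of robots over nodes. -/
def load (T : GameTree) (x : ℕ → ℕ) (u : ℕ) : ℕ :=
  ∑ v ∈ T.verts.filter (fun v => T.IsDesc v u), x v

/-- The optimal transport cost `∑_u d_u |x_u - x'_u|`. -/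
def transport (T : GameTree) (x x' : ℕ → ℕ) : ℝ :=
  ∑ u ∈ T.verts.erase 0, T.len u * |(T.load x u : ℝ) - (T.load x' u : ℝ)|

/-- `x` is a discrete configuration of `k` robots on `T`: it is supported by the leaves, and its
total is `k`. -/
def IsConfig (T : GameTree) (k : ℕ) (x : ℕ → ℕ) : Prop :=
  (∀ v, v ∉ T.leaves → x v = 0) ∧ ∑ v ∈ T.leaves, x v = k

/-- The edge leading to `l` gets longer by `s`. -/
def elongate (T : GameTree) (l : ℕ) (s : ℝ) : GameTree where
  verts := T.verts
  parent := T.parent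
  len := Function.update T.len l (T.len l + s)

/-- The leaf `l` receives the elements of `C` as children, through edges of length `δ`. -/
def fork (T : GameTree) (l : ℕ) (C : Finset ℕ) (δ : ℝ) : GameTree where
  verts := T.verts ∪ C
  parent := fun u => if u ∈ C then l else T.parent u
  len := fun u => if u ∈ C then δ else T.len u

/-- The nodes that have the same parent as `l`, without `l` itself. -/
def siblings (T : GameTree) (l : ℕ) : Finset ℕ := (T.children (T.parent l)).erase l

/-- The leaf `l` disappears. If its parent `p` is not the root and has a single other child `u`,
then `p` is suppressed and the edges `(u, p)` and `(p, p(p))` are merged into one. -/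
def kill (T : GameTree) (l : ℕ) : GameTree :=
  if T.parent l ≠ 0 ∧ (T.siblings l).card = 1 then
    { verts := (T.verts.erase l).erase (T.parent l)
      parent := fun u => if u ∈ T.siblings l then T.parent (T.parent l) else T.parent u
      len := fun u => if u ∈ T.siblings l then T.len (T.parent l) + T.len u else T.len u }
  else
    { verts := T.verts.erase l
      parent := T.parent
      len := T.len }

/-- The tree at the beginning of the game: the root `0` and one leaf `1`, whose edge has not
started to grow yet. -/
def start : GameTree where
  verts := {0, 1}
  parent := fun _ => 0
  len := fun _ => 0

end GameTree

/-- A strategy of the player of the continuous tree-mining game with `k` robots. The new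
configuration is `respond T x T'`, where `(T, x)` is the previous state and `T'` the modified tree;
`T' = T` tells whether robots are moved while a leaf is being elongated. The player also chooses the
length of the edges created by a fork of the leaf `l` into `m` children. -/
structure CTMStrategy (k : ℕ) where
  forkLen : GameTree → (ℕ → ℕ) → (l m : ℕ) → ℝ
  respond : GameTree → (ℕ → ℕ) → GameTree → (ℕ → ℕ)
  forkLen_pos : ∀ T x l m, 0 < forkLen T x l m
  forkLen_le_one : ∀ T x l m, forkLen T x l m ≤ 1
  respond_isConfig : ∀ (T : GameTree) (x : ℕ → ℕ) (T' : GameTree), T.IsSimple → T.IsConfig k x → T'.IsSimple →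
    T'.IsConfig k (respond T x T')
  /-- If the player reacts at all to the continuous elongation of a leaf, then there is a first
  instant at which it does, so that the evolution in continuous time is well defined. -/
  exists_first_move : ∀ (T : GameTree) (x : ℕ → ℕ) (l : ℕ), T.IsSimple → T.IsConfig k x → l ∈ T.leaves → 2 ≤ x l →
    {s : ℝ | 0 ≤ s ∧ respond (T.elongate l s) x (T.elongate l s) ≠ x}.Nonempty →
    ∃ s₀, IsLeast {s : ℝ | 0 ≤ s ∧ respond (T.elongate l s) x (T.elongate l s) ≠ x} s₀

namespace CTMStrategy

variable {k : ℕ}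

/-- `S.Reach T x c`: some behaviour of the adversary leads to the tree `T` and the configuration
`x`, after the player that follows `S` has incurred the cost `c`. -/
inductive Reach (S : CTMStrategy k) : GameTree → (ℕ → ℕ) → ℝ → Prop
  | start : Reach S GameTree.start (fun v => if v = 1 then k else 0) 0
  /-- A leaf that hosts at least two robots is elongated by `s`, at the cost of `x_l` per unit of
  length. The player leaves the configuration unchanged until that instant, when it may move. -/
  | elongate {T : GameTree} {x : ℕ → ℕ} {c : ℝ} (l : ℕ) (s : ℝ) :
      Reach S T x c → l ∈ T.leaves → 2 ≤ x l → 0 ≤ s →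
      (∀ s', 0 ≤ s' → s' < s → S.respond (T.elongate l s') x (T.elongate l s') = x) →
      Reach S (T.elongate l s) (S.respond (T.elongate l s) x (T.elongate l s))
        (c + s * (x l : ℝ) + (T.elongate l s).transport x
          (S.respond (T.elongate l s) x (T.elongate l s)))
  /-- A leaf that hosts at least three robots receives `m` children, with `2 ≤ m ≤ x_l - 1`. -/
  | fork {T : GameTree} {x : ℕ → ℕ} {c : ℝ} (l : ℕ) (C : Finset ℕ) (T' : GameTree) :
      Reach S T x c → l ∈ T.leaves → Disjoint C T.verts → 2 ≤ C.card → C.card + 1 ≤ x l →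
      T' = T.fork l C (S.forkLen T x l C.card) →
      Reach S T' (S.respond T x T') (c + T'.transport x (S.respond T x T'))
  /-- A leaf is killed, and its robots have to go to other leaves. Merging two edges does not change
  distances, hence the cost is computed in the tree before the deletion. -/
  | kill {T : GameTree} {x : ℕ → ℕ} {c : ℝ} (l : ℕ) :
      Reach S T x c → l ∈ T.leaves → 2 ≤ T.leaves.card →
      Reach S (T.kill l) (S.respond T x (T.kill l)) (c + T.transport x (S.respond T x (T.kill l)))

/-- `S` is `f`-bounded: whatever the adversary does, all the robots attain depth `D` with a cost of
at most `f D`, i.e. as long as the depth of the highest leaf does not exceed `D`, neither does the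
cost exceed `f D`. -/
def IsBounded (S : CTMStrategy k) (f : ℝ → ℝ) : Prop :=
  ∀ (T : GameTree) (x : ℕ → ℕ) (c : ℝ), S.Reach T x c →
    ∀ D : ℝ, (∃ l ∈ T.leaves, T.depth l ≤ D) → c ≤ f D

end CTMStrategy

/-! ## Finite rooted trees with labelled edges -/

/-- A finite rooted tree. A node is the list of the labels of the edges on the way up from that node
to the root: the root is `[]`, the children of `u` are of the form `i :: u`, and the parent of a node
`u ≠ []` is `u.tail`. -/
structure RTree where
  nodes : Finset (List ℕ)
  root_mem : [] ∈ nodes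
  parent_mem : ∀ (i : ℕ) (u : List ℕ), i :: u ∈ nodes → u ∈ nodes

/-- The number of edges on a longest path down from the root. -/
def RTree.depth (T : RTree) : ℕ := T.nodes.sup List.length

/-! ## Collective tree exploration -/

/-- In each round a robot stays, goes to the parent, or goes down along the edge with label `i`. -/
inductive Step where
  | stay
  | up
  | down (i : ℕ)

/-- The new position of a robot. Impossible steps have no effect. -/
def Step.apply (T : RTree) (u : List ℕ) : Step → List ℕ
  | .stay => u
  | .up => u.tail
  | .down i => if i :: u ∈ T.nodes then i :: u else u

/-- What the team knows at some time: the nodes that were visited, the discovered nodes, i.e. the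
visited ones and the lower ends of the dangling edges, and the positions of the `k` robots. -/
structure CTEView (k : ℕ) where
  visited : Finset (List ℕ)
  discovered : Finset (List ℕ)
  pos : Fin k → List ℕ

/-- The view of the team in the tree `T`: visiting a node reveals all the edges adjacent to it. -/
def CTEView.of {k : ℕ} (T : RTree) (visited : Finset (List ℕ)) (pos : Fin k → List ℕ) :
    CTEView k where
  visited := visited
  discovered := T.nodes.filter fun u => u.tail ∈ visited
  pos := pos

/-- A (deterministic, centralized) collective exploration algorithm for `k` robots: the steps of all
the robots as a function of the present view and of the list of past views, the latest one first. -/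
def CTEAlgorithm (k : ℕ) : Type := CTEView k → List (CTEView k) → Fin k → Step

namespace CTEAlgorithm

variable {k : ℕ}

/-- The present view and the past views after `t` rounds. All robots start at the root. -/
def run (A : CTEAlgorithm k) (T : RTree) : ℕ → CTEView k × List (CTEView k)
  | 0 => (CTEView.of T {[]} (fun _ => []), [])
  | t + 1 =>
    let v := (run A T t).1
    let past := (run A T t).2
    let pos := fun i => (A v past i).apply T (v.pos i)
    (CTEView.of T (v.visited ∪ Finset.univ.image pos) pos, v :: past)

/-- After `t` rounds all edges have been traversed, i.e. all nodes have been visited, and all robots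
are at the root. -/
def Finished (A : CTEAlgorithm k) (T : RTree) (t : ℕ) : Prop :=
  (A.run T t).1.visited = T.nodes ∧ ∀ i, (A.run T t).1.pos i = []

/-- The number of rounds before termination (`⊤` if the algorithm does not terminate on `T`). -/
def runtime (A : CTEAlgorithm k) (T : RTree) : ℕ∞ :=
  sInf {r : ℕ∞ | ∃ t : ℕ, A.Finished T t ∧ r = t}

end CTEAlgorithm

/-! ## Layered tree traversal -/

/-- A tree whose edges have length `0` or `1` (`len u` is the length of the edge between `u` and its
parent), with a target in its last layer. The layer `i` consists of the nodes at combinatorial depth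
`i`. -/
structure LayeredTree extends RTree where
  len : List ℕ → ℕ
  len_le_one : ∀ u, len u ≤ 1
  target : List ℕ
  target_mem : target ∈ nodes
  target_last : ∀ u ∈ nodes, u.length ≤ target.length

/-- What the searcher is shown: some layers, with the lengths of their edges. -/
structure LTTView where
  nodes : Finset (List ℕ)
  len : List ℕ → ℕ

namespace LayeredTree

/-- The nodes at combinatorial depth `i`. -/
def layer (T : LayeredTree) (i : ℕ) : Finset (List ℕ) := T.nodes.filter fun u => u.length = i

/-- The layers `0, …, i` and the lengths of the edges between them. -/
def reveal (T : LayeredTree) (i : ℕ) : LTTView where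
  nodes := T.nodes.filter fun u => u.length ≤ i
  len := fun u => if u ∈ T.nodes ∧ u.length ≤ i then T.len u else 0

/-- The distance between two nodes: the nodes below which the path from `u` to `v` uses the edge to
the parent are those which have exactly one of `u` and `v` among their descendants. -/
def dist (T : LayeredTree) (u v : List ℕ) : ℕ :=
  ∑ w ∈ symmDiff u.tails.toFinset v.tails.toFinset, T.len w

/-- The sum of all edge lengths. -/
def length (T : LayeredTree) : ℕ := ∑ u ∈ T.nodes.erase [], T.len u

/-- The distance from the root to the target. -/
def depth (T : LayeredTree) : ℕ := T.dist [] T.target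

end LayeredTree

/-- A deterministic algorithm for layered tree traversal: it maps the layers that have been revealed
and the position of the searcher in the last but one of them to a position in the last one. -/
structure LTTAlgorithm where
  next : LTTView → List ℕ → List ℕ
  next_mem : ∀ (T : LayeredTree) (i : ℕ) (u : List ℕ), i < T.target.length → u ∈ T.layer i →
    next (T.reveal (i + 1)) u ∈ T.layer (i + 1)

namespace LTTAlgorithm

/-- The position of the searcher in the layer `i`. -/
def pos (A : LTTAlgorithm) (T : LayeredTree) : ℕ → List ℕ
  | 0 => []
  | i + 1 => A.next (T.reveal (i + 1)) (A.pos T i)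

/-- The distance travelled by the searcher, through all layers and finally to the target. The last
term vanishes when the last layer is reduced to the target. -/
def cost (A : LTTAlgorithm) (T : LayeredTree) : ℕ :=
  (∑ i ∈ Finset.range T.target.length, T.dist (A.pos T i) (A.pos T (i + 1))) +
    T.dist (A.pos T T.target.length) T.target

end LTTAlgorithm

/-- A randomized algorithm is a probability distribution over deterministic ones. -/
abbrev RandomizedLTTAlgorithm : Type := PMF LTTAlgorithm

/-- The expected cost of a randomized algorithm. -/
def RandomizedLTTAlgorithm.expectedCost (A : RandomizedLTTAlgorithm) (T : LayeredTree) : ℝ≥0∞ :=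
  ∑' B : LTTAlgorithm, A B * (B.cost T : ℝ≥0∞)

end TreeMining

end

/-!
The robots of an exploration imitate a game of tree-mining whose tree is the part of the explored
tree that is covered so far. A leaf of the game that hosts at least two robots sits at a node of
the explored tree. Once all the children of this node have been visited, the leaf is forked if
several of them are open, it goes on along the edge if one of them is, and it is killed if none is.
A leaf that hosts a single robot may stay inside an edge, which this robot goes through on its own.

Let `Y v` be the number of robots below the node `v`, and `X v` the number of robots that the game
requests there. A robot at `v` goes to a child that has not been visited, or else to a child `w`
with `Y w < X w`; if there is none, then `X v < Y v` and it goes up. If a proportion `λ v` of the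
edge above `v` is covered, then

  `moves ≤ cost + ∑ v ≠ root, (1 + λ v - λ v * |Y v - X v|)`,

since a discovery adds a term to the sum, any other move decreases some `|Y v - X v|`, and the
transports and the elongations are paid for by the cost. Hence `2 * #edges + f k D` moves are
enough. This bounds `k` times the number of rounds in which no robot is idle; and in a layered
tree, whose edges of length zero are contracted, it bounds the sum of the costs of the `k` searchers
that imitate the robots.
-/

noncomputable section

open scoped ENNReal

open Classical

namespace TreeMining

namespace GameTree

variable {T : GameTree} {l u v w : ℕ}

/-- A finite tree rooted at `0` with nonnegative edge lengths. Unlike in `IsSimple`, nodes with a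
single child are allowed, as they occur halfway through the deletion of a leaf. -/
structure IsWeightedTree (T : GameTree) : Prop where
  root_mem : 0 ∈ T.verts
  parent_root : T.parent 0 = 0
  parent_mem : ∀ v ∈ T.verts, T.parent v ∈ T.verts
  isDesc_root : ∀ v ∈ T.verts, T.IsDesc v 0
  len_nonneg : ∀ v ∈ T.verts, v ≠ 0 → 0 ≤ T.len v

theorem IsSimple.isWeightedTree (hT : T.IsSimple) : T.IsWeightedTree :=
  ⟨hT.root_mem, hT.parent_root, hT.parent_mem, hT.reaches_root, hT.len_nonneg⟩

theorem mem_leaves : v ∈ T.leaves ↔ v ∈ T.verts ∧ T.children v = ∅ := by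
  simp [leaves]

theorem mem_children : u ∈ T.children v ↔ u ∈ T.verts ∧ u ≠ 0 ∧ T.parent u = v := by
  simp [children]

theorem mem_children_parent (hv : v ∈ T.verts) (hv0 : v ≠ 0) : v ∈ T.children (T.parent v) :=
  mem_children.2 ⟨hv, hv0, rfl⟩

theorem leaves_subset_verts (T : GameTree) : T.leaves ⊆ T.verts := Finset.filter_subset _ _

namespace IsDesc

theorem refl (T : GameTree) (u : ℕ) : T.IsDesc u u := ⟨0, rfl⟩

theorem trans (huv : T.IsDesc u v) (hvw : T.IsDesc v w) : T.IsDesc u w := by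
  obtain ⟨i, rfl⟩ := huv
  obtain ⟨j, rfl⟩ := hvw
  exact ⟨j + i, by rw [Function.iterate_add_apply]⟩

end IsDesc

theorem isDesc_parent (T : GameTree) (u : ℕ) : T.IsDesc u (T.parent u) := ⟨1, rfl⟩

theorem isDesc_iff_eq_or_parent : T.IsDesc u w ↔ u = w ∨ T.IsDesc (T.parent u) w := by
  constructor
  · rintro ⟨_ | i, rfl⟩
    · exact Or.inl rfl
    · exact Or.inr ⟨i, rfl⟩
  · rintro (rfl | h)
    · exact IsDesc.refl T u
    · exact (isDesc_parent T u).trans h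

namespace IsWeightedTree

variable (hT : T.IsWeightedTree)
include hT

theorem eq_root_of_isDesc (h : T.IsDesc 0 u) : u = 0 := by
  obtain ⟨i, rfl⟩ := h
  exact Function.iterate_fixed hT.parent_root i

theorem iterate_parent_mem (hv : v ∈ T.verts) (i : ℕ) : T.parent^[i] v ∈ T.verts :=
  (show Set.MapsTo T.parent T.verts T.verts from hT.parent_mem).iterate i hv

theorem parent_ne (hv : v ∈ T.verts) (hv0 : v ≠ 0) : T.parent v ≠ v := by
  intro h
  obtain ⟨i, hi⟩ := hT.isDesc_root v hv
  rw [Function.iterate_fixed h] at hi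
  exact hv0 hi

theorem eq_of_parent_eq_leaf (hl : l ∈ T.leaves) (hv : v ∈ T.verts) (h : T.parent v = l) :
    v = l := by
  rcases eq_or_ne v 0 with rfl | hv0
  · exact hT.parent_root.symm.trans h
  · have : v ∈ T.children l := mem_children.2 ⟨hv, hv0, h⟩
    simp [(mem_leaves.1 hl).2] at this

theorem eq_of_isDesc_leaf (hl : l ∈ T.leaves) (hv : v ∈ T.verts) (h : T.IsDesc v l) : v = l := by
  obtain ⟨i, hi⟩ := h
  induction i with
  | zero => exact hi
  | succ i ih =>
    rw [Function.iterate_succ_apply'] at hi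
    exact ih (hT.eq_of_parent_eq_leaf hl (hT.iterate_parent_mem hv i) hi)

theorem exists_child_root_of_isDesc (hv : v ∈ T.verts) (hv0 : v ≠ 0) :
    ∃ u ∈ T.children 0, T.IsDesc v u := by
  obtain ⟨i, hi⟩ := hT.isDesc_root v hv
  induction i generalizing v with
  | zero => exact absurd hi hv0
  | succ i ih =>
    by_cases hp : T.parent v = 0
    · exact ⟨v, hp ▸ mem_children_parent hv hv0, IsDesc.refl T v⟩
    · obtain ⟨u, hu, hvu⟩ := ih (hT.parent_mem v hv) hp hi
      exact ⟨u, hu, (isDesc_parent T v).trans hvu⟩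

theorem load_leaf (hl : l ∈ T.leaves) (x : ℕ → ℕ) : T.load x l = x l := by
  have hdesc : T.verts.filter (fun v => T.IsDesc v l) = {l} := by
    ext v
    simp only [Finset.mem_filter, Finset.mem_singleton]
    constructor
    · exact fun h => hT.eq_of_isDesc_leaf hl h.1 h.2
    · rintro rfl
      exact ⟨T.leaves_subset_verts hl, IsDesc.refl T v⟩
  rw [load, hdesc, Finset.sum_singleton]

theorem transport_nonneg (x x' : ℕ → ℕ) : 0 ≤ T.transport x x' :=
  Finset.sum_nonneg fun u hu => mul_nonneg
    (hT.len_nonneg u (Finset.mem_of_mem_erase hu) (Finset.ne_of_mem_erase hu)) (abs_nonneg _)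

theorem len_mul_abs_sub_le_transport (hl : l ∈ T.leaves) (hl0 : l ≠ 0) (x x' : ℕ → ℕ) :
    T.len l * |(x l : ℝ) - x' l| ≤ T.transport x x' := by
  have h := Finset.single_le_sum (s := T.verts.erase 0)
    (f := fun u => T.len u * |(T.load x u : ℝ) - (T.load x' u : ℝ)|)
    (fun u hu => mul_nonneg
      (hT.len_nonneg u (Finset.mem_of_mem_erase hu) (Finset.ne_of_mem_erase hu)) (abs_nonneg _))
    (Finset.mem_erase.2 ⟨hl0, T.leaves_subset_verts hl⟩)
  rwa [hT.load_leaf hl, hT.load_leaf hl] at h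

theorem depth_eq_transport (hv : v ∈ T.verts) :
    T.depth v = T.transport (Pi.single v 1) (Pi.single 0 1) := by
  have hfilter : T.verts.filter (fun u => u ≠ 0 ∧ T.IsDesc v u) =
      (T.verts.erase 0).filter (fun u => T.IsDesc v u) := by
    ext
    simp only [Finset.mem_filter, Finset.mem_erase]
    tauto
  rw [depth, transport, hfilter, Finset.sum_filter]
  refine Finset.sum_congr rfl fun u hu => ?_
  have load_root : T.load (Pi.single 0 1) u = 0 := by
    refine Finset.sum_eq_zero fun w hw => Pi.single_eq_of_ne ?_ _
    rintro rfl
    exact Finset.ne_of_mem_erase hu (hT.eq_root_of_isDesc (Finset.mem_filter.1 hw).2)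
  have load_self : T.load (Pi.single v 1) u = if T.IsDesc v u then 1 else 0 := by
    simp [load, Finset.sum_pi_single', hv]
  rw [load_root, load_self]
  split_ifs <;> simp

end IsWeightedTree

theorem IsSimple.siblings_nonempty (hT : T.IsSimple) (hl : l ∈ T.leaves) (hl0 : l ≠ 0)
    (htwo : 2 ≤ T.leaves.card) : (T.siblings l).Nonempty := by
  have hW := hT.isWeightedTree
  have hlv := T.leaves_subset_verts hl
  have hlp := mem_children_parent hlv hl0
  by_contra hempty
  have honly : T.children (T.parent l) = {l} := by
    rw [← Finset.insert_erase hlp, ← siblings, Finset.not_nonempty_iff_eq_empty.1 hempty]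
    rfl
  have hp : T.parent l = 0 := by
    by_contra hp
    exact hT.card_children _ (hT.parent_mem l hlv) hp (by rw [honly, Finset.card_singleton])
  obtain ⟨m, hm, hml⟩ := Finset.exists_mem_ne htwo l
  have hmv := T.leaves_subset_verts hm
  have hm0 : m ≠ 0 := by
    rintro rfl
    rw [hp, (mem_leaves.1 hm).2] at hlp
    exact Finset.notMem_empty l hlp
  obtain ⟨u, hu, hmu⟩ := hW.exists_child_root_of_isDesc hmv hm0
  rw [← hp, honly, Finset.mem_singleton] at hu
  exact hml (hW.eq_of_isDesc_leaf hl hmv (hu ▸ hmu))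

/-- The trees that occur in the game: the root is not a leaf, and as soon as there are two leaves,
their edges have a positive length. -/
structure IsPlayable (T : GameTree) : Prop extends T.IsSimple where
  root_not_leaf : 0 ∉ T.leaves
  len_pos : 2 ≤ T.leaves.card → ∀ l ∈ T.leaves, 0 < T.len l

theorem IsPlayable.ne_zero (hT : T.IsPlayable) (hl : l ∈ T.leaves) : l ≠ 0 := by
  rintro rfl
  exact hT.root_not_leaf hl

theorem leaves_start : start.leaves = {1} := by
  ext v
  simp only [mem_leaves, children, start, Finset.mem_insert, Finset.mem_singleton,
    Finset.filter_eq_empty_iff]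
  constructor
  · rintro ⟨rfl | rfl, h⟩
    · exact absurd ⟨one_ne_zero, rfl⟩ (h (Or.inr rfl))
    · rfl
  · rintro rfl
    exact ⟨Or.inr rfl, fun _ _ h => zero_ne_one h.2⟩

theorem isPlayable_start : start.IsPlayable where
  root_mem := by simp [start]
  parent_root := rfl
  parent_mem v _ := by simp [start]
  reaches_root v _ := ⟨1, rfl⟩
  len_nonneg v _ _ := le_rfl
  card_children v hv hv0 := by
    have hleaf : v ∈ start.leaves := by
      rw [leaves_start, Finset.mem_singleton]
      simpa [start, hv0] using hv
    simp [(mem_leaves.1 hleaf).2]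
  root_not_leaf := by simp [leaves_start]
  len_pos := by simp [leaves_start]

theorem transport_start (x x' : ℕ → ℕ) : start.transport x x' = 0 :=
  Finset.sum_eq_zero fun u _ => by simp [start]

end GameTree

namespace GameTree

variable {T : GameTree} {l v : ℕ} {s : ℝ}

theorem len_elongate (T : GameTree) (l : ℕ) (s : ℝ) (v : ℕ) :
    (T.elongate l s).len v = T.len v + if v = l then s else 0 := by
  by_cases h : v = l <;> simp [elongate, h]

theorem len_le_len_elongate (hs : 0 ≤ s) : T.len v ≤ (T.elongate l s).len v := by
  rw [len_elongate]
  split_ifs <;> linarith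

theorem IsPlayable.elongate (hT : T.IsPlayable) (hs : 0 ≤ s) : (T.elongate l s).IsPlayable where
  root_mem := hT.root_mem
  parent_root := hT.parent_root
  parent_mem := hT.parent_mem
  reaches_root := hT.reaches_root
  len_nonneg v hv hv0 := (hT.len_nonneg v hv hv0).trans (len_le_len_elongate hs)
  card_children := hT.card_children
  root_not_leaf := hT.root_not_leaf
  len_pos htwo v hv := (hT.len_pos htwo v hv).trans_le (len_le_len_elongate hs)

theorem IsWeightedTree.transport_elongate (hT : T.IsWeightedTree) (hl : l ∈ T.leaves)
    (hl0 : l ≠ 0) (s : ℝ) (x x' : ℕ → ℕ) :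
    (T.elongate l s).transport x x' = T.transport x x' + s * |(x l : ℝ) - x' l| := by
  have hmem : l ∈ T.verts.erase 0 := Finset.mem_erase.2 ⟨hl0, T.leaves_subset_verts hl⟩
  change ∑ u ∈ T.verts.erase 0, (T.elongate l s).len u * |(T.load x u : ℝ) - T.load x' u| =
    ∑ u ∈ T.verts.erase 0, T.len u * |(T.load x u : ℝ) - T.load x' u| + _
  simp only [len_elongate, add_mul, Finset.sum_add_distrib, ite_mul, zero_mul,
    Finset.sum_ite_eq', hmem, if_true, hT.load_leaf hl]

theorem IsWeightedTree.depth_elongate (hT : T.IsWeightedTree) (hl : l ∈ T.leaves)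
    (hl0 : l ≠ 0) (hv : v ∈ T.verts) (s : ℝ) :
    (T.elongate l s).depth v = T.depth v + if v = l then s else 0 := by
  have hdesc : T.IsDesc v l ↔ v = l :=
    ⟨hT.eq_of_isDesc_leaf hl hv, fun h => h ▸ IsDesc.refl T v⟩
  change ∑ u ∈ T.verts.filter (fun u => u ≠ 0 ∧ T.IsDesc v u), (T.elongate l s).len u =
    ∑ u ∈ T.verts.filter (fun u => u ≠ 0 ∧ T.IsDesc v u), T.len u + _
  simp only [len_elongate, Finset.sum_add_distrib, Finset.sum_ite_eq', Finset.mem_filter,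
    T.leaves_subset_verts hl, hl0, hdesc, ne_eq, not_false_eq_true, true_and]

/-- The distribution `x` after the robots on the elements of `C` are sent to `l`. -/
def gather (l : ℕ) (C : Finset ℕ) (x : ℕ → ℕ) (u : ℕ) : ℕ :=
  if u = l then x l + ∑ c ∈ C, x c else if u ∈ C then 0 else x u

theorem gather_self (l : ℕ) (C : Finset ℕ) (x : ℕ → ℕ) : gather l C x l = x l + ∑ c ∈ C, x c :=
  if_pos rfl

theorem gather_of_ne {C : Finset ℕ} (x : ℕ → ℕ) (hvl : v ≠ l) (hvC : v ∉ C) :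
    gather l C x v = x v := by
  rw [gather, if_neg hvl, if_neg hvC]

section Fork

variable {C : Finset ℕ} {δ : ℝ} {u w c : ℕ}

theorem verts_fork (T : GameTree) (l : ℕ) (C : Finset ℕ) (δ : ℝ) :
    (T.fork l C δ).verts = T.verts ∪ C := rfl

theorem parent_fork_of_mem (hc : c ∈ C) : (T.fork l C δ).parent c = l := if_pos hc

theorem parent_fork_of_notMem (hu : u ∉ C) : (T.fork l C δ).parent u = T.parent u := if_neg hu

theorem len_fork_of_mem (hc : c ∈ C) : (T.fork l C δ).len c = δ := if_pos hc

theorem len_fork_of_notMem (hu : u ∉ C) : (T.fork l C δ).len u = T.len u := if_neg hu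

theorem children_fork_of_ne (hC : Disjoint C T.verts) (hvl : v ≠ l) :
    (T.fork l C δ).children v = T.children v := by
  ext u
  rw [mem_children, mem_children, verts_fork, Finset.mem_union]
  by_cases huC : u ∈ C
  · simp [parent_fork_of_mem huC, hvl.symm, Finset.disjoint_left.1 hC huC]
  · simp only [huC, or_false, parent_fork_of_notMem huC]

theorem IsWeightedTree.children_eq_empty (hT : T.IsWeightedTree) (hv : v ∉ T.verts) :
    T.children v = ∅ := by
  refine Finset.eq_empty_of_forall_notMem fun u hu => hv ?_
  obtain ⟨huT, -, rfl⟩ := mem_children.1 hu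
  exact hT.parent_mem u huT

namespace IsWeightedTree

variable (hT : T.IsWeightedTree) (hC : Disjoint C T.verts)
include hT hC

theorem isDesc_fork_old (hu : u ∈ T.verts) : (T.fork l C δ).IsDesc u w ↔ T.IsDesc u w := by
  have iterate_eq (i : ℕ) : (T.fork l C δ).parent^[i] u = T.parent^[i] u := by
    induction i with
    | zero => rfl
    | succ i ih =>
      rw [Function.iterate_succ_apply', Function.iterate_succ_apply', ih, parent_fork_of_notMem
        (Finset.disjoint_right.1 hC (hT.iterate_parent_mem hu i))]
  simp only [IsDesc, iterate_eq]

theorem isDesc_fork_new (hl : l ∈ T.verts) (hc : c ∈ C) :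
    (T.fork l C δ).IsDesc c w ↔ c = w ∨ T.IsDesc l w := by
  rw [isDesc_iff_eq_or_parent, parent_fork_of_mem hc, hT.isDesc_fork_old hC hl]

theorem fork (hl : l ∈ T.verts) (hδ : 0 ≤ δ) : (T.fork l C δ).IsWeightedTree where
  root_mem := Finset.mem_union_left _ hT.root_mem
  parent_root := by
    rw [parent_fork_of_notMem (Finset.disjoint_right.1 hC hT.root_mem), hT.parent_root]
  parent_mem v hv := by
    refine Finset.mem_union_left _ ?_
    by_cases hvC : v ∈ C
    · rwa [parent_fork_of_mem hvC]
    · rw [parent_fork_of_notMem hvC]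
      exact hT.parent_mem v ((Finset.mem_union.1 hv).resolve_right hvC)
  isDesc_root v hv := by
    rcases Finset.mem_union.1 hv with hv | hv
    · exact (hT.isDesc_fork_old hC hv).2 (hT.isDesc_root v hv)
    · exact (hT.isDesc_fork_new hC hl hv).2 (Or.inr (hT.isDesc_root l hl))
  len_nonneg v hv hv0 := by
    by_cases hvC : v ∈ C
    · rwa [len_fork_of_mem hvC]
    · rw [len_fork_of_notMem hvC]
      exact hT.len_nonneg v ((Finset.mem_union.1 hv).resolve_right hvC) hv0

theorem children_fork_self (hl : l ∈ T.leaves) : (T.fork l C δ).children l = C := by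
  ext u
  rw [mem_children, verts_fork, Finset.mem_union]
  by_cases huC : u ∈ C
  · have hu0 : u ≠ 0 := fun h => Finset.disjoint_left.1 hC huC (h ▸ hT.root_mem)
    simp [huC, hu0, parent_fork_of_mem huC]
  · have : u ∉ T.children l := by simp [(mem_leaves.1 hl).2]
    rw [mem_children] at this
    simp only [parent_fork_of_notMem huC]
    tauto

theorem leaves_fork (hl : l ∈ T.leaves) (hne : C.Nonempty) :
    (T.fork l C δ).leaves = T.leaves.erase l ∪ C := by
  ext v
  have hlC : l ∉ C := Finset.disjoint_right.1 hC (T.leaves_subset_verts hl)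
  rw [mem_leaves, verts_fork, Finset.mem_union, Finset.mem_union, Finset.mem_erase, mem_leaves]
  rcases eq_or_ne v l with rfl | hvl
  · simp [hT.children_fork_self hC hl, hne.ne_empty, hlC]
  · rw [children_fork_of_ne hC hvl]
    have hnew (hvC : v ∈ C) : T.children v = ∅ :=
      hT.children_eq_empty (Finset.disjoint_left.1 hC hvC)
    tauto

theorem load_fork_old (hl : l ∈ T.verts) (x : ℕ → ℕ) (hu : u ∈ T.verts) :
    (T.fork l C δ).load x u = T.load (gather l C x) u := by
  have old_desc : T.verts.filter (fun v => (T.fork l C δ).IsDesc v u) =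
      T.verts.filter (fun v => T.IsDesc v u) :=
    Finset.filter_congr fun v hv => hT.isDesc_fork_old hC hv
  have new_desc : ∀ c ∈ C, (T.fork l C δ).IsDesc c u ↔ T.IsDesc l u := by
    intro c hc
    rw [hT.isDesc_fork_new hC hl hc, or_iff_right]
    rintro rfl
    exact Finset.disjoint_left.1 hC hc hu
  have gather_old : ∀ v ∈ T.verts, v ≠ l → gather l C x v = x v := fun v hv hvl =>
    gather_of_ne x hvl (Finset.disjoint_right.1 hC hv)
  rw [load, load, verts_fork, Finset.filter_union,
    Finset.sum_union (Finset.disjoint_filter_filter hC.symm), old_desc,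
    Finset.filter_congr new_desc, Finset.filter_const]
  by_cases hlu : T.IsDesc l u
  · have hmem : l ∈ T.verts.filter (fun v => T.IsDesc v u) := Finset.mem_filter.2 ⟨hl, hlu⟩
    rw [if_pos hlu, ← Finset.add_sum_erase _ _ hmem, ← Finset.add_sum_erase _ _ hmem, gather_self,
      add_right_comm]
    congr 1
    refine Finset.sum_congr rfl fun v hv => (gather_old v ?_ (Finset.ne_of_mem_erase hv)).symm
    exact (Finset.mem_filter.1 (Finset.mem_of_mem_erase hv)).1
  · rw [if_neg hlu, Finset.sum_empty, add_zero]
    refine Finset.sum_congr rfl fun v hv => (gather_old v (Finset.mem_filter.1 hv).1 ?_).symm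
    rintro rfl
    exact hlu (Finset.mem_filter.1 hv).2

theorem transport_fork (hl : l ∈ T.leaves) (hδ : 0 ≤ δ) (x x' : ℕ → ℕ) :
    (T.fork l C δ).transport x x' =
      T.transport (gather l C x) (gather l C x') + δ * ∑ c ∈ C, |(x c : ℝ) - x' c| := by
  have hlv := T.leaves_subset_verts hl
  have h0C : 0 ∉ C := Finset.disjoint_right.1 hC hT.root_mem
  have hdisj : Disjoint (T.verts.erase 0) C := hC.symm.mono_left (Finset.erase_subset _ _)
  have old_term : ∀ u ∈ T.verts.erase 0, (T.fork l C δ).len u *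
      |((T.fork l C δ).load x u : ℝ) - (T.fork l C δ).load x' u| =
      T.len u * |(T.load (gather l C x) u : ℝ) - T.load (gather l C x') u| := by
    intro u hu
    rw [len_fork_of_notMem (Finset.disjoint_left.1 hdisj hu),
      hT.load_fork_old hC hlv x (Finset.mem_of_mem_erase hu),
      hT.load_fork_old hC hlv x' (Finset.mem_of_mem_erase hu)]
  have new_term : ∀ c ∈ C, (T.fork l C δ).len c *
      |((T.fork l C δ).load x c : ℝ) - (T.fork l C δ).load x' c| = δ * |(x c : ℝ) - x' c| := by
    intro c hc
    have hleaf : c ∈ (T.fork l C δ).leaves := by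
      rw [hT.leaves_fork hC hl ⟨c, hc⟩]
      exact Finset.mem_union_right _ hc
    rw [len_fork_of_mem hc, (hT.fork hC hlv hδ).load_leaf hleaf,
      (hT.fork hC hlv hδ).load_leaf hleaf]
  rw [transport, transport, verts_fork, Finset.erase_union_distrib, Finset.erase_eq_of_notMem h0C,
    Finset.sum_union hdisj, Finset.sum_congr rfl old_term, Finset.sum_congr rfl new_term,
    Finset.mul_sum]

theorem depth_fork_old (hv : v ∈ T.verts) : (T.fork l C δ).depth v = T.depth v := by
  have mem_old (u : ℕ) (hvu : T.IsDesc v u) : u ∈ T.verts := by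
    obtain ⟨i, rfl⟩ := hvu
    exact hT.iterate_parent_mem hv i
  refine Finset.sum_congr ?_ fun u hu => ?_
  · ext u
    simp only [verts_fork, Finset.mem_filter, Finset.mem_union, hT.isDesc_fork_old hC hv]
    have := mem_old u
    tauto
  · refine len_fork_of_notMem (Finset.disjoint_right.1 hC (mem_old u ?_))
    exact (Finset.mem_filter.1 hu).2.2

theorem depth_fork_new (hl : l ∈ T.verts) (hc : c ∈ C) :
    (T.fork l C δ).depth c = T.depth l + δ := by
  have hc0 : c ≠ 0 := fun h => Finset.disjoint_left.1 hC hc (h ▸ hT.root_mem)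
  have hcv : c ∉ (T.fork l C δ).verts.filter (fun u => u ≠ 0 ∧ (T.fork l C δ).IsDesc l u) := by
    rw [Finset.mem_filter, hT.isDesc_fork_old hC hl]
    rintro ⟨-, -, i, hi⟩
    exact Finset.disjoint_left.1 hC hc (hi ▸ hT.iterate_parent_mem hl i)
  have hfilter : (T.fork l C δ).verts.filter (fun u => u ≠ 0 ∧ (T.fork l C δ).IsDesc c u) =
      insert c ((T.fork l C δ).verts.filter fun u => u ≠ 0 ∧ (T.fork l C δ).IsDesc l u) := by
    ext u
    simp only [Finset.mem_filter, Finset.mem_insert, hT.isDesc_fork_new hC hl hc,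
      hT.isDesc_fork_old hC hl]
    have : c ∈ (T.fork l C δ).verts := Finset.mem_union_right _ hc
    grind
  rw [depth, hfilter, Finset.sum_insert hcv, len_fork_of_mem hc, ← depth, hT.depth_fork_old hC hl,
    add_comm]

end IsWeightedTree

theorem IsPlayable.fork (hT : T.IsPlayable) (hC : Disjoint C T.verts) (hl : l ∈ T.leaves)
    (htwo : 2 ≤ C.card) (hδ : 0 < δ) : (T.fork l C δ).IsPlayable := by
  have hW := hT.isWeightedTree
  have hF := hW.fork hC (T.leaves_subset_verts hl) hδ.le
  have hleaves := hW.leaves_fork (δ := δ) hC hl (Finset.card_pos.1 (by omega))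
  refine ⟨⟨hF.root_mem, hF.parent_root, hF.parent_mem, hF.isDesc_root, hF.len_nonneg, ?_⟩, ?_, ?_⟩
  · intro v hv hv0
    rcases eq_or_ne v l with rfl | hvl
    · rw [hW.children_fork_self hC hl]
      omega
    · rw [children_fork_of_ne hC hvl]
      rcases Finset.mem_union.1 hv with hv | hv
      · exact hT.card_children v hv hv0
      · simp [hW.children_eq_empty (Finset.disjoint_left.1 hC hv)]
  · simp [hleaves, hT.root_not_leaf, Finset.disjoint_right.1 hC hT.root_mem]
  · intro _ v hv
    by_cases hvC : v ∈ C
    · rwa [len_fork_of_mem hvC]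
    · rw [hleaves, Finset.mem_union, or_iff_left hvC, Finset.mem_erase] at hv
      rw [len_fork_of_notMem hvC]
      exact hT.len_pos (Finset.one_lt_card.2 ⟨v, hv.2, l, hl, hv.1⟩) v hv.2

theorem IsWeightedTree.isConfig_gather {k : ℕ} {x : ℕ → ℕ} (hT : T.IsWeightedTree)
    (hC : Disjoint C T.verts) (hl : l ∈ T.leaves) (hne : C.Nonempty)
    (hx : (T.fork l C δ).IsConfig k x) : T.IsConfig k (gather l C x) := by
  have hleaves := hT.leaves_fork (δ := δ) hC hl hne
  have hdisj : Disjoint T.leaves C := hC.symm.mono_left T.leaves_subset_verts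
  have hxl : x l = 0 := hx.1 l (by simp [hleaves, Finset.disjoint_left.1 hdisj hl])
  refine ⟨fun v hv => ?_, ?_⟩
  · have hvl : v ≠ l := fun h => hv (h ▸ hl)
    by_cases hvC : v ∈ C
    · rw [gather, if_neg hvl, if_pos hvC]
    · rw [gather_of_ne x hvl hvC]
      exact hx.1 v (by simp [hleaves, hvC, hv])
  · have gather_old : ∀ v ∈ T.leaves.erase l, gather l C x v = x v := fun v hv =>
      gather_of_ne x (Finset.ne_of_mem_erase hv)
        (Finset.disjoint_left.1 hdisj (Finset.mem_of_mem_erase hv))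
    rw [← Finset.add_sum_erase _ _ hl, gather_self, hxl, zero_add,
      Finset.sum_congr rfl gather_old, add_comm, ← hx.2, hleaves,
      Finset.sum_union (hdisj.mono_left (Finset.erase_subset _ _))]

end Fork

end GameTree

namespace GameTree

variable {T : GameTree} {l p u v w : ℕ} {x x' : ℕ → ℕ}

/-- The deletion of a leaf, without the suppression of a node that is left with a single child. -/
def prune (T : GameTree) (l : ℕ) : GameTree where
  verts := T.verts.erase l
  parent := T.parent
  len := T.len

/-- The suppression of a node `p` with a single child `u`: the edges `(u, p)` and `(p, p(p))` are
merged. -/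
def suppress (T : GameTree) (p u : ℕ) : GameTree where
  verts := T.verts.erase p
  parent := Function.update T.parent u (T.parent p)
  len := Function.update T.len u (T.len p + T.len u)

theorem kill_eq_prune (h : ¬(T.parent l ≠ 0 ∧ (T.siblings l).card = 1)) : T.kill l = T.prune l :=
  if_neg h

theorem kill_eq_suppress_prune (hp : T.parent l ≠ 0) (hu : T.siblings l = {u}) :
    T.kill l = (T.prune l).suppress (T.parent l) u := by
  rw [kill, if_pos ⟨hp, by rw [hu, Finset.card_singleton]⟩, hu]
  simp only [suppress, prune, GameTree.mk.injEq, true_and]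
  constructor <;> ext w <;> by_cases hw : w = u <;> simp [hw]

theorem children_prune (T : GameTree) (l v : ℕ) :
    (T.prune l).children v = (T.children v).erase l := by
  ext u
  simp only [mem_children, prune, Finset.mem_erase]
  tauto

theorem kill_cases {P : GameTree → Prop}
    (hprune : (T.parent l ≠ 0 → (T.siblings l).card ≠ 1) → P (T.prune l))
    (hsuppress : ∀ u, T.parent l ≠ 0 → (T.prune l).children (T.parent l) = {u} →
      P ((T.prune l).suppress (T.parent l) u)) : P (T.kill l) := by
  by_cases h : T.parent l ≠ 0 ∧ (T.siblings l).card = 1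
  · obtain ⟨u, hu⟩ := Finset.card_eq_one.1 h.2
    rw [kill_eq_suppress_prune h.1 hu]
    exact hsuppress u h.1 ((children_prune T l _).trans hu)
  · rw [kill_eq_prune h]
    exact hprune (not_and.1 h)

theorem children_prune_of_ne (hv : v ≠ T.parent l) : (T.prune l).children v = T.children v := by
  rw [children_prune, Finset.erase_eq_of_notMem]
  exact fun hl => hv (mem_children.1 hl).2.2.symm

theorem load_prune (hx : x l = 0) (u : ℕ) : (T.prune l).load x u = T.load x u := by
  refine Finset.sum_subset (Finset.filter_subset_filter _ (Finset.erase_subset _ _)) ?_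
  intro v hv hv'
  suffices v = l by rw [this, hx]
  by_contra hvl
  obtain ⟨hv, hvu⟩ := Finset.mem_filter.1 hv
  exact hv' (Finset.mem_filter.2 ⟨Finset.mem_erase.2 ⟨hvl, hv⟩, hvu⟩)

theorem leaves_prune (hl : (T.siblings l).Nonempty) : (T.prune l).leaves = T.leaves.erase l := by
  ext v
  rw [mem_leaves, Finset.mem_erase, mem_leaves, prune, Finset.mem_erase, ← prune, and_assoc]
  rcases eq_or_ne v (T.parent l) with rfl | hv
  · have hpl : T.children (T.parent l) ≠ ∅ := (hl.mono (Finset.erase_subset _ _)).ne_empty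
    have hpl' : (T.children (T.parent l)).erase l ≠ ∅ := hl.ne_empty
    simp only [children_prune, hpl, hpl', and_false]
  · rw [children_prune_of_ne hv]

namespace IsWeightedTree

variable (hT : T.IsWeightedTree)
include hT

theorem prune (hl : l ∈ T.leaves) (hl0 : l ≠ 0) : (T.prune l).IsWeightedTree where
  root_mem := Finset.mem_erase.2 ⟨hl0.symm, hT.root_mem⟩
  parent_root := hT.parent_root
  parent_mem v hv := by
    have hvT := Finset.mem_of_mem_erase hv
    exact Finset.mem_erase.2 ⟨fun h => Finset.ne_of_mem_erase hv (hT.eq_of_parent_eq_leaf hl hvT h),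
      hT.parent_mem v hvT⟩
  isDesc_root v hv := hT.isDesc_root v (Finset.mem_of_mem_erase hv)
  len_nonneg v hv := hT.len_nonneg v (Finset.mem_of_mem_erase hv)

theorem transport_prune (hl : l ∈ T.leaves) (hx : x l = 0) (hx' : x' l = 0) :
    (T.prune l).transport x x' = T.transport x x' := by
  simp only [transport, load_prune hx, load_prune hx']
  refine Finset.sum_subset (Finset.erase_subset_erase _ (Finset.erase_subset _ _)) ?_
  intro v hv hv'
  suffices v = l by rw [this, hT.load_leaf hl, hT.load_leaf hl, hx, hx']; simp
  by_contra hvl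
  exact hv' (Finset.mem_erase.2 ⟨Finset.ne_of_mem_erase hv,
    Finset.mem_erase.2 ⟨hvl, Finset.mem_of_mem_erase hv⟩⟩)

end IsWeightedTree

section Suppress

theorem verts_suppress (T : GameTree) (p u : ℕ) : (T.suppress p u).verts = T.verts.erase p := rfl

theorem parent_suppress_child : (T.suppress p u).parent u = T.parent p :=
  Function.update_self ..

theorem parent_suppress_of_ne (hv : v ≠ u) : (T.suppress p u).parent v = T.parent v :=
  Function.update_of_ne hv ..

theorem len_suppress_child : (T.suppress p u).len u = T.len p + T.len u :=
  Function.update_self ..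

theorem len_suppress_of_ne (hv : v ≠ u) : (T.suppress p u).len v = T.len v :=
  Function.update_of_ne hv ..

namespace IsWeightedTree

variable (hT : T.IsWeightedTree) (hp0 : p ≠ 0) (hpu : T.children p = {u})
include hT hp0 hpu

omit hT hp0 in
theorem child_spec : u ∈ T.verts ∧ u ≠ 0 ∧ T.parent u = p :=
  mem_children.1 (hpu ▸ Finset.mem_singleton_self u)

theorem parent_eq_iff (hv : v ∈ T.verts) : T.parent v = p ↔ v = u := by
  constructor
  · intro h
    have hv0 : v ≠ 0 := by
      rintro rfl
      exact hp0 (h.symm.trans hT.parent_root)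
    have hmem : v ∈ T.children p := mem_children.2 ⟨hv, hv0, h⟩
    rwa [hpu, Finset.mem_singleton] at hmem
  · rintro rfl
    exact (child_spec hpu).2.2

omit hp0 in
theorem child_ne : u ≠ p := by
  obtain ⟨hu, hu0, hup⟩ := child_spec hpu
  exact fun h => hT.parent_ne hu hu0 (hup.trans h.symm)

omit hT hp0 in
theorem isDesc_of_suppress (h : (T.suppress p u).IsDesc v w) : T.IsDesc v w := by
  obtain ⟨i, rfl⟩ := h
  induction i with
  | zero => exact IsDesc.refl T v
  | succ i ih =>
    refine ih.trans ?_
    rw [Function.iterate_succ_apply']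
    generalize (T.suppress p u).parent^[i] v = y
    rcases eq_or_ne y u with rfl | hy
    · rw [parent_suppress_child, ← (child_spec hpu).2.2]
      exact (isDesc_parent T y).trans (isDesc_parent T _)
    · rw [parent_suppress_of_ne hy]
      exact isDesc_parent T y

theorem isDesc_suppress_of_iterate_eq (hwp : w ≠ p) (i : ℕ) (hv : v ∈ T.verts) (hvp : v ≠ p)
    (hi : T.parent^[i] v = w) : (T.suppress p u).IsDesc v w := by
  induction i using Nat.strong_induction_on generalizing v with
  | _ i ih =>
    match i with
    | 0 => exact hi ▸ IsDesc.refl _ v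
    | i + 1 =>
      refine (isDesc_parent _ v).trans ?_
      rcases eq_or_ne v u with rfl | hvu
      · have hvp' := (child_spec hpu).2.2
        rw [parent_suppress_child]
        rw [Function.iterate_succ_apply, hvp'] at hi
        match i with
        | 0 => exact absurd hi.symm hwp
        | i + 1 =>
          have hpT : p ∈ T.verts := hvp' ▸ hT.parent_mem v hv
          exact ih i (by omega) (hT.parent_mem p hpT) (hT.parent_ne hpT hp0) hi
      · rw [parent_suppress_of_ne hvu]
        exact ih i (by omega) (hT.parent_mem v hv)
          (mt (hT.parent_eq_iff hp0 hpu hv).1 hvu) hi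

theorem isDesc_suppress (hv : v ∈ T.verts) (hvp : v ≠ p) (hwp : w ≠ p) :
    (T.suppress p u).IsDesc v w ↔ T.IsDesc v w :=
  ⟨isDesc_of_suppress hpu,
    fun ⟨i, hi⟩ => hT.isDesc_suppress_of_iterate_eq hp0 hpu hwp i hv hvp hi⟩

theorem suppress : (T.suppress p u).IsWeightedTree where
  root_mem := Finset.mem_erase.2 ⟨hp0.symm, hT.root_mem⟩
  parent_root := by
    rw [parent_suppress_of_ne (child_spec hpu).2.1.symm, hT.parent_root]
  parent_mem v hv := by
    obtain ⟨-, hvT⟩ := Finset.mem_erase.1 hv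
    rcases eq_or_ne v u with rfl | hvu
    · have hpT : p ∈ T.verts := (child_spec hpu).2.2 ▸ hT.parent_mem v hvT
      rw [parent_suppress_child]
      exact Finset.mem_erase.2 ⟨hT.parent_ne hpT hp0, hT.parent_mem p hpT⟩
    · rw [parent_suppress_of_ne hvu]
      exact Finset.mem_erase.2 ⟨mt (hT.parent_eq_iff hp0 hpu hvT).1 hvu, hT.parent_mem v hvT⟩
  isDesc_root v hv := by
    obtain ⟨hvp, hvT⟩ := Finset.mem_erase.1 hv
    exact (hT.isDesc_suppress hp0 hpu hvT hvp hp0.symm).2 (hT.isDesc_root v hvT)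
  len_nonneg v hv hv0 := by
    obtain ⟨-, hvT⟩ := Finset.mem_erase.1 hv
    rcases eq_or_ne v u with rfl | hvu
    · have hpT : p ∈ T.verts := (child_spec hpu).2.2 ▸ hT.parent_mem v hvT
      rw [len_suppress_child]
      exact add_nonneg (hT.len_nonneg p hpT hp0) (hT.len_nonneg v hvT hv0)
    · rw [len_suppress_of_ne hvu]
      exact hT.len_nonneg v hvT hv0

theorem children_suppress (hvp : v ≠ p) :
    (T.suppress p u).children v = (T.children v).image (Equiv.swap p u) := by
  obtain ⟨huT, hu0, hup⟩ := child_spec hpu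
  have hpT : p ∈ T.verts := hup ▸ hT.parent_mem u huT
  have mem_image (w : ℕ) : w ∈ (T.children v).image (Equiv.swap p u) ↔
      Equiv.swap p u w ∈ T.children v := by
    rw [Finset.mem_image]
    refine ⟨?_, fun h => ⟨_, h, Equiv.swap_apply_self p u w⟩⟩
    rintro ⟨y, hy, rfl⟩
    rwa [Equiv.swap_apply_self]
  ext w
  rw [mem_image, mem_children, mem_children, verts_suppress, Finset.mem_erase]
  rcases eq_or_ne w p with rfl | hwp
  · simp [hup, hvp.symm]
  rcases eq_or_ne w u with rfl | hwu
  · simp [parent_suppress_child, huT, hu0, hpT, hp0, hwp]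
  · simp [Equiv.swap_apply_of_ne_of_ne hwp hwu, parent_suppress_of_ne hwu, hwp]

theorem leaves_suppress : (T.suppress p u).leaves = T.leaves := by
  ext v
  rw [mem_leaves, mem_leaves, verts_suppress, Finset.mem_erase]
  rcases eq_or_ne v p with rfl | hvp
  · simp [hpu]
  · rw [hT.children_suppress hp0 hpu hvp, Finset.image_eq_empty]
    simp [hvp]

theorem load_suppress (hx : x p = 0) (hwp : w ≠ p) : (T.suppress p u).load x w = T.load x w := by
  have hfilter : (T.suppress p u).verts.filter (fun v => (T.suppress p u).IsDesc v w) =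
      (T.verts.filter fun v => T.IsDesc v w).erase p := by
    ext v
    rw [Finset.mem_erase, Finset.mem_filter, Finset.mem_filter, verts_suppress, Finset.mem_erase,
      and_assoc]
    refine and_congr_right fun hvp => and_congr_right fun hv => ?_
    exact hT.isDesc_suppress hp0 hpu hv hvp hwp
  rw [load, hfilter, load, Finset.sum_erase _ hx]

theorem load_of_children_eq_singleton (hx : x p = 0) : T.load x p = T.load x u := by
  have hup := (child_spec hpu).2.2
  symm
  refine Finset.sum_subset (fun v hv => ?_) fun v hv hvu => ?_
  · obtain ⟨hv, hvu⟩ := Finset.mem_filter.1 hv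
    exact Finset.mem_filter.2 ⟨hv, hvu.trans (hup ▸ isDesc_parent T u)⟩
  · obtain ⟨hv, i, hi⟩ := Finset.mem_filter.1 hv
    match i with
    | 0 => rwa [← hi] at hx
    | i + 1 =>
      rw [Function.iterate_succ_apply', hT.parent_eq_iff hp0 hpu (hT.iterate_parent_mem hv i)] at hi
      exact absurd (Finset.mem_filter.2 ⟨hv, i, hi⟩) hvu

theorem transport_suppress (hx : x p = 0) (hx' : x' p = 0) :
    (T.suppress p u).transport x x' = T.transport x x' := by
  obtain ⟨huT, hu0, hup⟩ := child_spec hpu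
  have hpT : p ∈ T.verts.erase 0 := Finset.mem_erase.2 ⟨hp0, hup ▸ hT.parent_mem u huT⟩
  have huT' : u ∈ (T.verts.erase 0).erase p :=
    Finset.mem_erase.2 ⟨hT.child_ne hpu, Finset.mem_erase.2 ⟨hu0, huT⟩⟩
  have old_term : ∀ v ∈ ((T.verts.erase 0).erase p).erase u, (T.suppress p u).len v *
      |((T.suppress p u).load x v : ℝ) - (T.suppress p u).load x' v| =
      T.len v * |(T.load x v : ℝ) - T.load x' v| := by
    intro v hv
    obtain ⟨hvu, hv⟩ := Finset.mem_erase.1 hv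
    rw [len_suppress_of_ne hvu, hT.load_suppress hp0 hpu hx (Finset.ne_of_mem_erase hv),
      hT.load_suppress hp0 hpu hx' (Finset.ne_of_mem_erase hv)]
  have hverts : (T.suppress p u).verts.erase 0 = (T.verts.erase 0).erase p :=
    Finset.erase_right_comm
  rw [transport, transport, hverts, ← Finset.add_sum_erase _ _ hpT, ← Finset.add_sum_erase _ _ huT',
    ← Finset.add_sum_erase (T.verts.erase 0 |>.erase p) _ huT', Finset.sum_congr rfl old_term,
    len_suppress_child, hT.load_suppress hp0 hpu hx (hT.child_ne hpu),
    hT.load_suppress hp0 hpu hx' (hT.child_ne hpu), hT.load_of_children_eq_singleton hp0 hpu hx,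
    hT.load_of_children_eq_singleton hp0 hpu hx']
  ring

end IsWeightedTree

end Suppress

namespace IsPlayable

variable (hT : T.IsPlayable) (hl : l ∈ T.leaves) (htwo : 2 ≤ T.leaves.card)
include hT hl htwo

theorem leaves_prune : (T.prune l).leaves = T.leaves.erase l :=
  GameTree.leaves_prune (hT.siblings_nonempty hl (hT.ne_zero hl) htwo)

omit htwo in
theorem parent_notMem_leaves : T.parent l ∉ T.leaves := by
  have hlv := T.leaves_subset_verts hl
  have hl0 := hT.ne_zero hl
  exact fun h => Finset.ne_empty_of_mem (mem_children_parent hlv hl0) (mem_leaves.1 h).2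

theorem leaves_kill : (T.kill l).leaves = T.leaves.erase l := by
  have hP := hT.isWeightedTree.prune hl (hT.ne_zero hl)
  refine kill_cases (P := fun T' => T'.leaves = T.leaves.erase l) (fun _ => ?_) fun u hp0 hpu => ?_
  · exact hT.leaves_prune hl htwo
  · rw [hP.leaves_suppress hp0 hpu, hT.leaves_prune hl htwo]

omit htwo in
theorem transport_kill (hx : x l = 0) (hx' : x' l = 0)
    (hxp : T.parent l ≠ 0 → x (T.parent l) = 0) (hxp' : T.parent l ≠ 0 → x' (T.parent l) = 0) :
    (T.kill l).transport x x' = T.transport x x' := by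
  have hW := hT.isWeightedTree
  have hP := hW.prune hl (hT.ne_zero hl)
  refine kill_cases (P := fun T' => T'.transport x x' = T.transport x x') (fun _ => ?_)
    fun u hp0 hpu => ?_
  · exact hW.transport_prune hl hx hx'
  · rw [hP.transport_suppress hp0 hpu (hxp hp0) (hxp' hp0), hW.transport_prune hl hx hx']

omit htwo in
theorem isWeightedTree_kill : (T.kill l).IsWeightedTree := by
  have hP := hT.isWeightedTree.prune hl (hT.ne_zero hl)
  exact kill_cases (fun _ => hP) fun u hp0 hpu => hP.suppress hp0 hpu

omit htwo in
theorem card_children_kill : ∀ v ∈ (T.kill l).verts, v ≠ 0 → ((T.kill l).children v).card ≠ 1 := by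
  have hP := hT.isWeightedTree.prune hl (hT.ne_zero hl)
  refine kill_cases (P := fun T' => ∀ v ∈ T'.verts, v ≠ 0 → (T'.children v).card ≠ 1)
    (fun hcard v hv hv0 => ?_) fun u hp0 hpu v hv hv0 => ?_
  · rcases eq_or_ne v (T.parent l) with rfl | hvp
    · rw [children_prune]
      exact hcard hv0
    · rw [children_prune_of_ne hvp]
      exact hT.card_children v (Finset.mem_of_mem_erase hv) hv0
  · obtain ⟨hvp, hv⟩ := Finset.mem_erase.1 hv
    rw [hP.children_suppress hp0 hpu hvp, Finset.card_image_of_injective _ (Equiv.injective _),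
      children_prune_of_ne hvp]
    exact hT.card_children v (Finset.mem_of_mem_erase hv) hv0

omit htwo in
theorem len_le_len_kill (v : ℕ) : T.len v ≤ (T.kill l).len v := by
  refine kill_cases (P := fun T' => T.len v ≤ T'.len v) (fun _ => le_rfl) fun u hp0 hpu => ?_
  rcases eq_or_ne v u with rfl | hvu
  · rw [len_suppress_child]
    have hpT := hT.parent_mem l (T.leaves_subset_verts hl)
    exact le_add_of_nonneg_left (hT.len_nonneg _ hpT hp0)
  · rw [len_suppress_of_ne hvu]
    exact le_rfl

theorem kill : (T.kill l).IsPlayable where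
  toIsSimple :=
    { root_mem := (hT.isWeightedTree_kill hl).root_mem
      parent_root := (hT.isWeightedTree_kill hl).parent_root
      parent_mem := (hT.isWeightedTree_kill hl).parent_mem
      reaches_root := (hT.isWeightedTree_kill hl).isDesc_root
      len_nonneg := (hT.isWeightedTree_kill hl).len_nonneg
      card_children := hT.card_children_kill hl }
  root_not_leaf h := by
    rw [hT.leaves_kill hl htwo] at h
    exact hT.root_not_leaf (Finset.mem_of_mem_erase h)
  len_pos _ v hv := by
    rw [hT.leaves_kill hl htwo] at hv
    exact (hT.len_pos htwo v (Finset.mem_of_mem_erase hv)).trans_le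
      (hT.len_le_len_kill hl v)

theorem depth_kill (hv : v ∈ T.leaves) (hvl : v ≠ l) : (T.kill l).depth v = T.depth v := by
  have hv' : v ∈ (T.kill l).leaves := by
    rw [hT.leaves_kill hl htwo]
    exact Finset.mem_erase.2 ⟨hvl, hv⟩
  have hpv : T.parent l ≠ v := fun h => hT.parent_notMem_leaves hl (h ▸ hv)
  rw [(hT.isWeightedTree_kill hl).depth_eq_transport ((T.kill l).leaves_subset_verts hv'),
    hT.isWeightedTree.depth_eq_transport (T.leaves_subset_verts hv)]
  exact hT.transport_kill hl (Pi.single_eq_of_ne hvl.symm _)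
    (Pi.single_eq_of_ne (hT.ne_zero hl) _) (fun _ => Pi.single_eq_of_ne hpv _)
    fun hp0 => Pi.single_eq_of_ne hp0 _

theorem eq_zero_of_isConfig_kill {k : ℕ} (hx : (T.kill l).IsConfig k x) : x l = 0 :=
  hx.1 l (by rw [hT.leaves_kill hl htwo]; exact Finset.notMem_erase l _)

theorem isConfig_of_kill {k : ℕ} (hx : (T.kill l).IsConfig k x) : T.IsConfig k x := by
  have hleaves := hT.leaves_kill hl htwo
  refine ⟨fun v hv => hx.1 v fun hv' => hv ?_, ?_⟩
  · rw [hleaves] at hv'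
    exact Finset.mem_of_mem_erase hv'
  · rw [← Finset.sum_erase T.leaves (hT.eq_zero_of_isConfig_kill hl htwo hx), ← hleaves]
    exact hx.2

end IsPlayable

end GameTree

section Suffix

variable {α : Type*} {a b : α} {v w : List α}

theorem mem_of_suffix {V : Finset (List α)} (hV : ∀ (a : α) (v : List α), a :: v ∈ V → v ∈ V)
    (h : v <:+ w) (hw : w ∈ V) : v ∈ V := by
  obtain ⟨t, rfl⟩ := h
  induction t with
  | nil => exact hw
  | cons a t ih => exact ih (hV a _ hw)

theorem exists_cons_suffix (h : v <:+ w) (hne : v ≠ w) : ∃ a, a :: v <:+ w := by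
  obtain ⟨t, rfl⟩ := h
  rcases List.eq_nil_or_concat t with rfl | ⟨t', a, rfl⟩
  · exact absurd rfl hne
  · exact ⟨a, t', by simp⟩

theorem head_eq_of_cons_suffix (h : a :: v <:+ w) (h' : b :: v <:+ w) : a = b := by
  have h_eq := (List.suffix_of_suffix_length_le h h' (by simp)).eq_of_length (by simp)
  exact (List.cons_eq_cons.1 h_eq).1

theorem suffix_of_cons_suffix (h : a :: v <:+ w) : v <:+ w :=
  (List.suffix_cons a v).trans h

theorem not_cons_suffix_self (a : α) (v : List α) : ¬ a :: v <:+ v := fun h => by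
  simpa using h.length_le

end Suffix

/-- The number of robots in the subtree of `v`, where `pos` gives the positions of the robots. -/
def robotsBelow {k : ℕ} (pos : Fin k → List ℕ) (v : List ℕ) : ℕ :=
  (Finset.univ.filter fun i => v <:+ pos i).card

section RobotsBelow

variable {k : ℕ} (pos : Fin k → List ℕ) (i : Fin k)

theorem robotsBelow_nil : robotsBelow pos [] = k := by
  simp [robotsBelow]

theorem robotsBelow_update (u v : List ℕ) :
    robotsBelow (Function.update pos i u) v + (if v <:+ pos i then 1 else 0) =
      robotsBelow pos v + (if v <:+ u then 1 else 0) := by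
  have h_others : ∑ j ∈ Finset.univ.erase i, (if v <:+ Function.update pos i u j then 1 else 0) =
      ∑ j ∈ Finset.univ.erase i, (if v <:+ pos j then 1 else 0) :=
    Finset.sum_congr rfl fun j hj => by rw [Function.update_of_ne (Finset.ne_of_mem_erase hj)]
  simp only [robotsBelow, Finset.card_filter]
  rw [← Finset.add_sum_erase _ _ (Finset.mem_univ i),
    ← Finset.add_sum_erase _ _ (Finset.mem_univ i), Function.update_self, h_others]
  ring

theorem robotsBelow_cons (a : ℕ) (v : List ℕ) :
    robotsBelow (Function.update pos i (a :: pos i)) v =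
      robotsBelow pos v + (if v = a :: pos i then 1 else 0) := by
  have h := robotsBelow_update pos i (a :: pos i) v
  by_cases hv : v = a :: pos i
  · subst hv
    simpa [not_cons_suffix_self] using h
  · simpa [List.suffix_cons_iff, hv] using h

variable {pos i}

theorem robotsBelow_tail (hi : pos i ≠ []) (v : List ℕ) :
    robotsBelow (Function.update pos i (pos i).tail) v + (if v = pos i then 1 else 0) =
      robotsBelow pos v := by
  obtain ⟨a, u, hu⟩ := List.exists_cons_of_ne_nil hi
  have h := robotsBelow_cons (Function.update pos i (pos i).tail) i a v
  simp only [Function.update_self, Function.update_idem, hu, List.tail_cons] at h ⊢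
  rw [← h, ← hu, Function.update_eq_self]

theorem robotsBelow_pos {v : List ℕ} (h : v <:+ pos i) : 1 ≤ robotsBelow pos v :=
  Finset.card_pos.2 ⟨i, by simp [h]⟩

variable (pos i)

theorem sum_robotsBelow_lt (A : Finset ℕ) :
    ∑ a ∈ A, robotsBelow pos (a :: pos i) < robotsBelow pos (pos i) := by
  unfold robotsBelow
  rw [← Finset.card_biUnion]
  · have h_ne : ∀ a ∈ A, i ∉ Finset.univ.filter fun j => a :: pos i <:+ pos j := fun a _ h =>
      not_cons_suffix_self a _ (Finset.mem_filter.1 h).2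
    refine Finset.card_lt_card
      ((Finset.ssubset_iff_of_subset ?_).2 ⟨i, by simp, by simpa using h_ne⟩)
    refine Finset.biUnion_subset.2 fun a _ => Finset.monotone_filter_right _ fun j _ hj => ?_
    exact suffix_of_cons_suffix hj
  · refine fun a _ b _ hab => Finset.disjoint_filter.2 fun j _ hj hj' => hab ?_
    exact head_eq_of_cons_suffix hj hj'

end RobotsBelow

/-- The number of robots that the configuration `x` of the game puts on those of the leaves `L` that
are located in the subtree of `v`, where `φ` gives the locations of the leaves. -/
def loadBelow (L : Finset ℕ) (φ : ℕ → List ℕ) (x : ℕ → ℕ) (v : List ℕ) : ℕ :=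
  ∑ l ∈ L.filter (fun l => v <:+ φ l), x l

/-- Some leaf is located in the subtree of `v`. -/
def Covered (L : Finset ℕ) (φ : ℕ → List ℕ) (v : List ℕ) : Prop := ∃ l ∈ L, v <:+ φ l

/-- Some leaf is located strictly below `v`. -/
def Interior (L : Finset ℕ) (φ : ℕ → List ℕ) (v : List ℕ) : Prop := ∃ l ∈ L, v <:+ φ l ∧ v ≠ φ l

section LoadBelow

variable {L L' : Finset ℕ} {φ : ℕ → List ℕ} {x : ℕ → ℕ} {v w : List ℕ}

theorem Covered.mono (h : Covered L φ w) (hvw : v <:+ w) : Covered L φ v :=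
  h.imp fun _ h => ⟨h.1, hvw.trans h.2⟩

theorem Covered.interior (h : Covered L φ v) (hv : ∀ l ∈ L, φ l ≠ v) : Interior L φ v :=
  h.imp fun l h => ⟨h.1, h.2, (hv l h.1).symm⟩

theorem Interior.covered (h : Interior L φ v) : Covered L φ v :=
  h.imp fun _ h => ⟨h.1, h.2.1⟩

theorem loadBelow_of_not_covered (h : ¬ Covered L φ v) : loadBelow L φ x v = 0 :=
  Finset.sum_eq_zero fun l hl =>
    absurd ⟨l, (Finset.mem_filter.1 hl).1, (Finset.mem_filter.1 hl).2⟩ h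

theorem covered_of_loadBelow_pos (h : 0 < loadBelow L φ x v) : Covered L φ v :=
  not_imp_comm.1 loadBelow_of_not_covered h.ne'

theorem loadBelow_loc {l : ℕ} (hl : l ∈ L) (hanti : ∀ m ∈ L, φ l <:+ φ m → l = m) :
    loadBelow L φ x (φ l) = x l := by
  unfold loadBelow
  rw [Finset.sum_eq_single_of_mem l (by simp [hl])]
  intro m hm hne
  rw [Finset.mem_filter] at hm
  exact absurd (hanti m hm.1 hm.2).symm hne

theorem loadBelow_eq_sum_children (hv : ∀ l ∈ L, φ l ≠ v) {A : Finset ℕ}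
    (hA : ∀ a, Covered L φ (a :: v) → a ∈ A) :
    loadBelow L φ x v = ∑ a ∈ A, loadBelow L φ x (a :: v) := by
  unfold loadBelow
  rw [← Finset.sum_biUnion]
  · refine Finset.sum_congr ?_ fun _ _ => rfl
    ext l
    simp only [Finset.mem_filter, Finset.mem_biUnion]
    constructor
    · rintro ⟨hl, h⟩
      obtain ⟨a, ha⟩ := exists_cons_suffix h (hv l hl).symm
      exact ⟨a, hA a ⟨l, hl, ha⟩, hl, ha⟩
    · rintro ⟨a, -, hl, h⟩
      exact ⟨hl, suffix_of_cons_suffix h⟩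
  · refine fun a _ b _ hab => Finset.disjoint_filter.2 fun j _ hj hj' => hab ?_
    exact head_eq_of_cons_suffix hj hj'

theorem loadBelow_of_subset (hL : L' ⊆ L) (hx : ∀ l ∈ L, l ∉ L' → x l = 0) (v : List ℕ) :
    loadBelow L' φ x v = loadBelow L φ x v := by
  refine Finset.sum_subset (Finset.filter_subset_filter _ hL) fun l hl hl' => hx l ?_ ?_
  · exact (Finset.mem_filter.1 hl).1
  · exact fun h => hl' (Finset.mem_filter.2 ⟨h, (Finset.mem_filter.1 hl).2⟩)

end LoadBelow

/-- The distance between two families of loads, where the edge above `v` has the length `lam v`. -/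
def loadDist (V : Finset (List ℕ)) (lam : List ℕ → ℝ) (X X' : List ℕ → ℕ) : ℝ :=
  ∑ v ∈ V.erase [], lam v * |(X v : ℝ) - X' v|

/-- The number of moves that the nodes of `V` account for, when `Y v` robots are below `v`, of which
the game requests `X v`. An edge is paid for when it is discovered, again while its covered part
`lam v` grows, and its account is debited with the distance of `Y` to `X`. -/
def potential (V : Finset (List ℕ)) (lam : List ℕ → ℝ) (Y X : List ℕ → ℕ) : ℝ :=
  ∑ v ∈ V.erase [], (1 + lam v - lam v * |(Y v : ℝ) - X v|)

section Potential

variable {V : Finset (List ℕ)} {lam : List ℕ → ℝ} {Y Y' X X' : List ℕ → ℕ} {v : List ℕ}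

theorem potential_triangle (hlam : ∀ v, 0 ≤ lam v) (Y X X' : List ℕ → ℕ) :
    potential V lam Y X ≤ potential V lam Y X' + loadDist V lam X X' := by
  unfold potential loadDist
  rw [← Finset.sum_add_distrib]
  refine Finset.sum_le_sum fun v _ => ?_
  have h : |(Y v : ℝ) - X' v| ≤ |(Y v : ℝ) - X v| + |(X v : ℝ) - X' v| := abs_sub_le _ _ _
  nlinarith [mul_le_mul_of_nonneg_left h (hlam v)]

theorem potential_le (h0 : ∀ v, 0 ≤ lam v) (h1 : ∀ v, lam v ≤ 1) (Y X : List ℕ → ℕ) :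
    potential V lam Y X ≤ 2 * ((V.erase []).card : ℝ) := by
  unfold potential
  rw [mul_comm, ← nsmul_eq_mul]
  refine Finset.sum_le_card_nsmul _ _ _ fun v _ => ?_
  linarith [h1 v, mul_nonneg (h0 v) (abs_nonneg ((Y v : ℝ) - X v))]

theorem sum_erase_nil_eq_add {F G : List ℕ → ℝ} (hv : v ∈ V) (h0 : v ≠ [])
    (h : ∀ w, w ≠ v → F w = G w) :
    ∑ w ∈ V.erase [], F w = ∑ w ∈ V.erase [], G w + (F v - G v) := by
  have hv' : v ∈ V.erase [] := Finset.mem_erase.2 ⟨h0, hv⟩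
  rw [← Finset.add_sum_erase _ _ hv', ← Finset.add_sum_erase _ _ hv',
    Finset.sum_congr rfl fun w hw => h w (Finset.ne_of_mem_erase hw)]
  ring

theorem potential_update (hv : v ∈ V) (h0 : v ≠ []) (r : ℝ) :
    potential V (Function.update lam v r) Y X =
      potential V lam Y X + (r - lam v) * (1 - |(Y v : ℝ) - X v|) := by
  unfold potential
  rw [sum_erase_nil_eq_add hv h0 fun w hw => by rw [Function.update_of_ne hw],
    Function.update_self]
  ring

theorem loadDist_update (hv : v ∈ V) (h0 : v ≠ []) (r : ℝ) :
    loadDist V (Function.update lam v r) X X' =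
      loadDist V lam X X' + (r - lam v) * |(X v : ℝ) - X' v| := by
  unfold loadDist
  rw [sum_erase_nil_eq_add hv h0 fun w hw => by rw [Function.update_of_ne hw],
    Function.update_self]
  ring

theorem potential_change_robots (hv : v ∈ V) (h0 : v ≠ []) (hY : ∀ w, w ≠ v → Y' w = Y w) :
    potential V lam Y' X =
      potential V lam Y X + lam v * (|(Y v : ℝ) - X v| - |(Y' v : ℝ) - X v|) := by
  unfold potential
  rw [sum_erase_nil_eq_add hv h0 fun w hw => by rw [hY w hw]]
  ring

end Potential

/-- The state of the search of a tree: `V` is the set of visited nodes, `F` that of the full nodes,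
all children of which have been visited, and `K` that of the closed nodes, below which there is
nothing left to visit. -/
structure IsSearchState (V F K : Finset (List ℕ)) : Prop where
  root_mem : [] ∈ V
  parent_mem : ∀ (a : ℕ) (v : List ℕ), a :: v ∈ V → v ∈ V
  full_subset : F ⊆ V
  closed_subset : K ⊆ F
  closed_cons : ∀ (a : ℕ) (v : List ℕ), v ∈ K → a :: v ∈ V → a :: v ∈ K

/-- The leaves `L` of a game tree are located at visited nodes, in such a way that the game tree has
the shape of the part of the visited tree which is not closed. -/
structure IsPlacement (V F K : Finset (List ℕ)) (L : Finset ℕ) (φ : ℕ → List ℕ) : Prop where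
  loc_mem : ∀ l ∈ L, φ l ∈ V
  loc_not_closed : ∀ l ∈ L, φ l ∉ K
  loc_antichain : ∀ l ∈ L, ∀ m ∈ L, φ l <:+ φ m → l = m
  full_of_interior : ∀ v, Interior L φ v → v ∈ F
  interior_cons : ∀ v, Interior L φ v → ∀ a, a :: v ∈ V → a :: v ∈ K ∨ Covered L φ (a :: v)

/-- `cov v` is the proportion of the edge above `v` that belongs to the game tree. It is set to `1`
for the root and for closed nodes. -/
structure IsCover (K : Finset (List ℕ)) (L : Finset ℕ) (φ : ℕ → List ℕ) (cov : List ℕ → ℝ) :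
    Prop where
  cover_nil : cov [] = 1
  cover_nonneg : ∀ v, 0 ≤ cov v
  cover_le_one : ∀ v, cov v ≤ 1
  cover_closed : ∀ v ∈ K, cov v = 1
  cover_of_not_covered : ∀ v, v ∉ K → ¬ Covered L φ v → cov v = 0
  cover_of_interior : ∀ v, Interior L φ v → cov v = 1

section SearchState

variable {V F K K' : Finset (List ℕ)} {L L' : Finset ℕ} {φ : ℕ → List ℕ} {cov : List ℕ → ℝ}
  {v w : List ℕ} {a : ℕ}

namespace IsSearchState

theorem visited_of_suffix (h : IsSearchState V F K) (hvw : v <:+ w) (hw : w ∈ V) : v ∈ V :=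
  mem_of_suffix h.parent_mem hvw hw

theorem closed_of_suffix (h : IsSearchState V F K) (hvw : v <:+ w) (hv : v ∈ K) (hw : w ∈ V) :
    w ∈ K := by
  obtain ⟨t, rfl⟩ := hvw
  induction t with
  | nil => exact hv
  | cons a t ih => exact h.closed_cons a _ (ih (h.parent_mem a _ hw)) hw

theorem insert_visited (h : IsSearchState V F K) (hv : v ∈ V) (hvF : v ∉ F) :
    IsSearchState (insert (a :: v) V) F K where
  root_mem := Finset.mem_insert_of_mem h.root_mem
  parent_mem b w hw := by
    rcases Finset.mem_insert.1 hw with hw | hw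
    · exact (List.cons_eq_cons.1 hw).2.symm ▸ Finset.mem_insert_of_mem hv
    · exact Finset.mem_insert_of_mem (h.parent_mem b w hw)
  full_subset := h.full_subset.trans (Finset.subset_insert _ _)
  closed_subset := h.closed_subset
  closed_cons b w hw hb := by
    rcases Finset.mem_insert.1 hb with hb | hb
    · exact absurd (h.closed_subset ((List.cons_eq_cons.1 hb).2 ▸ hw)) hvF
    · exact h.closed_cons b w hw hb

theorem insert_full (h : IsSearchState V F K) (hv : v ∈ V) : IsSearchState V (insert v F) K :=
  { h with
    full_subset := Finset.insert_subset hv h.full_subset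
    closed_subset := h.closed_subset.trans (Finset.subset_insert _ _) }

end IsSearchState

namespace IsPlacement

theorem visited_of_covered (h : IsPlacement V F K L φ) (hs : IsSearchState V F K)
    (hv : Covered L φ v) : v ∈ V := by
  obtain ⟨l, hl, hvl⟩ := hv
  exact hs.visited_of_suffix hvl (h.loc_mem l hl)

theorem not_closed_of_covered (h : IsPlacement V F K L φ) (hs : IsSearchState V F K)
    (hv : Covered L φ v) : v ∉ K := by
  obtain ⟨l, hl, hvl⟩ := hv
  exact fun hc => h.loc_not_closed l hl (hs.closed_of_suffix hvl hc (h.loc_mem l hl))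

theorem not_covered_cons_loc (h : IsPlacement V F K L φ) {l : ℕ} (hl : l ∈ L) (a : ℕ) :
    ¬ Covered L φ (a :: φ l) := by
  rintro ⟨m, hm, ham⟩
  obtain rfl := h.loc_antichain l hl m hm (suffix_of_cons_suffix ham)
  exact not_cons_suffix_self _ _ ham

theorem insert_visited (h : IsPlacement V F K L φ) (hvF : v ∉ F) :
    IsPlacement (insert (a :: v) V) F K L φ :=
  { h with
    loc_mem := fun l hl => Finset.mem_insert_of_mem (h.loc_mem l hl)
    interior_cons := fun w hw b hb => by
      rcases Finset.mem_insert.1 hb with hb | hb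
      · exact absurd (h.full_of_interior w hw) ((List.cons_eq_cons.1 hb).2 ▸ hvF)
      · exact h.interior_cons w hw b hb }

theorem insert_full (h : IsPlacement V F K L φ) : IsPlacement V (insert v F) K L φ :=
  { h with full_of_interior := fun w hw => Finset.mem_insert_of_mem (h.full_of_interior w hw) }

end IsPlacement

/-- The search below the full node `v` is over, and `L'` is what remains of the set `L` of leaves
when those at `v` are removed. The nodes that lose their last leaf are closed. -/
structure IsRetirement (V F K K' : Finset (List ℕ)) (L L' : Finset ℕ) (φ : ℕ → List ℕ)
    (v : List ℕ) : Prop where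
  mem_closed : ∀ w, w ∈ K' ↔ w = v ∨ w ∈ K ∨ Covered L φ w ∧ ¬ Covered L' φ w
  mem_full : v ∈ F
  closed_of_cons : ∀ a, a :: v ∈ V → a :: v ∈ K
  subset : L' ⊆ L
  loc_eq : ∀ l ∈ L, l ∉ L' → φ l = v
  not_covered : ¬ Covered L' φ v

namespace IsRetirement

theorem interior (r : IsRetirement V F K K' L L' φ v) (h : Interior L' φ w) : Interior L φ w :=
  h.imp fun _ h => ⟨r.subset h.1, h.2⟩

theorem eq_or_mem_or_interior (r : IsRetirement V F K K' L L' φ v) (hw : w ∈ K') :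
    w = v ∨ w ∈ K ∨ Interior L φ w ∧ ¬ Covered L' φ w := by
  rcases (r.mem_closed w).1 hw with hw | hw | ⟨⟨l, hl, hwl⟩, hw'⟩
  · exact Or.inl hw
  · exact Or.inr (Or.inl hw)
  · have hlv : φ l = v := r.loc_eq l hl fun hl' => hw' ⟨l, hl', hwl⟩
    refine or_iff_not_imp_left.2 fun hwv => Or.inr ⟨⟨l, hl, hwl, hlv ▸ hwv⟩, hw'⟩

theorem isSearchState (r : IsRetirement V F K K' L L' φ v) (hs : IsSearchState V F K)
    (hp : IsPlacement V F K L φ) : IsSearchState V F K' :=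
  { hs with
    closed_subset := fun w hw => by
      rcases r.eq_or_mem_or_interior hw with rfl | hw | ⟨hw, -⟩
      · exact r.mem_full
      · exact hs.closed_subset hw
      · exact hp.full_of_interior w hw
    closed_cons := fun a w hw ha => by
      rw [r.mem_closed]
      rcases r.eq_or_mem_or_interior hw with rfl | hw | ⟨hw, hw'⟩
      · exact Or.inr (Or.inl (r.closed_of_cons a ha))
      · exact Or.inr (Or.inl (hs.closed_cons a w hw ha))
      · refine Or.inr ((hp.interior_cons w hw a ha).imp_right fun hc => ⟨hc, fun hc' => hw' ?_⟩)
        exact hc'.mono (List.suffix_cons a w) }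

theorem isPlacement (r : IsRetirement V F K K' L L' φ v) (hp : IsPlacement V F K L φ) :
    IsPlacement V F K' L' φ where
  loc_mem l hl := hp.loc_mem l (r.subset hl)
  loc_not_closed l hl hc := by
    have hcov : Covered L' φ (φ l) := ⟨l, hl, List.suffix_rfl⟩
    rcases (r.mem_closed _).1 hc with hc | hc | ⟨-, hc⟩
    · exact r.not_covered (hc ▸ hcov)
    · exact hp.loc_not_closed l (r.subset hl) hc
    · exact hc hcov
  loc_antichain l hl m hm := hp.loc_antichain l (r.subset hl) m (r.subset hm)
  full_of_interior w hw := hp.full_of_interior w (r.interior hw)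
  interior_cons w hw a ha := by
    rw [r.mem_closed]
    have := hp.interior_cons w (r.interior hw) a ha
    tauto

theorem isCover (r : IsRetirement V F K K' L L' φ v) (hv : v ≠ []) (hc : IsCover K L φ cov) :
    IsCover K' L' φ (Function.update cov v 1) where
  cover_nil := by rw [Function.update_of_ne hv.symm, hc.cover_nil]
  cover_nonneg w := by
    rw [Function.update_apply]
    split_ifs
    exacts [zero_le_one, hc.cover_nonneg w]
  cover_le_one w := by
    rw [Function.update_apply]
    split_ifs
    exacts [le_rfl, hc.cover_le_one w]
  cover_closed w hw := by
    rw [Function.update_apply]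
    rcases r.eq_or_mem_or_interior hw with rfl | hw | ⟨hw, -⟩
    · rw [if_pos rfl]
    · rw [hc.cover_closed w hw, ite_self]
    · rw [hc.cover_of_interior w hw, ite_self]
  cover_of_not_covered w hw hw' := by
    simp only [r.mem_closed, not_or, not_and_or, not_not] at hw
    rw [Function.update_of_ne hw.1]
    exact hc.cover_of_not_covered w hw.2.1 (hw.2.2.resolve_right hw')
  cover_of_interior w hw := by
    rw [Function.update_apply, hc.cover_of_interior w (r.interior hw), ite_self]

end IsRetirement

end SearchState

/-- The leaf `l`, which is located at a full node, is replaced by the leaves `C`, which are located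
at the children of that node that are not closed, `e c` being the label of the edge to the location
of `c`. -/
structure IsBranching (V F K : Finset (List ℕ)) (L L' : Finset ℕ) (φ φ' : ℕ → List ℕ) (l : ℕ)
    (C : Finset ℕ) (e : ℕ → ℕ) : Prop where
  mem_leaves : l ∈ L
  mem_full : φ l ∈ F
  leaves_eq : L' = L.erase l ∪ C
  disjoint : Disjoint (L.erase l) C
  nonempty : C.Nonempty
  injOn : Set.InjOn e C
  loc_of_mem_erase : ∀ m ∈ L.erase l, φ' m = φ m
  loc_of_mem : ∀ c ∈ C, φ' c = e c :: φ l
  visited : ∀ c ∈ C, e c :: φ l ∈ V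
  not_closed : ∀ c ∈ C, e c :: φ l ∉ K
  exists_eq : ∀ a, a :: φ l ∈ V → a :: φ l ∉ K → ∃ c ∈ C, e c = a

namespace IsBranching

variable {V F K : Finset (List ℕ)} {L L' : Finset ℕ} {φ φ' : ℕ → List ℕ} {l : ℕ} {C : Finset ℕ}
  {e : ℕ → ℕ} {cov cov' : List ℕ → ℝ} {δ : ℝ} {v : List ℕ}

theorem mem_iff (b : IsBranching V F K L L' φ φ' l C e) {m : ℕ} :
    m ∈ L' ↔ m ∈ L.erase l ∨ m ∈ C := by
  rw [b.leaves_eq, Finset.mem_union]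

theorem covered_iff (b : IsBranching V F K L L' φ φ' l C e) :
    Covered L' φ' v ↔ Covered L φ v ∨ ∃ c ∈ C, v = e c :: φ l := by
  constructor
  · rintro ⟨m, hm, hv⟩
    rcases b.mem_iff.1 hm with hm | hm
    · exact Or.inl ⟨m, Finset.mem_of_mem_erase hm, b.loc_of_mem_erase m hm ▸ hv⟩
    · rw [b.loc_of_mem m hm, List.suffix_cons_iff] at hv
      exact hv.symm.imp (fun hv => ⟨l, b.mem_leaves, hv⟩) fun hv => ⟨m, hm, hv⟩
  · have h_new : ∀ c ∈ C, v <:+ e c :: φ l → Covered L' φ' v := fun c hc hv =>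
      ⟨c, b.mem_iff.2 (Or.inr hc), b.loc_of_mem c hc ▸ hv⟩
    rintro (⟨m, hm, hv⟩ | ⟨c, hc, rfl⟩)
    · rcases eq_or_ne m l with rfl | hml
      · obtain ⟨c, hc⟩ := b.nonempty
        exact h_new c hc (hv.trans (List.suffix_cons _ _))
      · have hm' := Finset.mem_erase.2 ⟨hml, hm⟩
        exact ⟨m, b.mem_iff.2 (Or.inl hm'), (b.loc_of_mem_erase m hm').symm ▸ hv⟩
    · exact h_new c hc List.suffix_rfl

theorem interior_iff (b : IsBranching V F K L L' φ φ' l C e) :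
    Interior L' φ' v ↔ Interior L φ v ∨ v = φ l := by
  constructor
  · rintro ⟨m, hm, hv, hne⟩
    rcases b.mem_iff.1 hm with hm | hm
    · rw [b.loc_of_mem_erase m hm] at hv hne
      exact Or.inl ⟨m, Finset.mem_of_mem_erase hm, hv, hne⟩
    · rw [b.loc_of_mem m hm] at hv hne
      have hv' := (List.suffix_cons_iff.1 hv).resolve_left hne
      exact or_iff_not_imp_right.2 fun hvl => ⟨l, b.mem_leaves, hv', hvl⟩
  · have h_new : v <:+ φ l → Interior L' φ' v := fun hv => by
      obtain ⟨c, hc⟩ := b.nonempty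
      refine ⟨c, b.mem_iff.2 (Or.inr hc), ?_⟩
      rw [b.loc_of_mem c hc]
      refine ⟨hv.trans (List.suffix_cons _ _), ?_⟩
      rintro rfl
      exact not_cons_suffix_self _ _ hv
    rintro (⟨m, hm, hv, hne⟩ | rfl)
    · rcases eq_or_ne m l with rfl | hml
      · exact h_new hv
      · have hm' := Finset.mem_erase.2 ⟨hml, hm⟩
        exact ⟨m, b.mem_iff.2 (Or.inl hm'), by rw [b.loc_of_mem_erase m hm']; exact ⟨hv, hne⟩⟩
    · exact h_new List.suffix_rfl

theorem isPlacement (b : IsBranching V F K L L' φ φ' l C e) (hp : IsPlacement V F K L φ) :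
    IsPlacement V F K L' φ' where
  loc_mem m hm := by
    rcases b.mem_iff.1 hm with hm | hm
    · exact b.loc_of_mem_erase m hm ▸ hp.loc_mem m (Finset.mem_of_mem_erase hm)
    · exact b.loc_of_mem m hm ▸ b.visited m hm
  loc_not_closed m hm := by
    rcases b.mem_iff.1 hm with hm | hm
    · exact b.loc_of_mem_erase m hm ▸ hp.loc_not_closed m (Finset.mem_of_mem_erase hm)
    · exact b.loc_of_mem m hm ▸ b.not_closed m hm
  loc_antichain m hm n hn hmn := by
    have hl := hp.loc_antichain l b.mem_leaves
    rcases b.mem_iff.1 hm with hm | hm <;> rcases b.mem_iff.1 hn with hn | hn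
    · rw [b.loc_of_mem_erase m hm, b.loc_of_mem_erase n hn] at hmn
      exact hp.loc_antichain m (Finset.mem_of_mem_erase hm) n (Finset.mem_of_mem_erase hn) hmn
    · rw [b.loc_of_mem_erase m hm, b.loc_of_mem n hn, List.suffix_cons_iff] at hmn
      obtain ⟨hml, hm⟩ := Finset.mem_erase.1 hm
      rcases hmn with hmn | hmn
      · exact absurd (hl m hm (hmn ▸ List.suffix_cons _ _)).symm hml
      · exact absurd (hp.loc_antichain m hm l b.mem_leaves hmn) hml
    · rw [b.loc_of_mem m hm, b.loc_of_mem_erase n hn] at hmn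
      obtain ⟨hnl, hn⟩ := Finset.mem_erase.1 hn
      exact absurd (hl n hn (suffix_of_cons_suffix hmn)).symm hnl
    · rw [b.loc_of_mem m hm, b.loc_of_mem n hn] at hmn
      exact b.injOn hm hn (List.cons_eq_cons.1 (hmn.eq_of_length rfl)).1
  full_of_interior w hw := by
    rcases b.interior_iff.1 hw with hw | rfl
    exacts [hp.full_of_interior w hw, b.mem_full]
  interior_cons w hw a ha := by
    rw [b.covered_iff]
    rcases b.interior_iff.1 hw with hw | rfl
    · exact (hp.interior_cons w hw a ha).imp_right Or.inl
    · refine or_iff_not_imp_left.2 fun haK => Or.inr ?_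
      obtain ⟨c, hc, rfl⟩ := b.exists_eq a ha haK
      exact ⟨c, hc, rfl⟩

theorem isCover (b : IsBranching V F K L L' φ φ' l C e) (hp : IsPlacement V F K L φ)
    (hc : IsCover K L φ cov) (hl : cov (φ l) = 1) (hδ0 : 0 ≤ δ) (hδ1 : δ ≤ 1)
    (hnew : ∀ c ∈ C, cov' (e c :: φ l) = δ)
    (hold : ∀ w, (∀ c ∈ C, w ≠ e c :: φ l) → cov' w = cov w) : IsCover K L' φ' cov' := by
  have h_cases : ∀ w, cov' w = δ ∨ cov' w = cov w := fun w => by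
    by_cases hw : ∃ c ∈ C, w = e c :: φ l
    · obtain ⟨c, hc, rfl⟩ := hw
      exact Or.inl (hnew c hc)
    · push Not at hw
      exact Or.inr (hold w hw)
  exact
  { cover_nil := by rw [hold [] (by simp), hc.cover_nil]
    cover_nonneg := fun w => by
      rcases h_cases w with hw | hw
      exacts [hw ▸ hδ0, hw ▸ hc.cover_nonneg w]
    cover_le_one := fun w => by
      rcases h_cases w with hw | hw
      exacts [hw ▸ hδ1, hw ▸ hc.cover_le_one w]
    cover_closed := fun w hw => by
      rw [hold w fun c hc hwc => b.not_closed c hc (hwc ▸ hw), hc.cover_closed w hw]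
    cover_of_not_covered := fun w hw hcov => by
      rw [b.covered_iff, not_or] at hcov
      push Not at hcov
      rw [hold w hcov.2, hc.cover_of_not_covered w hw hcov.1]
    cover_of_interior := fun w hw => by
      rcases b.interior_iff.1 hw with hw | rfl
      · rw [hold w, hc.cover_of_interior w hw]
        rintro c - rfl
        exact hp.not_covered_cons_loc b.mem_leaves _ hw.covered
      · rw [hold _ fun c _ => (List.cons_ne_self _ _).symm, hl] }

theorem loadBelow_new (b : IsBranching V F K L L' φ φ' l C e) (hp : IsPlacement V F K L φ)
    (x : ℕ → ℕ) {c : ℕ} (hc : c ∈ C) : loadBelow L' φ' x (e c :: φ l) = x c := by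
  have hc' := b.mem_iff.2 (Or.inr hc)
  rw [← b.loc_of_mem c hc, loadBelow_loc hc' ((b.isPlacement hp).loc_antichain c hc')]

theorem loadBelow_old (b : IsBranching V F K L L' φ φ' l C e) {x z : ℕ → ℕ}
    (hz : ∀ m ∈ L.erase l, z m = x m) (hzl : z l = ∑ c ∈ C, x c)
    (hv : ∀ c ∈ C, v ≠ e c :: φ l) : loadBelow L' φ' x v = loadBelow L φ z v := by
  have h_new : ∑ c ∈ C, (if v <:+ φ' c then x c else 0) = if v <:+ φ l then z l else 0 := by
    have h_iff : ∀ c ∈ C, v <:+ φ' c ↔ v <:+ φ l := fun c hc => by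
      rw [b.loc_of_mem c hc, List.suffix_cons_iff, or_iff_right (hv c hc)]
    rw [Finset.sum_congr rfl fun c hc => if_congr (h_iff c hc) rfl rfl, hzl]
    split_ifs <;> simp
  have h_old : ∑ m ∈ L.erase l, (if v <:+ φ' m then x m else 0) =
      ∑ m ∈ L.erase l, (if v <:+ φ m then z m else 0) :=
    Finset.sum_congr rfl fun m hm => by rw [b.loc_of_mem_erase m hm, hz m hm]
  simp only [loadBelow, Finset.sum_filter]
  rw [b.leaves_eq, Finset.sum_union b.disjoint, h_new, h_old, Finset.sum_erase_add _ _ b.mem_leaves]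

theorem sum_erase_nil (b : IsBranching V F K L L' φ φ' l C e) {f g : List ℕ → ℝ} {h : ℕ → ℝ}
    (hold : ∀ w, (∀ c ∈ C, w ≠ e c :: φ l) → f w = g w)
    (hnew : ∀ c ∈ C, f (e c :: φ l) = g (e c :: φ l) + h c) :
    ∑ w ∈ V.erase [], f w = ∑ w ∈ V.erase [], g w + ∑ c ∈ C, h c := by
  have h_sub : C.image (fun c => e c :: φ l) ⊆ V.erase [] := by
    simpa [Finset.image_subset_iff] using b.visited
  have h_inj : Set.InjOn (fun c => e c :: φ l) C := fun c hc d hd hcd =>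
    b.injOn hc hd (List.cons_eq_cons.1 hcd).1
  have h_rest : ∑ w ∈ V.erase [] \ C.image (fun c => e c :: φ l), f w =
      ∑ w ∈ V.erase [] \ C.image (fun c => e c :: φ l), g w := by
    refine Finset.sum_congr rfl fun w hw => hold w fun c hc hwc => ?_
    exact (Finset.mem_sdiff.1 hw).2 (Finset.mem_image.2 ⟨c, hc, hwc.symm⟩)
  rw [← Finset.sum_sdiff h_sub, ← Finset.sum_sdiff (f := g) h_sub, Finset.sum_image h_inj,
    Finset.sum_image h_inj, h_rest, Finset.sum_congr rfl hnew, Finset.sum_add_distrib, add_assoc]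

theorem loadDist_eq (b : IsBranching V F K L L' φ φ' l C e) (hp : IsPlacement V F K L φ)
    (hnew : ∀ c ∈ C, cov' (e c :: φ l) = δ)
    (hold : ∀ w, (∀ c ∈ C, w ≠ e c :: φ l) → cov' w = cov w) {x x' z z' : ℕ → ℕ}
    (hz : ∀ m ∈ L.erase l, z m = x m) (hzl : z l = ∑ c ∈ C, x c)
    (hz' : ∀ m ∈ L.erase l, z' m = x' m) (hzl' : z' l = ∑ c ∈ C, x' c) :
    loadDist V cov' (loadBelow L' φ' x) (loadBelow L' φ' x') =
      loadDist V cov (loadBelow L φ z) (loadBelow L φ z') +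
        δ * ∑ c ∈ C, |(x c : ℝ) - x' c| := by
  rw [Finset.mul_sum]
  refine b.sum_erase_nil (fun w hw => ?_) fun c hc => ?_
  · rw [hold w hw, b.loadBelow_old hz hzl hw, b.loadBelow_old hz' hzl' hw]
  · rw [hnew c hc, b.loadBelow_new hp x hc, b.loadBelow_new hp x' hc,
      loadBelow_of_not_covered (hp.not_covered_cons_loc b.mem_leaves _),
      loadBelow_of_not_covered (hp.not_covered_cons_loc b.mem_leaves _)]
    simp

theorem potential_eq (b : IsBranching V F K L L' φ φ' l C e) (hp : IsPlacement V F K L φ)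
    (hc : IsCover K L φ cov) (hnew : ∀ c ∈ C, cov' (e c :: φ l) = δ)
    (hold : ∀ w, (∀ c ∈ C, w ≠ e c :: φ l) → cov' w = cov w) {x z : ℕ → ℕ}
    (hz : ∀ m ∈ L.erase l, z m = x m) (hzl : z l = ∑ c ∈ C, x c) {Y : List ℕ → ℕ}
    (hY : ∀ c ∈ C, Y (e c :: φ l) = 1) :
    potential V cov' Y (loadBelow L' φ' x) =
      potential V cov Y (loadBelow L φ z) + δ * ∑ c ∈ C, (1 - |(1 : ℝ) - x c|) := by
  rw [Finset.mul_sum]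
  refine b.sum_erase_nil (fun w hw => ?_) fun c hcC => ?_
  · rw [hold w hw, b.loadBelow_old hz hzl hw]
  · rw [hnew c hcC, b.loadBelow_new hp x hcC, hY c hcC,
      hc.cover_of_not_covered _ (b.not_closed c hcC) (hp.not_covered_cons_loc b.mem_leaves _)]
    push_cast
    ring

theorem potential_le (b : IsBranching V F K L L' φ φ' l C e) (hp : IsPlacement V F K L φ)
    (hc : IsCover K L φ cov) (hδ : 0 ≤ δ) (hnew : ∀ c ∈ C, cov' (e c :: φ l) = δ)
    (hold : ∀ w, (∀ c ∈ C, w ≠ e c :: φ l) → cov' w = cov w) {x z : ℕ → ℕ}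
    (hz : ∀ m ∈ L.erase l, z m = x m) (hzl : z l = ∑ c ∈ C, x c) {Y : List ℕ → ℕ}
    (hY : ∀ c ∈ C, Y (e c :: φ l) = 1) :
    potential V cov Y (loadBelow L φ z) ≤
      potential V cov' Y (loadBelow L' φ' x) + δ * ∑ c ∈ C, (x c : ℝ) := by
  have h_nonneg : 0 ≤ ∑ c ∈ C, ((1 - |(1 : ℝ) - x c|) + x c) :=
    Finset.sum_nonneg fun c _ => by
      have : (0 : ℝ) ≤ x c := Nat.cast_nonneg _
      linarith [abs_le.2 (⟨by linarith, by linarith⟩ : -(1 + x c : ℝ) ≤ 1 - x c ∧ _ ≤ _)]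
  rw [b.potential_eq hp hc hnew hold hz hzl hY, add_assoc, ← mul_add, ← Finset.sum_add_distrib]
  exact le_add_of_nonneg_right (mul_nonneg hδ h_nonneg)

end IsBranching

/-- A team of robots in a tree, which is discovered progressively, together with a game of
tree-mining. Leaves of the game tree are located at nodes of the explored tree. -/
structure Exploration (k : ℕ) where
  /-- the nodes that have been visited -/
  visited : Finset (List ℕ)
  /-- visited nodes whose children have all been visited -/
  full : Finset (List ℕ)
  /-- visited nodes whose subtrees need no further visit -/
  closed : Finset (List ℕ)
  pos : Fin k → List ℕ
  /-- the number of moves of all the robots -/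
  moves : ℕ
  tree : GameTree
  conf : ℕ → ℕ
  cost : ℝ
  /-- the location of a leaf `l` of the game tree: it is on the edge between the node `loc l` and
  its parent -/
  loc : ℕ → List ℕ
  /-- the proportion of the edge between a node and its parent that is covered by the game tree; it
  is set to `1` for the root and for closed nodes -/
  cover : List ℕ → ℝ

namespace Exploration

variable {k : ℕ}

/-- The number of robots of the team in the subtree of `v`. -/
def robots (σ : Exploration k) : List ℕ → ℕ := robotsBelow σ.pos

/-- The number of robots of the game in the subtree of `v`. -/
def load (σ : Exploration k) : List ℕ → ℕ := loadBelow σ.tree.leaves σ.loc σ.conf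

/-- `v` is above a leaf of the game tree. -/
def IsCovered (σ : Exploration k) : List ℕ → Prop := Covered σ.tree.leaves σ.loc

/-- The invariants of an exploration that plays the game against the strategy `S`. By `transport_eq`
and `depth_eq` the game tree is isometric to the covered part of the explored tree, up to a shift of
the depths by `1`. -/
structure Valid (S : CTMStrategy k) (σ : Exploration k) : Prop extends
    IsSearchState σ.visited σ.full σ.closed,
    IsPlacement σ.visited σ.full σ.closed σ.tree.leaves σ.loc,
    IsCover σ.closed σ.tree.leaves σ.loc σ.cover where
  reach : S.Reach σ.tree σ.conf σ.cost
  playable : σ.tree.IsPlayable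
  config : σ.tree.IsConfig k σ.conf
  pos_mem : ∀ i, σ.pos i ∈ σ.visited
  robots_pos : ∀ v ∈ σ.visited, v ∉ σ.closed → 1 ≤ σ.robots v
  robots_eq_one : ∀ v ∈ σ.visited, v ∉ σ.closed → σ.cover v < 1 → σ.robots v = 1
  transport_eq : ∀ x x', σ.tree.IsConfig k x → σ.tree.IsConfig k x' → σ.tree.transport x x' =
    loadDist σ.visited σ.cover (loadBelow σ.tree.leaves σ.loc x) (loadBelow σ.tree.leaves σ.loc x')
  depth_eq : ∀ l ∈ σ.tree.leaves, σ.tree.depth l + 1 = (σ.loc l).length + σ.cover (σ.loc l)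
  moves_le : (σ.moves : ℝ) ≤ σ.cost + potential σ.visited σ.cover σ.robots σ.load

/-- Leaves that host at least two robots are located at nodes, rather than inside edges. -/
def Eager (σ : Exploration k) : Prop :=
  ∀ l ∈ σ.tree.leaves, 2 ≤ σ.conf l → σ.cover (σ.loc l) = 1

variable {S : CTMStrategy k} {σ : Exploration k} {i : Fin k} {a : ℕ} {u v : List ℕ}

namespace Valid

theorem visited_of_covered (h : σ.Valid S) (hv : σ.IsCovered v) : v ∈ σ.visited :=
  h.toIsPlacement.visited_of_covered h.toIsSearchState hv

theorem not_closed_of_covered (h : σ.Valid S) (hv : σ.IsCovered v) : v ∉ σ.closed :=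
  h.toIsPlacement.not_closed_of_covered h.toIsSearchState hv

theorem load_loc (h : σ.Valid S) {l : ℕ} (hl : l ∈ σ.tree.leaves) : σ.load (σ.loc l) = σ.conf l :=
  loadBelow_loc hl (h.loc_antichain l hl)

theorem load_nil (h : σ.Valid S) : σ.load [] = k := by
  unfold load loadBelow
  rw [Finset.filter_true_of_mem fun l _ => List.nil_suffix]
  exact h.config.2

theorem leaves_nonempty (h : σ.Valid S) (hk : 0 < k) : σ.tree.leaves.Nonempty := by
  by_contra hne
  have := h.config.2
  rw [Finset.not_nonempty_iff_eq_empty.1 hne, Finset.sum_empty] at this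
  omega

theorem covered_nil (h : σ.Valid S) (hk : 0 < k) : σ.IsCovered [] :=
  (h.leaves_nonempty hk).imp fun _ hl => ⟨hl, List.nil_suffix⟩

theorem closed_subset_visited (h : σ.Valid S) : σ.closed ⊆ σ.visited :=
  h.closed_subset.trans h.full_subset

theorem load_eq_zero_of_closed (h : σ.Valid S) (hv : v ∈ σ.closed) : σ.load v = 0 :=
  loadBelow_of_not_covered fun hc => h.not_closed_of_covered hc hv

theorem cover_eq_one (h : σ.Valid S) (he : σ.Eager) (hv : 2 ≤ σ.load v) : σ.cover v = 1 := by
  have hc : σ.IsCovered v := covered_of_loadBelow_pos (two_pos.trans_le hv)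
  by_cases hl : ∃ l ∈ σ.tree.leaves, σ.loc l = v
  · obtain ⟨l, hl, rfl⟩ := hl
    exact he l hl (h.load_loc hl ▸ hv)
  · push Not at hl
    exact h.cover_of_interior v (hc.interior hl)

end Valid

/-- The exploration after the robot `i` goes to `u`. -/
def move (σ : Exploration k) (i : Fin k) (u : List ℕ) : Exploration k :=
  { σ with
    visited := insert u σ.visited
    pos := Function.update σ.pos i u
    moves := σ.moves + 1 }

theorem move_robots_tail (hi : σ.pos i ≠ []) (v : List ℕ) :
    (σ.move i (σ.pos i).tail).robots v + (if v = σ.pos i then 1 else 0) = σ.robots v :=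
  robotsBelow_tail hi v

theorem move_robots_cons (a : ℕ) (v : List ℕ) :
    (σ.move i (a :: σ.pos i)).robots v = σ.robots v + (if v = a :: σ.pos i then 1 else 0) :=
  robotsBelow_cons σ.pos i a v

theorem move_pos_mem (hpos : ∀ j, σ.pos j ∈ σ.visited) (j : Fin k) :
    (σ.move i u).pos j ∈ (σ.move i u).visited := by
  change Function.update σ.pos i u j ∈ insert u σ.visited
  rw [Function.update_apply]
  split_ifs
  · exact Finset.mem_insert_self _ _
  · exact Finset.mem_insert_of_mem (hpos j)

namespace Valid

/-- A move along the edge above `v` which brings the number of robots below `v` closer to the load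
is paid for by the decrease of their distance. -/
theorem move (h : σ.Valid S) (hu : u ∈ σ.visited) (hv : v ∈ σ.visited) (h0 : v ≠ [])
    (hc : σ.cover v = 1) (hne : ∀ w, w ≠ v → (σ.move i u).robots w = σ.robots w)
    (hpos : v ∉ σ.closed → 1 ≤ (σ.move i u).robots v)
    (hle : |((σ.move i u).robots v : ℝ) - σ.load v| + 1 ≤ |(σ.robots v : ℝ) - σ.load v|) :
    (σ.move i u).Valid S := by
  have hvis : (σ.move i u).visited = σ.visited := Finset.insert_eq_of_mem hu
  refine { h with
    toIsSearchState := hvis.symm ▸ h.toIsSearchState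
    loc_mem := hvis.symm ▸ h.loc_mem
    interior_cons := hvis.symm ▸ h.interior_cons
    pos_mem := move_pos_mem h.pos_mem
    robots_pos := fun w hw hwc => ?_
    robots_eq_one := fun w hw hwc hlt => ?_
    transport_eq := hvis.symm ▸ h.transport_eq
    moves_le := ?_ }
  · rcases eq_or_ne w v with rfl | hwv
    · exact hpos hwc
    · exact hne w hwv ▸ h.robots_pos w (hvis ▸ hw) hwc
  · have hwv : w ≠ v := fun hwv => absurd hc (hwv ▸ hlt).ne
    exact hne w hwv ▸ h.robots_eq_one w (hvis ▸ hw) hwc hlt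
  · rw [hvis]
    change ((σ.moves + 1 : ℕ) : ℝ) ≤ σ.cost + potential σ.visited σ.cover _ σ.load
    rw [potential_change_robots hv h0 hne, hc]
    push_cast
    linarith [h.moves_le]

theorem move_up (h : σ.Valid S) (h0 : σ.pos i ≠ []) (hc : σ.cover (σ.pos i) = 1)
    (hlt : σ.load (σ.pos i) < σ.robots (σ.pos i))
    (hocc : σ.pos i ∈ σ.closed ∨ 2 ≤ σ.robots (σ.pos i)) :
    (σ.move i (σ.pos i).tail).Valid S := by
  have hi := move_robots_tail h0 (σ.pos i)
  rw [if_pos rfl] at hi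
  refine h.move (h.visited_of_suffix (List.tail_suffix _) (h.pos_mem i)) (h.pos_mem i) h0 hc
    ?_ ?_ ?_
  · intro w hw
    have := move_robots_tail h0 w
    rwa [if_neg hw, add_zero] at this
  · intro hcl
    have := hocc.resolve_left hcl
    omega
  · rw [← hi] at hlt ⊢
    have hle : (σ.load (σ.pos i) : ℝ) ≤ (σ.move i (σ.pos i).tail).robots (σ.pos i) := by
      exact_mod_cast Nat.lt_succ_iff.1 hlt
    push_cast
    rw [abs_of_nonneg (by linarith), abs_of_nonneg (by linarith)]
    linarith

theorem move_down (h : σ.Valid S) (ha : a :: σ.pos i ∈ σ.visited)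
    (hc : σ.cover (a :: σ.pos i) = 1)
    (hlt : σ.robots (a :: σ.pos i) < σ.load (a :: σ.pos i)) :
    (σ.move i (a :: σ.pos i)).Valid S := by
  have hi := move_robots_cons (σ := σ) (i := i) a (a :: σ.pos i)
  rw [if_pos rfl] at hi
  refine h.move ha ha (List.cons_ne_nil _ _) hc ?_ ?_ ?_
  · intro w hw
    rw [move_robots_cons, if_neg hw, add_zero]
  · omega
  · rw [hi]
    have hle : (σ.robots (a :: σ.pos i) : ℝ) + 1 ≤ σ.load (a :: σ.pos i) := by exact_mod_cast hlt
    push_cast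
    rw [abs_of_nonpos (by linarith), abs_of_nonpos (by linarith)]
    linarith

theorem robots_of_not_visited (h : σ.Valid S) (hv : v ∉ σ.visited) : σ.robots v = 0 := by
  unfold robots robotsBelow
  refine Finset.card_eq_zero.2 (Finset.filter_eq_empty_iff.2 fun j _ hj => ?_)
  exact hv (h.visited_of_suffix hj (h.pos_mem j))

theorem move_new (h : σ.Valid S) (ha : a :: σ.pos i ∉ σ.visited) (hfull : σ.pos i ∉ σ.full) :
    (σ.move i (a :: σ.pos i)).Valid S := by
  have hcov : ¬ σ.IsCovered (a :: σ.pos i) := fun hc => ha (h.visited_of_covered hc)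
  have hcover : σ.cover (a :: σ.pos i) = 0 :=
    h.cover_of_not_covered _ (fun hc => ha (h.closed_subset_visited hc)) hcov
  have hrob0 : σ.robots (a :: σ.pos i) = 0 := h.robots_of_not_visited ha
  have hrob : ∀ w ∈ σ.visited, (σ.move i (a :: σ.pos i)).robots w = σ.robots w := by
    intro w hw
    rw [move_robots_cons, if_neg (ne_of_mem_of_not_mem hw ha), add_zero]
  have hne : a :: σ.pos i ∉ σ.visited.erase [] := fun hm => ha (Finset.mem_of_mem_erase hm)
  have herase : (insert (a :: σ.pos i) σ.visited).erase [] =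
      insert (a :: σ.pos i) (σ.visited.erase []) :=
    Finset.erase_insert_of_ne (List.cons_ne_nil _ _)
  refine { h with
    toIsSearchState := h.toIsSearchState.insert_visited (h.pos_mem i) hfull
    toIsPlacement := h.toIsPlacement.insert_visited hfull
    pos_mem := move_pos_mem h.pos_mem
    robots_pos := fun w hw hwc => ?_
    robots_eq_one := fun w hw hwc hlt => ?_
    transport_eq := fun x x' hx hx' => ?_
    moves_le := ?_ }
  · rcases Finset.mem_insert.1 hw with rfl | hw
    · simp [move_robots_cons]
    · exact hrob w hw ▸ h.robots_pos w hw hwc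
  · rcases Finset.mem_insert.1 hw with rfl | hw
    · simp [move_robots_cons, hrob0]
    · exact hrob w hw ▸ h.robots_eq_one w hw hwc hlt
  · change σ.tree.transport x x' = loadDist (insert _ σ.visited) σ.cover _ _
    rw [h.transport_eq x x' hx hx', loadDist, loadDist, herase, Finset.sum_insert hne, hcover,
      zero_mul, zero_add]
    rfl
  · change ((σ.moves + 1 : ℕ) : ℝ) ≤ σ.cost + potential (insert _ σ.visited) σ.cover _ σ.load
    rw [potential, herase, Finset.sum_insert hne, hcover,
      Finset.sum_congr rfl fun w hw => by rw [hrob w (Finset.mem_of_mem_erase hw)]]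
    have := h.moves_le
    rw [potential] at this
    push_cast
    linarith

end Valid

/-- The exploration after the node `v` is recorded as full. -/
def markFull (σ : Exploration k) (v : List ℕ) : Exploration k :=
  { σ with full := insert v σ.full }

theorem Valid.markFull (h : σ.Valid S) (hv : v ∈ σ.visited) : (σ.markFull v).Valid S :=
  { h with
    toIsSearchState := h.toIsSearchState.insert_full hv
    toIsPlacement := h.toIsPlacement.insert_full }

end Exploration

namespace Exploration

variable {k : ℕ} {S : CTMStrategy k} {σ : Exploration k} {v : List ℕ}

/-- An edge that is not entirely covered is used by a single robot, hence covering it entirely has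
no influence on the potential as long as the game has no robot below. -/
theorem Valid.potential_cover_one (h : σ.Valid S) (hv : v ∈ σ.visited) (h0 : v ≠ [])
    (hcl : v ∉ σ.closed) {X : List ℕ → ℕ} (hX : X v = 0) :
    potential σ.visited (Function.update σ.cover v 1) σ.robots X =
      potential σ.visited σ.cover σ.robots X := by
  rw [potential_update hv h0, hX]
  rcases (h.cover_le_one v).lt_or_eq with hlt | heq
  · simp [h.robots_eq_one v hv hcl hlt]
  · simp [heq]

theorem Valid.moves_le_of_isConfig (h : σ.Valid S) {y : ℕ → ℕ} (hy : σ.tree.IsConfig k y) :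
    (σ.moves : ℝ) ≤ σ.cost + σ.tree.transport σ.conf y +
      potential σ.visited σ.cover σ.robots (loadBelow σ.tree.leaves σ.loc y) := by
  have htri : potential σ.visited σ.cover σ.robots σ.load ≤ _ :=
    potential_triangle h.cover_nonneg σ.robots σ.load (loadBelow σ.tree.leaves σ.loc y)
  have hdist : σ.tree.transport σ.conf y =
    loadDist σ.visited σ.cover σ.load (loadBelow σ.tree.leaves σ.loc y) :=
    h.transport_eq σ.conf y h.config hy
  linarith [h.moves_le]

theorem Valid.retire (h : σ.Valid S) {K' : Finset (List ℕ)} {T' : GameTree} {y : ℕ → ℕ} {c : ℝ}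
    (r : IsRetirement σ.visited σ.full σ.closed K' σ.tree.leaves T'.leaves σ.loc v) (h0 : v ≠ [])
    (hcl : v ∉ σ.closed) (hreach : S.Reach T' y c) (hplay : T'.IsPlayable)
    (hconfig : T'.IsConfig k y) (hdepth : ∀ l ∈ T'.leaves, T'.depth l = σ.tree.depth l)
    (hconf : ∀ x, T'.IsConfig k x →
      σ.tree.IsConfig k x ∧ ∀ l ∈ σ.tree.leaves, l ∉ T'.leaves → x l = 0)
    (htrans : ∀ x x', T'.IsConfig k x → T'.IsConfig k x' →
      T'.transport x x' = σ.tree.transport x x')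
    (hcost : σ.cost + σ.tree.transport σ.conf y ≤ c) :
    Valid S { σ with
      closed := K', tree := T', conf := y, cost := c, cover := Function.update σ.cover v 1 } := by
  have hvis : v ∈ σ.visited := h.full_subset r.mem_full
  have hload : ∀ x, T'.IsConfig k x →
      loadBelow T'.leaves σ.loc x = loadBelow σ.tree.leaves σ.loc x := fun x hx =>
    funext (loadBelow_of_subset r.subset (hconf x hx).2)
  have hzero : ∀ x, loadBelow T'.leaves σ.loc x v = 0 := fun x =>
    loadBelow_of_not_covered r.not_covered
  refine { h with
    toIsSearchState := r.isSearchState h.toIsSearchState h.toIsPlacement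
    toIsPlacement := r.isPlacement h.toIsPlacement
    toIsCover := r.isCover h0 h.toIsCover
    reach := hreach
    playable := hplay
    config := hconfig
    robots_pos := fun w hw hwc => h.robots_pos w hw fun hwc' =>
      hwc ((r.mem_closed w).2 (Or.inr (Or.inl hwc')))
    robots_eq_one := fun w hw hwc hlt => ?_
    transport_eq := fun x x' hx hx' => ?_
    depth_eq := fun l hl => ?_
    moves_le := ?_ }
  · simp only [r.mem_closed, not_or] at hwc
    change Function.update σ.cover v 1 w < 1 at hlt
    rw [Function.update_of_ne hwc.1] at hlt
    exact h.robots_eq_one w hw hwc.2.1 hlt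
  · rw [htrans x x' hx hx', h.transport_eq x x' (hconf x hx).1 (hconf x' hx').1,
      loadDist_update hvis h0, hzero, hzero, hload x hx, hload x' hx']
    simp
  · have hlv : σ.loc l ≠ v := fun hlv => r.not_covered ⟨l, hl, hlv ▸ List.suffix_rfl⟩
    change _ = _ + Function.update σ.cover v 1 (σ.loc l)
    rw [hdepth l hl, h.depth_eq l (r.subset hl), Function.update_of_ne hlv]
  · change (σ.moves : ℝ) ≤ c + potential σ.visited _ σ.robots (loadBelow T'.leaves σ.loc y)
    rw [h.potential_cover_one hvis h0 hcl (hzero y), hload y hconfig]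
    linarith [h.moves_le_of_isConfig (hconf y hconfig).1]

/-- The exploration after the node `v` is closed. -/
def close (σ : Exploration k) (v : List ℕ) : Exploration k :=
  { σ with
    closed := insert v σ.closed
    cover := Function.update σ.cover v 1 }

theorem Valid.close (h : σ.Valid S) (hk : 0 < k) (hv : v ∈ σ.full) (hcl : v ∉ σ.closed)
    (hcov : ¬ σ.IsCovered v) (hch : ∀ a, a :: v ∈ σ.visited → a :: v ∈ σ.closed) :
    (σ.close v).Valid S := by
  refine h.retire (T' := σ.tree) ⟨fun w => ?_, hv, hch, subset_rfl, fun l hl hl' => absurd hl hl',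
    hcov⟩ (fun h0 => hcov (h0 ▸ h.covered_nil hk)) hcl h.reach h.playable h.config
    (fun _ _ => rfl) (fun x hx => ⟨hx, fun l hl hl' => absurd hl hl'⟩) (fun _ _ _ _ => rfl) ?_
  · rw [Finset.mem_insert, and_not_self_iff, or_false]
  · simp [GameTree.transport]

/-- The exploration after the leaf `l` of the game tree is killed. The nodes that are above no other
leaf are closed. -/
def killLeaf (S : CTMStrategy k) (σ : Exploration k) (l : ℕ) : Exploration k :=
  { σ with
    tree := σ.tree.kill l
    conf := S.respond σ.tree σ.conf (σ.tree.kill l)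
    cost := σ.cost + σ.tree.transport σ.conf (S.respond σ.tree σ.conf (σ.tree.kill l))
    closed := σ.closed ∪ σ.visited.filter fun v =>
      σ.IsCovered v ∧ ¬ Covered (σ.tree.leaves.erase l) σ.loc v
    cover := Function.update σ.cover (σ.loc l) 1 }

theorem Valid.isRetirement_killLeaf (h : σ.Valid S) {l : ℕ} (hl : l ∈ σ.tree.leaves)
    (htwo : 2 ≤ σ.tree.leaves.card) (hfull : σ.loc l ∈ σ.full)
    (hch : ∀ a, a :: σ.loc l ∈ σ.visited → a :: σ.loc l ∈ σ.closed) :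
    IsRetirement σ.visited σ.full σ.closed (σ.killLeaf S l).closed σ.tree.leaves
      (σ.tree.kill l).leaves σ.loc (σ.loc l) := by
  have hlcov : ¬ Covered (σ.tree.leaves.erase l) σ.loc (σ.loc l) := by
    rintro ⟨m, hm, hlm⟩
    exact Finset.ne_of_mem_erase hm
      (h.loc_antichain l hl m (Finset.mem_of_mem_erase hm) hlm).symm
  rw [h.playable.leaves_kill hl htwo]
  refine ⟨fun w => ?_, hfull, hch, Finset.erase_subset _ _, fun m hm hm' => ?_, hlcov⟩
  · change w ∈ σ.closed ∪ _ ↔ _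
    rw [Finset.mem_union, Finset.mem_filter]
    constructor
    · tauto
    · rintro (rfl | hw | hw)
      · exact Or.inr ⟨h.loc_mem l hl, ⟨l, hl, List.suffix_rfl⟩, hlcov⟩
      · exact Or.inl hw
      · exact Or.inr ⟨h.visited_of_covered hw.1, hw⟩
  · rw [not_imp_comm.1 (fun hml => Finset.mem_erase.2 ⟨hml, hm⟩) hm']

theorem Valid.loc_ne_nil (h : σ.Valid S) {l : ℕ} (hl : l ∈ σ.tree.leaves)
    (htwo : 2 ≤ σ.tree.leaves.card) : σ.loc l ≠ [] := by
  obtain ⟨m, hm, hml⟩ := Finset.exists_mem_ne htwo l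
  exact fun h0 => hml (h.loc_antichain l hl m hm (h0 ▸ List.nil_suffix)).symm

theorem Valid.killLeaf (h : σ.Valid S) {l : ℕ} (hl : l ∈ σ.tree.leaves)
    (htwo : 2 ≤ σ.tree.leaves.card) (hfull : σ.loc l ∈ σ.full)
    (hch : ∀ a, a :: σ.loc l ∈ σ.visited → a :: σ.loc l ∈ σ.closed) :
    (σ.killLeaf S l).Valid S := by
  have hplay := h.playable.kill hl htwo
  have hleaves := h.playable.leaves_kill hl htwo
  refine h.retire (h.isRetirement_killLeaf hl htwo hfull hch) (h.loc_ne_nil hl htwo)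
    (h.loc_not_closed l hl) (.kill l h.reach hl htwo) hplay
    (S.respond_isConfig _ _ _ h.playable.toIsSimple h.config hplay.toIsSimple) ?_ ?_ ?_ le_rfl
  · intro m hm
    rw [hleaves, Finset.mem_erase] at hm
    exact h.playable.depth_kill hl htwo hm.2 hm.1
  · refine fun x hx => ⟨h.playable.isConfig_of_kill hl htwo hx, fun m _ hm' => hx.1 m hm'⟩
  · intro x x' hx hx'
    have hp := h.playable.parent_notMem_leaves hl
    exact h.playable.transport_kill hl (h.playable.eq_zero_of_isConfig_kill hl htwo hx)
      (h.playable.eq_zero_of_isConfig_kill hl htwo hx')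
      (fun _ => (h.playable.isConfig_of_kill hl htwo hx).1 _ hp)
      (fun _ => (h.playable.isConfig_of_kill hl htwo hx').1 _ hp)

theorem Valid.loc_mem_closed_killLeaf (h : σ.Valid S) {l : ℕ} (hl : l ∈ σ.tree.leaves)
    (htwo : 2 ≤ σ.tree.leaves.card) (hfull : σ.loc l ∈ σ.full)
    (hch : ∀ a, a :: σ.loc l ∈ σ.visited → a :: σ.loc l ∈ σ.closed) :
    σ.loc l ∈ (σ.killLeaf S l).closed :=
  ((h.isRetirement_killLeaf hl htwo hfull hch).mem_closed _).2 (Or.inl rfl)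

end Exploration

namespace Exploration

variable {k : ℕ} {S : CTMStrategy k} {σ : Exploration k} {l : ℕ}

theorem Valid.robots_eq_one_of_not_covered (h : σ.Valid S) {v : List ℕ} (hv : v ∈ σ.visited)
    (hcl : v ∉ σ.closed) (hcov : ¬ σ.IsCovered v) : σ.robots v = 1 :=
  h.robots_eq_one v hv hcl (h.cover_of_not_covered v hcl hcov ▸ zero_lt_one)

section Branch

variable {T' : GameTree} {φ' : ℕ → List ℕ} {cov' : List ℕ → ℝ} {C : Finset ℕ} {e : ℕ → ℕ} {δ : ℝ}

theorem Valid.depth_eq_branch (h : σ.Valid S)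
    (b : IsBranching σ.visited σ.full σ.closed σ.tree.leaves T'.leaves σ.loc φ' l C e)
    (hone : σ.cover (σ.loc l) = 1) (hnew : ∀ c ∈ C, cov' (e c :: σ.loc l) = δ)
    (hold : ∀ w, (∀ c ∈ C, w ≠ e c :: σ.loc l) → cov' w = σ.cover w)
    (hdepth : ∀ m ∈ σ.tree.leaves.erase l, T'.depth m = σ.tree.depth m)
    (hdepth' : ∀ c ∈ C, T'.depth c = σ.tree.depth l + δ) :
    ∀ m ∈ T'.leaves, T'.depth m + 1 = (φ' m).length + cov' (φ' m) := by
  intro m hm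
  rcases b.mem_iff.1 hm with hm | hm
  · have hml := Finset.mem_of_mem_erase hm
    rw [hdepth m hm, b.loc_of_mem_erase m hm, h.depth_eq m hml, hold]
    intro c _ hmc
    exact h.not_covered_cons_loc b.mem_leaves (e c) ⟨m, hml, hmc ▸ List.suffix_rfl⟩
  · have hdl := h.depth_eq l b.mem_leaves
    rw [hdepth' m hm, b.loc_of_mem m hm, hnew m hm, List.length_cons]
    rw [hone] at hdl
    push_cast
    linarith

/-- `z x` is the configuration that is obtained from `x` when the robots on `C` go back to `l`. -/
theorem Valid.branch (h : σ.Valid S) {y : ℕ → ℕ} {c : ℝ} (z : (ℕ → ℕ) → ℕ → ℕ)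
    (b : IsBranching σ.visited σ.full σ.closed σ.tree.leaves T'.leaves σ.loc φ' l C e)
    (hone : σ.cover (σ.loc l) = 1) (hδ0 : 0 ≤ δ) (hδ1 : δ ≤ 1)
    (hnew : ∀ c ∈ C, cov' (e c :: σ.loc l) = δ)
    (hold : ∀ w, (∀ c ∈ C, w ≠ e c :: σ.loc l) → cov' w = σ.cover w)
    (hreach : S.Reach T' y c) (hplay : T'.IsPlayable) (hconfig : T'.IsConfig k y)
    (hdepth : ∀ m ∈ σ.tree.leaves.erase l, T'.depth m = σ.tree.depth m)
    (hdepth' : ∀ c ∈ C, T'.depth c = σ.tree.depth l + δ)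
    (hz : ∀ x, T'.IsConfig k x → σ.tree.IsConfig k (z x) ∧
      (∀ m ∈ σ.tree.leaves.erase l, z x m = x m) ∧ z x l = ∑ c ∈ C, x c)
    (htrans : ∀ x x', T'.IsConfig k x → T'.IsConfig k x' → T'.transport x x' =
      σ.tree.transport (z x) (z x') + δ * ∑ c ∈ C, |(x c : ℝ) - x' c|)
    (hcost : σ.cost + σ.tree.transport σ.conf (z y) + δ * ∑ c ∈ C, (y c : ℝ) ≤ c) :
    Valid S { σ with tree := T', conf := y, cost := c, loc := φ', cover := cov' } := by
  have h_robots : ∀ c ∈ C, σ.robots (e c :: σ.loc l) = 1 := fun c hc =>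
    h.robots_eq_one_of_not_covered (b.visited c hc) (b.not_closed c hc)
      (h.not_covered_cons_loc b.mem_leaves _)
  refine { h with
    toIsPlacement := b.isPlacement h.toIsPlacement
    toIsCover := b.isCover h.toIsPlacement h.toIsCover hone hδ0 hδ1 hnew hold
    reach := hreach
    playable := hplay
    config := hconfig
    robots_eq_one := fun w hw hwc hlt => ?_
    transport_eq := fun x x' hx hx' => ?_
    depth_eq := h.depth_eq_branch b hone hnew hold hdepth hdepth'
    moves_le := ?_ }
  · by_cases hwC : ∃ c ∈ C, w = e c :: σ.loc l
    · obtain ⟨c, hc, rfl⟩ := hwC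
      exact h_robots c hc
    · push Not at hwC
      exact h.robots_eq_one w hw hwc (hold w hwC ▸ hlt)
  · obtain ⟨hzc, hzo, hzl⟩ := hz x hx
    obtain ⟨hzc', hzo', hzl'⟩ := hz x' hx'
    rw [htrans x x' hx hx', h.transport_eq _ _ hzc hzc',
      b.loadDist_eq h.toIsPlacement hnew hold hzo hzl hzo' hzl']
  · obtain ⟨hzc, hzo, hzl⟩ := hz y hconfig
    change (σ.moves : ℝ) ≤ c + potential σ.visited cov' σ.robots (loadBelow T'.leaves φ' y)
    linarith [h.moves_le_of_isConfig hzc,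
      b.potential_le h.toIsPlacement h.toIsCover hδ0 hnew hold hzo hzl h_robots]

end Branch

/-- The exploration after the leaf `l` of the game tree enters the edge that goes down along the
label `a`. -/
def advance (σ : Exploration k) (l a : ℕ) : Exploration k :=
  { σ with loc := Function.update σ.loc l (a :: σ.loc l) }

theorem Valid.advance (h : σ.Valid S) {a : ℕ} (hl : l ∈ σ.tree.leaves)
    (hfull : σ.loc l ∈ σ.full) (hone : σ.cover (σ.loc l) = 1) (ha : a :: σ.loc l ∈ σ.visited)
    (hacl : a :: σ.loc l ∉ σ.closed)
    (hch : ∀ b, b :: σ.loc l ∈ σ.visited → b :: σ.loc l ∉ σ.closed → b = a) :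
    (σ.advance l a).Valid S := by
  have hcover : σ.cover (a :: σ.loc l) = 0 :=
    h.cover_of_not_covered _ hacl (h.not_covered_cons_loc hl a)
  refine h.branch (T' := σ.tree) (C := {l}) (e := fun _ => a) (δ := 0) (z := id)
    { mem_leaves := hl
      mem_full := hfull
      leaves_eq := by rw [Finset.union_comm, ← Finset.insert_eq, Finset.insert_erase hl]
      disjoint := Finset.disjoint_singleton_right.2 (Finset.notMem_erase l _)
      nonempty := Finset.singleton_nonempty l
      injOn := by simp
      loc_of_mem_erase := fun m hm => Function.update_of_ne (Finset.ne_of_mem_erase hm) _ _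
      loc_of_mem := by simp
      visited := fun _ _ => ha
      not_closed := fun _ _ => hacl
      exists_eq := fun b hb hbcl => ⟨l, Finset.mem_singleton_self l, (hch b hb hbcl).symm⟩ }
    hone le_rfl zero_le_one (fun _ _ => hcover) (fun _ _ => rfl) h.reach h.playable h.config
    (fun _ _ => rfl) (by simp) (by simp) (by simp) (by simp [GameTree.transport])

end Exploration

theorem GameTree.gather_eq_self {l : ℕ} {C : Finset ℕ} {x : ℕ → ℕ} (hx : ∀ c ∈ C, x c = 0) :
    GameTree.gather l C x = x := by
  funext u
  rw [GameTree.gather, Finset.sum_eq_zero hx, add_zero]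
  split_ifs with hul huC
  · rw [hul]
  · exact (hx u huC).symm
  · rfl

namespace Exploration

variable {k : ℕ} {S : CTMStrategy k} {σ : Exploration k} {l : ℕ}

/-- The exploration after the leaf `l` of the game tree receives the elements of `C` as children.
The child `c` is located on the edge that goes down from `loc l` along the label `e c`. -/
def forkLeaf (S : CTMStrategy k) (σ : Exploration k) (l : ℕ) (C : Finset ℕ) (e : ℕ → ℕ) :
    Exploration k :=
  let δ := S.forkLen σ.tree σ.conf l C.card
  let T := σ.tree.fork l C δ
  { σ with
    tree := T
    conf := S.respond σ.tree σ.conf T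
    cost := σ.cost + T.transport σ.conf (S.respond σ.tree σ.conf T)
    loc := fun u => if u ∈ C then e u :: σ.loc l else σ.loc u
    cover := fun w => if ∃ c ∈ C, w = e c :: σ.loc l then δ else σ.cover w }

theorem Valid.forkLeaf (h : σ.Valid S) {C : Finset ℕ} {e : ℕ → ℕ} (hl : l ∈ σ.tree.leaves)
    (hC : Disjoint C σ.tree.verts) (htwo : 2 ≤ C.card) (hcard : C.card + 1 ≤ σ.conf l)
    (he : Set.InjOn e C) (hfull : σ.loc l ∈ σ.full) (hone : σ.cover (σ.loc l) = 1)
    (hvis : ∀ c ∈ C, e c :: σ.loc l ∈ σ.visited) (hcl : ∀ c ∈ C, e c :: σ.loc l ∉ σ.closed)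
    (hch : ∀ a, a :: σ.loc l ∈ σ.visited → a :: σ.loc l ∉ σ.closed → ∃ c ∈ C, e c = a) :
    (σ.forkLeaf S l C e).Valid S := by
  set δ := S.forkLen σ.tree σ.conf l C.card
  have hδ : 0 < δ := S.forkLen_pos _ _ _ _
  have hne : C.Nonempty := Finset.card_pos.1 (by omega)
  have hW := h.playable.isWeightedTree
  have hplay : (σ.tree.fork l C δ).IsPlayable := h.playable.fork hC hl htwo hδ
  have hleaves := hW.leaves_fork (δ := δ) hC hl hne
  have hdisj : Disjoint σ.tree.leaves C := hC.symm.mono_left σ.tree.leaves_subset_verts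
  have hlC : l ∉ C := Finset.disjoint_left.1 hdisj hl
  have not_mem_of_mem_erase : ∀ m ∈ σ.tree.leaves.erase l, m ∉ C := fun m hm =>
    Finset.disjoint_left.1 hdisj (Finset.mem_of_mem_erase hm)
  have conf_eq_zero : ∀ c ∈ C, σ.conf c = 0 := fun c hc =>
    h.config.1 c (Finset.disjoint_right.1 hdisj hc)
  refine h.branch (T' := σ.tree.fork l C δ) (C := C) (e := e) (δ := δ) (z := GameTree.gather l C)
    { mem_leaves := hl
      mem_full := hfull
      leaves_eq := hleaves
      disjoint := hdisj.mono_left (Finset.erase_subset _ _)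
      nonempty := hne
      injOn := he
      loc_of_mem_erase := fun m hm => if_neg (not_mem_of_mem_erase m hm)
      loc_of_mem := fun c hc => if_pos hc
      visited := hvis
      not_closed := hcl
      exists_eq := hch }
    hone hδ.le (S.forkLen_le_one _ _ _ _) (fun c hc => if_pos ⟨c, hc, rfl⟩)
    (fun w hw => if_neg (by push Not; exact hw)) (.fork l C _ h.reach hl hC htwo hcard rfl) hplay
    (S.respond_isConfig _ _ _ h.playable.toIsSimple h.config hplay.toIsSimple)
    (fun m hm => hW.depth_fork_old hC (σ.tree.leaves_subset_verts (Finset.mem_of_mem_erase hm)))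
    (fun c hc => hW.depth_fork_new hC (σ.tree.leaves_subset_verts hl) hc)
    (fun x hx => ⟨hW.isConfig_gather hC hl hne hx, fun m hm => ?_, ?_⟩)
    (fun x x' _ _ => hW.transport_fork hC hl hδ.le x x') ?_
  · exact GameTree.gather_of_ne x (Finset.ne_of_mem_erase hm) (not_mem_of_mem_erase m hm)
  · rw [GameTree.gather_self, hx.1 l (by simp [hleaves, hlC]), zero_add]
  · rw [hW.transport_fork hC hl hδ.le, GameTree.gather_eq_self conf_eq_zero, add_assoc]
    refine (congrArg _ (congrArg _ (congrArg _ (Finset.sum_congr rfl fun c hc => ?_)))).ge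
    rw [conf_eq_zero c hc, Nat.cast_zero, zero_sub, abs_neg, Nat.abs_cast]

/-- The exploration after the edge of the leaf `l` of the game tree grows by `s`. -/
def elongateLeaf (S : CTMStrategy k) (σ : Exploration k) (l : ℕ) (s : ℝ) : Exploration k :=
  let T := σ.tree.elongate l s
  { σ with
    tree := T
    conf := S.respond T σ.conf T
    cost := σ.cost + s * (σ.conf l : ℝ) + T.transport σ.conf (S.respond T σ.conf T)
    cover := Function.update σ.cover (σ.loc l) (σ.cover (σ.loc l) + s) }

theorem Valid.loc_ne_nil_of_cover_lt (h : σ.Valid S) (hlt : σ.cover (σ.loc l) < 1) :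
    σ.loc l ≠ [] :=
  fun h0 => hlt.ne (h0 ▸ h.cover_nil)

theorem Valid.isCover_update (h : σ.Valid S) {r : ℝ} (hl : l ∈ σ.tree.leaves)
    (h0 : σ.loc l ≠ []) (hr0 : 0 ≤ r) (hr1 : r ≤ 1) :
    IsCover σ.closed σ.tree.leaves σ.loc (Function.update σ.cover (σ.loc l) r) where
  cover_nil := by rw [Function.update_of_ne h0.symm, h.cover_nil]
  cover_nonneg w := by
    rw [Function.update_apply]
    split_ifs
    exacts [hr0, h.cover_nonneg w]
  cover_le_one w := by
    rw [Function.update_apply]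
    split_ifs
    exacts [hr1, h.cover_le_one w]
  cover_closed w hw := by
    rw [Function.update_of_ne (ne_of_mem_of_not_mem hw (h.loc_not_closed l hl))]
    exact h.cover_closed w hw
  cover_of_not_covered w hw hwc := by
    rw [Function.update_of_ne fun hwl : w = σ.loc l => hwc ⟨l, hl, hwl ▸ List.suffix_rfl⟩]
    exact h.cover_of_not_covered w hw hwc
  cover_of_interior w hw := by
    obtain ⟨m, hm, hwm, hne⟩ := hw
    rw [Function.update_of_ne, h.cover_of_interior w ⟨m, hm, hwm, hne⟩]
    rintro rfl
    exact hne (congrArg σ.loc (h.loc_antichain l hl m hm hwm))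

theorem Valid.transport_elongate (h : σ.Valid S) {s : ℝ} (hl : l ∈ σ.tree.leaves)
    (h0 : σ.loc l ≠ []) {x x' : ℕ → ℕ} (hx : σ.tree.IsConfig k x) (hx' : σ.tree.IsConfig k x') :
    (σ.tree.elongate l s).transport x x' =
      loadDist σ.visited (Function.update σ.cover (σ.loc l) (σ.cover (σ.loc l) + s))
        (loadBelow σ.tree.leaves σ.loc x) (loadBelow σ.tree.leaves σ.loc x') := by
  rw [h.playable.isWeightedTree.transport_elongate hl (h.playable.ne_zero hl),
    loadDist_update (h.loc_mem l hl) h0, loadBelow_loc hl (h.loc_antichain l hl),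
    loadBelow_loc hl (h.loc_antichain l hl), h.transport_eq x x' hx hx', add_sub_cancel_left]

/-- A lonely robot walks along the edge that is being covered: there is a deficit of at least one
robot on this edge, so that the potential decreases at most as fast as the cost increases. -/
theorem Valid.moves_le_elongate (h : σ.Valid S) {s : ℝ} (hl : l ∈ σ.tree.leaves)
    (htwo : 2 ≤ σ.conf l) (hs : 0 ≤ s) (hlt : σ.cover (σ.loc l) < 1) :
    (σ.moves : ℝ) ≤ σ.cost + s * (σ.conf l : ℝ) + potential σ.visited
      (Function.update σ.cover (σ.loc l) (σ.cover (σ.loc l) + s)) σ.robots σ.load := by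
  have h0 := h.loc_ne_nil_of_cover_lt hlt
  have : (2 : ℝ) ≤ σ.conf l := by exact_mod_cast htwo
  rw [potential_update (h.loc_mem l hl) h0, h.load_loc hl,
    h.robots_eq_one _ (h.loc_mem l hl) (h.loc_not_closed l hl) hlt,
    abs_of_nonpos (by norm_num; linarith)]
  push_cast
  nlinarith [h.moves_le]

theorem Valid.depth_elongate (h : σ.Valid S) {m : ℕ} (hl : l ∈ σ.tree.leaves)
    (hm : m ∈ σ.tree.leaves) (s : ℝ) :
    (σ.tree.elongate l s).depth m + 1 = (σ.loc m).length +
      Function.update σ.cover (σ.loc l) (σ.cover (σ.loc l) + s) (σ.loc m) := by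
  rw [h.playable.isWeightedTree.depth_elongate hl (h.playable.ne_zero hl)
    (σ.tree.leaves_subset_verts hm)]
  rcases eq_or_ne m l with rfl | hml
  · rw [if_pos rfl, Function.update_self]
    linarith [h.depth_eq m hl]
  · have hne : σ.loc m ≠ σ.loc l := fun heq =>
      hml (h.loc_antichain m hm l hl (heq ▸ List.suffix_rfl))
    rw [if_neg hml, add_zero, Function.update_of_ne hne, h.depth_eq m hm]

theorem Valid.elongateLeaf (h : σ.Valid S) {s : ℝ} (hl : l ∈ σ.tree.leaves)
    (htwo : 2 ≤ σ.conf l) (hs : 0 ≤ s) (hlt : σ.cover (σ.loc l) < 1)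
    (hle : σ.cover (σ.loc l) + s ≤ 1)
    (hwait : ∀ s', 0 ≤ s' → s' < s →
      S.respond (σ.tree.elongate l s') σ.conf (σ.tree.elongate l s') = σ.conf) :
    (σ.elongateLeaf S l s).Valid S := by
  have h0 := h.loc_ne_nil_of_cover_lt hlt
  have hvis := h.loc_mem l hl
  have hcl := h.loc_not_closed l hl
  have hplay : (σ.tree.elongate l s).IsPlayable := h.playable.elongate hs
  have hresp : (σ.tree.elongate l s).IsConfig k _ :=
    S.respond_isConfig _ σ.conf _ hplay.toIsSimple h.config hplay.toIsSimple
  have hcover := h.isCover_update hl h0 (add_nonneg (h.cover_nonneg (σ.loc l)) hs) hle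
  refine { h with
    toIsCover := hcover
    reach := .elongate l s h.reach hl htwo hs hwait
    playable := hplay
    config := hresp
    robots_eq_one := fun w hw hwc hwlt => ?_
    transport_eq := fun x x' => h.transport_elongate hl h0
    depth_eq := fun m hm => h.depth_elongate hl hm s
    moves_le := ?_ }
  · rcases eq_or_ne w (σ.loc l) with rfl | hwl
    · exact h.robots_eq_one _ hvis hcl hlt
    · exact h.robots_eq_one w hw hwc (Function.update_of_ne hwl _ σ.cover ▸ hwlt)
  · have htri : _ ≤ potential _ _ _ (loadBelow σ.tree.leaves σ.loc
        (S.respond (σ.tree.elongate l s) σ.conf (σ.tree.elongate l s))) + _ :=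
      potential_triangle (V := σ.visited) hcover.cover_nonneg σ.robots σ.load _
    change (σ.moves : ℝ) ≤ σ.cost + s * (σ.conf l : ℝ) + (σ.tree.elongate l s).transport _ _ +
      potential σ.visited (Function.update σ.cover (σ.loc l) _) σ.robots
        (loadBelow σ.tree.leaves σ.loc _)
    rw [h.transport_elongate hl h0 h.config hresp]
    have hmoves := h.moves_le_elongate hl htwo hs hlt
    rw [add_right_comm, add_assoc _ (potential _ _ _ _)]
    exact hmoves.trans (add_le_add_right htri _)

end Exploration

/-- A reaction of the player moves some robot along the edge of a leaf. -/
theorem GameTree.IsPlayable.le_transport {k : ℕ} {T : GameTree} (hT : T.IsPlayable)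
    {x x' : ℕ → ℕ} (hx : T.IsConfig k x) (hx' : T.IsConfig k x') (hne : x ≠ x') {ε : ℝ}
    (hε : 2 ≤ T.leaves.card → ∀ l ∈ T.leaves, ε ≤ T.len l) : ε ≤ T.transport x x' := by
  obtain ⟨l, hxl⟩ := Function.ne_iff.1 hne
  have hl : l ∈ T.leaves := by
    by_contra hl
    exact hxl (by rw [hx.1 l hl, hx'.1 l hl])
  have htwo : 2 ≤ T.leaves.card := by
    by_contra hcard
    have hone : T.leaves.card = 1 := by
      have := Finset.card_pos.2 ⟨l, hl⟩
      omega
    obtain ⟨m, hm⟩ := Finset.card_eq_one.1 hone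
    obtain rfl := Finset.mem_singleton.1 (hm ▸ hl)
    have hsum := hx.2.trans hx'.2.symm
    rw [hm, Finset.sum_singleton, Finset.sum_singleton] at hsum
    exact hxl hsum
  have habs : (1 : ℝ) ≤ |(x l : ℝ) - x' l| := by
    exact_mod_cast Int.one_le_abs (sub_ne_zero.2 (by exact_mod_cast hxl : (x l : ℤ) ≠ x' l))
  calc ε ≤ T.len l * 1 := by rw [mul_one]; exact hε htwo l hl
    _ ≤ T.len l * |(x l : ℝ) - x' l| := mul_le_mul_of_nonneg_left habs (hT.len_pos htwo l hl).le
    _ ≤ T.transport x x' :=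
      hT.isWeightedTree.len_mul_abs_sub_le_transport hl (hT.ne_zero hl) x x'

namespace Exploration

variable {k : ℕ} {S : CTMStrategy k} {σ τ υ : Exploration k} {f : ℝ → ℝ} {l : ℕ} {s ε : ℝ}

/-- `τ` differs from `σ` by the state of the game only. -/
structure SameTeam (σ τ : Exploration k) : Prop where
  visited : τ.visited = σ.visited
  full : τ.full = σ.full
  closed : τ.closed = σ.closed
  pos : τ.pos = σ.pos
  moves : τ.moves = σ.moves

/-- Moreover the leaves of the game tree of `τ` are those of `σ`, at the same locations. -/
structure SamePlacement (σ τ : Exploration k) : Prop extends SameTeam σ τ where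
  leaves : τ.tree.leaves = σ.tree.leaves
  loc : τ.loc = σ.loc

theorem SameTeam.refl (σ : Exploration k) : σ.SameTeam σ := ⟨rfl, rfl, rfl, rfl, rfl⟩

theorem SameTeam.trans (h : σ.SameTeam τ) (h' : τ.SameTeam υ) : σ.SameTeam υ :=
  ⟨h'.visited.trans h.visited, h'.full.trans h.full, h'.closed.trans h.closed,
    h'.pos.trans h.pos, h'.moves.trans h.moves⟩

theorem SamePlacement.refl (σ : Exploration k) : σ.SamePlacement σ := ⟨.refl σ, rfl, rfl⟩

theorem SamePlacement.trans (h : σ.SamePlacement τ) (h' : τ.SamePlacement υ) :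
    σ.SamePlacement υ :=
  ⟨h.toSameTeam.trans h'.toSameTeam, h'.leaves.trans h.leaves, h'.loc.trans h.loc⟩

theorem samePlacement_elongateLeaf (S : CTMStrategy k) (σ : Exploration k) (l : ℕ) (s : ℝ) :
    σ.SamePlacement (σ.elongateLeaf S l s) := ⟨⟨rfl, rfl, rfl, rfl, rfl⟩, rfl, rfl⟩

theorem Valid.cost_le (h : σ.Valid S) (hf : S.IsBounded f) (hl : l ∈ σ.tree.leaves) :
    σ.cost ≤ f (σ.loc l).length :=
  hf _ _ _ h.reach _ ⟨l, hl, by linarith [h.depth_eq l hl, h.cover_le_one (σ.loc l)]⟩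

theorem Valid.exists_elongateLeaf (h : σ.Valid S) (hl : l ∈ σ.tree.leaves) (htwo : 2 ≤ σ.conf l)
    (hlt : σ.cover (σ.loc l) < 1) :
    ∃ s, 0 ≤ s ∧ (σ.elongateLeaf S l s).Valid S ∧
      (σ.cover (σ.loc l) + s = 1 ∨ (σ.elongateLeaf S l s).conf ≠ σ.conf) := by
  set R := {s | 0 ≤ s ∧ S.respond (σ.tree.elongate l s) σ.conf (σ.tree.elongate l s) ≠ σ.conf}
  have no_reaction {s : ℝ} (hs : s ∉ R) (hs0 : 0 ≤ s) :
      S.respond (σ.tree.elongate l s) σ.conf (σ.tree.elongate l s) = σ.conf := by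
    by_contra hne
    exact hs ⟨hs0, hne⟩
  by_cases hR : ∃ s ∈ R, s ≤ 1 - σ.cover (σ.loc l)
  · obtain ⟨s, hsR, hs⟩ := hR
    obtain ⟨s₀, hs₀R, hmin⟩ := S.exists_first_move σ.tree σ.conf l h.playable.toIsSimple h.config
      hl htwo ⟨s, hsR⟩
    have hs₀ : s₀ ≤ s := hmin hsR
    exact ⟨s₀, hs₀R.1, h.elongateLeaf hl htwo hs₀R.1 hlt (by linarith) fun s' h0 hs' =>
      no_reaction (fun hs'R => (hmin hs'R).not_gt hs') h0, Or.inr hs₀R.2⟩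
  · push Not at hR
    exact ⟨1 - σ.cover (σ.loc l), by linarith,
      h.elongateLeaf hl htwo (by linarith) hlt (by linarith) fun s' h0 hs' =>
        no_reaction (fun hs'R => (hR s' hs'R).not_gt hs') h0, Or.inl (by ring)⟩

theorem cover_le_cover_elongateLeaf (hs : 0 ≤ s) (w : List ℕ) :
    σ.cover w ≤ (σ.elongateLeaf S l s).cover w := by
  change _ ≤ Function.update σ.cover (σ.loc l) (σ.cover (σ.loc l) + s) w
  rw [Function.update_apply]
  split_ifs with hw
  · rw [hw]
    linarith
  · exact le_rfl

theorem Valid.cost_le_cost_elongateLeaf (h : σ.Valid S) (hs : 0 ≤ s) :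
    σ.cost ≤ (σ.elongateLeaf S l s).cost := by
  have htrans := (h.playable.elongate (l := l) hs).isWeightedTree.transport_nonneg σ.conf
    (σ.elongateLeaf S l s).conf
  have hmove : 0 ≤ s * (σ.conf l : ℝ) := by positivity
  change _ ≤ σ.cost + s * (σ.conf l : ℝ) + _
  exact (le_add_of_nonneg_right hmove).trans (le_add_of_nonneg_right htrans)

theorem Valid.cost_add_le_cost_elongateLeaf (h : σ.Valid S) (hs : 0 ≤ s)
    (h' : (σ.elongateLeaf S l s).Valid S) (hne : (σ.elongateLeaf S l s).conf ≠ σ.conf)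
    (hlen : 2 ≤ σ.tree.leaves.card → ∀ m ∈ σ.tree.leaves, ε ≤ σ.tree.len m) :
    σ.cost + ε ≤ (σ.elongateLeaf S l s).cost := by
  have htrans : ε ≤ (σ.tree.elongate l s).transport _ _ :=
    h'.playable.le_transport (x := σ.conf) h.config h'.config hne.symm fun htwo m hm =>
      (hlen htwo m hm).trans (GameTree.len_le_len_elongate hs)
  have hmove : 0 ≤ s * (σ.conf l : ℝ) := by positivity
  change _ ≤ σ.cost + s * (σ.conf l : ℝ) + _
  exact add_le_add (le_add_of_nonneg_right hmove) htrans

/-- The leaves of the game tree that are located inside edges. -/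
def partialLeaves (σ : Exploration k) : Finset ℕ :=
  σ.tree.leaves.filter fun l => σ.cover (σ.loc l) < 1

/-- An elongation stops when the player reacts, at a cost of at least `ε`, or at a node. -/
theorem Valid.exists_progress (h : σ.Valid S) (hε : 0 < ε)
    (hlen : 2 ≤ σ.tree.leaves.card → ∀ m ∈ σ.tree.leaves, ε ≤ σ.tree.len m) (he : ¬ σ.Eager) :
    ∃ l s, 0 ≤ s ∧ (σ.elongateLeaf S l s).Valid S ∧
      σ.cost + ε * ((σ.elongateLeaf S l s).partialLeaves.card + 1) ≤
        (σ.elongateLeaf S l s).cost + ε * σ.partialLeaves.card := by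
  unfold Eager at he
  push Not at he
  obtain ⟨l, hl, htwo, hne⟩ := he
  have hlt : σ.cover (σ.loc l) < 1 := (h.cover_le_one _).lt_of_ne hne
  obtain ⟨s, hs, h', hs'⟩ := h.exists_elongateLeaf hl htwo hlt
  have hsub : (σ.elongateLeaf S l s).partialLeaves ⊆ σ.partialLeaves :=
    Finset.monotone_filter_right _ fun _ _ hm => (cover_le_cover_elongateLeaf hs _).trans_lt hm
  refine ⟨l, s, hs, h', ?_⟩
  rcases hs' with hs' | hmove
  · have hnotMem : l ∉ (σ.elongateLeaf S l s).partialLeaves := by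
      refine fun hmem => (Finset.mem_filter.1 hmem).2.not_ge ?_
      change 1 ≤ Function.update σ.cover (σ.loc l) (σ.cover (σ.loc l) + s) (σ.loc l)
      rw [Function.update_self, hs']
    have hcard : ((σ.elongateLeaf S l s).partialLeaves.card : ℝ) + 1 ≤ σ.partialLeaves.card := by
      exact_mod_cast Finset.card_lt_card (Finset.ssubset_iff_of_subset hsub |>.2
        ⟨l, Finset.mem_filter.2 ⟨hl, hlt⟩, hnotMem⟩)
    exact add_le_add (h.cost_le_cost_elongateLeaf hs) (mul_le_mul_of_nonneg_left hcard hε.le)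
  · have hcard : ((σ.elongateLeaf S l s).partialLeaves.card : ℝ) ≤ σ.partialLeaves.card := by
      exact_mod_cast Finset.card_le_card hsub
    linarith [h.cost_add_le_cost_elongateLeaf hs h' hmove hlen,
      mul_le_mul_of_nonneg_left hcard hε.le]

/-- The cost of the game is bounded, hence there are finitely many reactions of the player until all
elongations are exhausted. -/
theorem Valid.exists_eager_of_lt (h : σ.Valid S) (hf : S.IsBounded f) (hl : l ∈ σ.tree.leaves)
    (hε : 0 < ε) (hlen : 2 ≤ σ.tree.leaves.card → ∀ m ∈ σ.tree.leaves, ε ≤ σ.tree.len m) {n : ℕ}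
    (hn : f (σ.loc l).length - σ.cost + ε * σ.partialLeaves.card < ε * n) :
    ∃ τ : Exploration k, τ.Valid S ∧ τ.Eager ∧ σ.SamePlacement τ := by
  induction n generalizing σ with
  | zero =>
    have : 0 ≤ ε * (σ.partialLeaves.card : ℝ) := by positivity
    rw [Nat.cast_zero, mul_zero] at hn
    linarith [h.cost_le hf hl]
  | succ n ih =>
    by_cases he : σ.Eager
    · exact ⟨σ, h, he, .refl σ⟩
    · obtain ⟨m, s, hs, h', hprogress⟩ := h.exists_progress hε hlen he
      obtain ⟨τ, hτ, hτe, hστ⟩ := ih h' hl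
        (fun htwo m hm => (hlen htwo m hm).trans (GameTree.len_le_len_elongate hs)) (by
          change f (σ.loc l).length - _ + _ < _
          push_cast at hn
          linarith)
      exact ⟨τ, hτ, hτe, (samePlacement_elongateLeaf S σ m s).trans hστ⟩

theorem Valid.exists_eager (h : σ.Valid S) (hk : 0 < k) (hf : S.IsBounded f) :
    ∃ τ : Exploration k, τ.Valid S ∧ τ.Eager ∧ σ.SamePlacement τ := by
  obtain ⟨l, hl⟩ := h.leaves_nonempty hk
  obtain ⟨ε, hε, hlen⟩ : ∃ ε : ℝ, 0 < ε ∧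
      (2 ≤ σ.tree.leaves.card → ∀ m ∈ σ.tree.leaves, ε ≤ σ.tree.len m) := by
    by_cases htwo : 2 ≤ σ.tree.leaves.card
    · obtain ⟨m, hm, hmin⟩ := Finset.exists_min_image σ.tree.leaves σ.tree.len ⟨l, hl⟩
      exact ⟨σ.tree.len m, h.playable.len_pos htwo m hm, fun _ => hmin⟩
    · exact ⟨1, one_pos, fun htwo' => absurd htwo' htwo⟩
  obtain ⟨n, hn⟩ := exists_nat_gt ((f (σ.loc l).length - σ.cost + ε * σ.partialLeaves.card) / ε)
  rw [div_lt_iff₀' hε] at hn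
  exact h.exists_eager_of_lt hf hl hε hlen hn

end Exploration

theorem exists_disjoint_injOn_image_eq (V A : Finset ℕ) :
    ∃ (C : Finset ℕ) (e : ℕ → ℕ), Disjoint C V ∧ C.card = A.card ∧ Set.InjOn e C ∧
      C.image e = A := by
  set N := V.sup id + 1
  refine ⟨A.image (· + N), fun c => c - N, ?_, ?_, ?_, ?_⟩
  · refine Finset.disjoint_left.2 fun c hc hcV => ?_
    obtain ⟨a, -, rfl⟩ := Finset.mem_image.1 hc
    have : a + N ≤ V.sup id := Finset.le_sup (f := id) hcV
    omega
  · exact Finset.card_image_of_injective _ (add_left_injective N)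
  · rw [Finset.coe_image]
    rintro _ ⟨a, -, rfl⟩ _ ⟨b, -, rfl⟩ hab
    simpa using hab
  · simp [Finset.image_image, Function.comp_def]

namespace Exploration

variable {k : ℕ} {S : CTMStrategy k} {σ τ υ : Exploration k} {f : ℝ → ℝ} {K : Finset (List ℕ)}
  {i : Fin k} {l a : ℕ} {v w : List ℕ}

/-- The labels that lead from `v` to visited nodes that are not closed. -/
def openLabels (σ : Exploration k) (v : List ℕ) : Finset ℕ :=
  (σ.visited.image fun w => w.headD 0).filter fun a => a :: v ∈ σ.visited ∧ a :: v ∉ σ.closed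

theorem mem_openLabels : a ∈ σ.openLabels v ↔ a :: v ∈ σ.visited ∧ a :: v ∉ σ.closed := by
  unfold openLabels
  rw [Finset.mem_filter, Finset.mem_image]
  exact ⟨fun h => h.2, fun h => ⟨⟨a :: v, h.1, rfl⟩, h⟩⟩

namespace Valid

theorem mem_openLabels_of_covered (h : σ.Valid S) (ha : σ.IsCovered (a :: v)) :
    a ∈ σ.openLabels v :=
  mem_openLabels.2 ⟨h.visited_of_covered ha, h.not_closed_of_covered ha⟩

theorem openLabels_nonempty_of_interior (h : σ.Valid S) (hv : Interior σ.tree.leaves σ.loc v) :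
    (σ.openLabels v).Nonempty := by
  obtain ⟨l, hl, hvl, hne⟩ := hv
  obtain ⟨a, ha⟩ := exists_cons_suffix hvl hne
  exact ⟨a, h.mem_openLabels_of_covered ⟨l, hl, ha⟩⟩

theorem card_openLabels_lt (h : σ.Valid S) (i : Fin k) :
    (σ.openLabels (σ.pos i)).card < σ.robots (σ.pos i) :=
  calc (σ.openLabels (σ.pos i)).card = ∑ _ ∈ σ.openLabels (σ.pos i), 1 := Finset.card_eq_sum_ones _
    _ ≤ ∑ a ∈ σ.openLabels (σ.pos i), robotsBelow σ.pos (a :: σ.pos i) :=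
      Finset.sum_le_sum fun _ ha => h.robots_pos _ (mem_openLabels.1 ha).1 (mem_openLabels.1 ha).2
    _ < σ.robots (σ.pos i) := sum_robotsBelow_lt σ.pos i _

theorem loc_ne_of_interior (h : σ.Valid S) (hv : Interior σ.tree.leaves σ.loc v)
    (hl : l ∈ σ.tree.leaves) : σ.loc l ≠ v := by
  rintro rfl
  obtain ⟨m, hm, hlm, hne⟩ := hv
  exact hne (congrArg σ.loc (h.loc_antichain l hl m hm hlm))

theorem ne_nil_of_load_lt (h : σ.Valid S) (hv : σ.load v < σ.robots v) : v ≠ [] := by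
  rintro rfl
  rw [h.load_nil, robots, robotsBelow_nil] at hv
  exact lt_irrefl _ hv

/-- If no child requests more robots than it has, then the robot `i`, which is below no child, is in
excess. -/
theorem move_interior (h : σ.Valid S) (he : σ.Eager)
    (hi : Interior σ.tree.leaves σ.loc (σ.pos i)) :
    (∃ a, a :: σ.pos i ∈ σ.visited ∧ (σ.move i (a :: σ.pos i)).Valid S) ∨
      (σ.pos i ≠ [] ∧ (σ.move i (σ.pos i).tail).Valid S) := by
  by_cases hex : ∃ a ∈ σ.openLabels (σ.pos i), σ.robots (a :: σ.pos i) < σ.load (a :: σ.pos i)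
  · obtain ⟨a, ha, hlt⟩ := hex
    rw [mem_openLabels] at ha
    have hrobots := h.robots_pos _ ha.1 ha.2
    exact Or.inl ⟨a, ha.1, h.move_down ha.1 (h.cover_eq_one he (by omega)) hlt⟩
  · push Not at hex
    have hload : σ.load (σ.pos i) < σ.robots (σ.pos i) :=
      calc σ.load (σ.pos i) = ∑ a ∈ σ.openLabels (σ.pos i), σ.load (a :: σ.pos i) :=
            loadBelow_eq_sum_children (fun l hl => h.loc_ne_of_interior hi hl)
              fun a ha => h.mem_openLabels_of_covered ha
        _ ≤ ∑ a ∈ σ.openLabels (σ.pos i), σ.robots (a :: σ.pos i) := Finset.sum_le_sum hex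
        _ < σ.robots (σ.pos i) := sum_robotsBelow_lt σ.pos i _
    have hopen := (h.openLabels_nonempty_of_interior hi).card_pos
    have hcard := h.card_openLabels_lt i
    have h0 := h.ne_nil_of_load_lt hload
    exact Or.inr ⟨h0, h.move_up h0 (h.cover_of_interior _ hi) hload (Or.inr (by omega))⟩

theorem interior_advance (hl : l ∈ σ.tree.leaves) (a : ℕ) :
    Interior (σ.advance l a).tree.leaves (σ.advance l a).loc (σ.loc l) := by
  refine ⟨l, hl, ?_⟩
  simp [Exploration.advance]

theorem exists_fork (h : σ.Valid S) (hl : l ∈ σ.tree.leaves) (hfull : σ.loc l ∈ σ.full)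
    (hone : σ.cover (σ.loc l) = 1) (htwo : 2 ≤ (σ.openLabels (σ.loc l)).card)
    (hconf : (σ.openLabels (σ.loc l)).card + 1 ≤ σ.conf l) :
    ∃ τ : Exploration k, τ.Valid S ∧ σ.SameTeam τ ∧
      Interior τ.tree.leaves τ.loc (σ.loc l) := by
  obtain ⟨C, e, hdisj, hcard, hinj, himage⟩ :=
    exists_disjoint_injOn_image_eq σ.tree.verts (σ.openLabels (σ.loc l))
  have hchild : ∀ c ∈ C, e c ∈ σ.openLabels (σ.loc l) := fun c hc =>
    himage ▸ Finset.mem_image_of_mem e hc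
  obtain ⟨c, hc⟩ : C.Nonempty := Finset.card_pos.1 (hcard ▸ two_pos.trans_le htwo)
  refine ⟨σ.forkLeaf S l C e, h.forkLeaf hl hdisj (hcard ▸ htwo) (hcard ▸ hconf) hinj
    hfull hone (fun c hc => (mem_openLabels.1 (hchild c hc)).1)
    (fun c hc => (mem_openLabels.1 (hchild c hc)).2) (fun a ha ha' => ?_),
    ⟨rfl, rfl, rfl, rfl, rfl⟩, c, ?_, ?_⟩
  · exact Finset.mem_image.1 (himage ▸ mem_openLabels.2 ⟨ha, ha'⟩)
  · change c ∈ (σ.tree.fork l C _).leaves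
    rw [h.playable.isWeightedTree.leaves_fork hdisj hl ⟨c, hc⟩]
    exact Finset.mem_union_right _ hc
  · change _ <:+ (if c ∈ C then _ else _) ∧ _ ≠ (if c ∈ C then _ else _)
    rw [if_pos hc]
    exact ⟨List.suffix_cons _ _, (List.cons_ne_self _ _).symm⟩

/-- The leaf `l` is forked, or merely goes on along the only open edge. -/
theorem exists_interior (h : σ.Valid S) (hk : 0 < k) (hf : S.IsBounded f)
    (hl : l ∈ σ.tree.leaves) (hfull : σ.loc l ∈ σ.full) (hone : σ.cover (σ.loc l) = 1)
    (hopen : (σ.openLabels (σ.loc l)).Nonempty)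
    (hconf : (σ.openLabels (σ.loc l)).card + 1 ≤ σ.conf l) :
    ∃ τ : Exploration k, τ.Valid S ∧ τ.Eager ∧ σ.SameTeam τ ∧
      Interior τ.tree.leaves τ.loc (σ.loc l) := by
  obtain ⟨τ, hτ, hστ, hint⟩ : ∃ τ : Exploration k, τ.Valid S ∧ σ.SameTeam τ ∧
      Interior τ.tree.leaves τ.loc (σ.loc l) := by
    rcases (Nat.one_le_iff_ne_zero.2 hopen.card_pos.ne').eq_or_lt with hcard | htwo
    · obtain ⟨a, ha⟩ := Finset.card_eq_one.1 hcard.symm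
      have mem_iff {b : ℕ} : b ∈ σ.openLabels (σ.loc l) ↔ b = a := by rw [ha, Finset.mem_singleton]
      obtain ⟨havis, hacl⟩ := mem_openLabels.1 (mem_iff.2 rfl)
      exact ⟨σ.advance l a, h.advance hl hfull hone havis hacl fun b hb hb' =>
        mem_iff.1 (mem_openLabels.2 ⟨hb, hb'⟩), ⟨rfl, rfl, rfl, rfl, rfl⟩, interior_advance hl a⟩
    · exact h.exists_fork hl hfull hone htwo hconf
  obtain ⟨υ, hυ, he, hτυ⟩ := hτ.exists_eager hk hf
  exact ⟨υ, hυ, he, hστ.trans hτυ.toSameTeam, hτυ.leaves ▸ hτυ.loc ▸ hint⟩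

end Valid

/-- The node `w` is known to be full: it is recorded as such, or the robot `i` is at `w` and sees no
new child, where `K` is the set of the nodes that are known to exist. -/
def SeenFull (K : Finset (List ℕ)) (i : Fin k) (σ : Exploration k) (w : List ℕ) : Prop :=
  w ∈ σ.full ∨ (w = σ.pos i ∧ ∀ a, a :: w ∈ K → a :: w ∈ σ.visited)

/-- `τ` is obtained from `σ` while the robots stand still: besides the state of the game, only the
records of full and of closed nodes change. -/
structure IsUpdate (K : Finset (List ℕ)) (i : Fin k) (σ τ : Exploration k) : Prop where
  visited : τ.visited = σ.visited
  pos : τ.pos = σ.pos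
  moves : τ.moves = σ.moves
  seenFull : ∀ w ∈ τ.full, σ.SeenFull K i w

/-- The robot `i` moves once: up, or down to a node of `K` or to a visited node. `K` is the set of
the nodes that are known to exist. -/
structure IsStep (S : CTMStrategy k) (K : Finset (List ℕ)) (i : Fin k) (σ τ : Exploration k) :
    Prop where
  valid : τ.Valid S
  eager : τ.Eager
  moves : τ.moves = σ.moves + 1
  seenFull : ∀ w ∈ τ.full, σ.SeenFull K i w
  pos : τ.pos = Function.update σ.pos i (τ.pos i)
  visited : τ.visited = insert (τ.pos i) σ.visited
  up_or_down : (σ.pos i ≠ [] ∧ τ.pos i = (σ.pos i).tail) ∨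
    ∃ a, τ.pos i = a :: σ.pos i ∧ (a :: σ.pos i ∈ K ∨ a :: σ.pos i ∈ σ.visited)

theorem SameTeam.isUpdate (h : σ.SameTeam τ) : IsUpdate K i σ τ :=
  ⟨h.visited, h.pos, h.moves, fun _ hw => Or.inl (h.full ▸ hw)⟩

theorem IsUpdate.isStep (h : IsUpdate K i σ τ) (h' : IsStep S K i τ υ) : IsStep S K i σ υ where
  valid := h'.valid
  eager := h'.eager
  moves := h.moves ▸ h'.moves
  seenFull w hw := by
    rcases h'.seenFull w hw with hw | ⟨hw, hK⟩
    · exact h.seenFull w hw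
    · exact Or.inr ⟨h.pos ▸ hw, h.visited ▸ hK⟩
  pos := h.pos ▸ h'.pos
  visited := h.visited ▸ h'.visited
  up_or_down := h.pos ▸ h.visited ▸ h'.up_or_down

theorem isStep_move (hv : (σ.move i v).Valid S) (he : σ.Eager)
    (hu : (σ.pos i ≠ [] ∧ v = (σ.pos i).tail) ∨
      ∃ a, v = a :: σ.pos i ∧ (a :: σ.pos i ∈ K ∨ a :: σ.pos i ∈ σ.visited)) :
    IsStep S K i σ (σ.move i v) := by
  have hself : (σ.move i v).pos i = v := Function.update_self _ _ _
  refine ⟨hv, he, rfl, fun w hw => Or.inl hw, ?_, ?_, ?_⟩ <;> rw [hself]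
  · rfl
  · rfl
  · exact hu

namespace Valid

theorem exists_isStep_of_closed (h : σ.Valid S) (hk : 0 < k) (hf : S.IsBounded f)
    (hi : σ.pos i ∈ σ.closed) : ∃ τ, IsStep S K i σ τ := by
  obtain ⟨τ, hτ, he, hστ⟩ := h.exists_eager hk hf
  rw [← hστ.closed, ← hστ.pos] at hi
  have hlt : τ.load (τ.pos i) < τ.robots (τ.pos i) := by
    rw [hτ.load_eq_zero_of_closed hi]
    exact robotsBelow_pos List.suffix_rfl
  have h0 := hτ.ne_nil_of_load_lt hlt
  exact ⟨_, hστ.toSameTeam.isUpdate.isStep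
    (isStep_move (hτ.move_up h0 (hτ.cover_closed _ hi) hlt (Or.inl hi)) he (Or.inl ⟨h0, rfl⟩))⟩

theorem exists_isStep_of_interior (h : σ.Valid S) (he : σ.Eager)
    (hi : Interior σ.tree.leaves σ.loc (σ.pos i)) : ∃ τ, IsStep S K i σ τ := by
  rcases h.move_interior he hi with ⟨a, ha, hmove⟩ | ⟨h0, hmove⟩
  · exact ⟨_, isStep_move hmove he (Or.inr ⟨a, rfl, Or.inr ha⟩)⟩
  · exact ⟨_, isStep_move hmove he (Or.inl ⟨h0, rfl⟩)⟩

/-- The robot `i` goes up if the leaf `l` requests fewer robots than there are, otherwise there are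
enough of them to fork the leaf. -/
theorem exists_isStep_of_leaf (h : σ.Valid S) (he : σ.Eager) (hk : 0 < k) (hf : S.IsBounded f)
    (hl : l ∈ σ.tree.leaves) (hi : σ.pos i = σ.loc l) (hfull : σ.loc l ∈ σ.full)
    (hone : σ.cover (σ.loc l) = 1) (hopen : (σ.openLabels (σ.loc l)).Nonempty) :
    ∃ τ, IsStep S K i σ τ := by
  have hcard := hi ▸ h.card_openLabels_lt i
  by_cases hlt : σ.conf l < σ.robots (σ.loc l)
  · rw [← h.load_loc hl] at hlt
    have hpos := hopen.card_pos
    rw [← hi] at *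
    have h0 := h.ne_nil_of_load_lt hlt
    exact ⟨_, isStep_move (h.move_up h0 hone hlt (Or.inr (by omega))) he (Or.inl ⟨h0, rfl⟩)⟩
  · obtain ⟨τ, hτ, hτe, hστ, hint⟩ := h.exists_interior hk hf hl hfull hone hopen (by omega)
    rw [← hi, ← hστ.pos] at hint
    obtain ⟨υ, hυ⟩ := hτ.exists_isStep_of_interior hτe hint
    exact ⟨υ, hστ.isUpdate.isStep hυ⟩

theorem exists_isStep_of_openLabels (h : σ.Valid S) (he : σ.Eager) (hk : 0 < k)
    (hf : S.IsBounded f) (hfull : σ.pos i ∈ σ.full) (hcl : σ.pos i ∉ σ.closed)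
    (hopen : (σ.openLabels (σ.pos i)).Nonempty) : ∃ τ, IsStep S K i σ τ := by
  have htwo : 2 ≤ σ.robots (σ.pos i) :=
    (Nat.succ_le_succ hopen.card_pos).trans (h.card_openLabels_lt i)
  have hone : σ.cover (σ.pos i) = 1 := by
    by_contra hne
    have := h.robots_eq_one _ (h.pos_mem i) hcl ((h.cover_le_one _).lt_of_ne hne)
    omega
  have hcov : σ.IsCovered (σ.pos i) := by
    by_contra hcov
    exact zero_ne_one ((h.cover_of_not_covered _ hcl hcov).symm.trans hone)
  by_cases hloc : ∃ l ∈ σ.tree.leaves, σ.loc l = σ.pos i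
  · obtain ⟨l, hl, hli⟩ := hloc
    rw [← hli] at hfull hone hopen
    exact h.exists_isStep_of_leaf he hk hf hl hli.symm hfull hone hopen
  · push Not at hloc
    exact h.exists_isStep_of_interior he (hcov.interior hloc)

theorem suffix_loc_of_not_closed (h : σ.Valid S) (hl : l ∈ σ.tree.leaves)
    (huniq : ∀ m ∈ σ.tree.leaves, m = l)
    (hch : ∀ a, a :: σ.loc l ∈ σ.visited → a :: σ.loc l ∈ σ.closed) (hw : w ∈ σ.visited)
    (hwcl : w ∉ σ.closed) : w <:+ σ.loc l := by
  induction w with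
  | nil => exact List.nil_suffix
  | cons a w ih =>
    have hsuff := ih (h.parent_mem a w hw) fun hc => hwcl (h.closed_cons a w hc hw)
    have hne : w ≠ σ.loc l := by
      rintro rfl
      exact hwcl (hch a hw)
    obtain ⟨m, hm, hma⟩ :=
      (h.interior_cons w ⟨l, hl, hsuff, hne⟩ a hw).resolve_left hwcl
    exact huniq m hm ▸ hma

theorem visited_subset_full (h : σ.Valid S) (hl : l ∈ σ.tree.leaves)
    (huniq : ∀ m ∈ σ.tree.leaves, m = l) (hfull : σ.loc l ∈ σ.full)
    (hch : ∀ a, a :: σ.loc l ∈ σ.visited → a :: σ.loc l ∈ σ.closed) : σ.visited ⊆ σ.full := by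
  intro w hw
  by_cases hwcl : w ∈ σ.closed
  · exact h.closed_subset hwcl
  by_cases hwl : w = σ.loc l
  · exact hwl ▸ hfull
  · exact h.full_of_interior w ⟨l, hl, h.suffix_loc_of_not_closed hl huniq hch hw hwcl, hwl⟩

theorem exists_isStep_or_subset_full (h : σ.Valid S) (he : σ.Eager) (hk : 0 < k)
    (hf : S.IsBounded f) (hfull : σ.pos i ∈ σ.full) :
    (∃ τ, IsStep S K i σ τ) ∨ σ.visited ⊆ σ.full := by
  by_cases hcl : σ.pos i ∈ σ.closed
  · exact Or.inl (h.exists_isStep_of_closed hk hf hcl)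
  by_cases hopen : (σ.openLabels (σ.pos i)).Nonempty
  · exact Or.inl (h.exists_isStep_of_openLabels he hk hf hfull hcl hopen)
  have hch : ∀ a, a :: σ.pos i ∈ σ.visited → a :: σ.pos i ∈ σ.closed := by
    intro a ha
    by_contra hac
    exact hopen ⟨a, mem_openLabels.2 ⟨ha, hac⟩⟩
  have of_closed {τ : Exploration k} (hτ : τ.Valid S) (hστ : IsUpdate K i σ τ)
      (hi : σ.pos i ∈ τ.closed) : ∃ υ, IsStep S K i σ υ := by
    obtain ⟨υ, hυ⟩ := hτ.exists_isStep_of_closed hk hf (by rwa [hστ.pos])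
    exact ⟨υ, hστ.isStep hυ⟩
  by_cases hcov : σ.IsCovered (σ.pos i)
  · obtain ⟨l, hl, hli⟩ : ∃ l ∈ σ.tree.leaves, σ.loc l = σ.pos i := by
      by_contra! hloc
      exact hopen (h.openLabels_nonempty_of_interior (hcov.interior hloc))
    rw [← hli] at hfull hch of_closed
    by_cases htwo : 2 ≤ σ.tree.leaves.card
    · exact Or.inl (of_closed (h.killLeaf hl htwo hfull hch)
        ⟨rfl, rfl, rfl, fun _ => Or.inl⟩ (h.loc_mem_closed_killLeaf hl htwo hfull hch))
    · have huniq : ∀ m ∈ σ.tree.leaves, m = l := fun m hm =>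
        Finset.card_le_one.1 (by omega) m hm l hl
      exact Or.inr (h.visited_subset_full hl huniq hfull hch)
  · exact Or.inl (of_closed (h.close hk hfull hcl hcov hch) ⟨rfl, rfl, rfl, fun _ => Or.inl⟩
      (Finset.mem_insert_self _ _))

theorem exists_isStep_or_seenFull (h : σ.Valid S) (he : σ.Eager) (hk : 0 < k) (hf : S.IsBounded f)
    (hK : σ.pos i ∈ σ.full → ∀ a, a :: σ.pos i ∈ K → a :: σ.pos i ∈ σ.visited) :
    (∃ τ, IsStep S K i σ τ) ∨ ∀ w ∈ σ.visited, σ.SeenFull K i w := by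
  by_cases hnew : ∃ a, a :: σ.pos i ∈ K ∧ a :: σ.pos i ∉ σ.visited
  · obtain ⟨a, haK, ha⟩ := hnew
    exact Or.inl ⟨_, isStep_move (h.move_new ha fun hfull => ha (hK hfull a haK)) he
      (Or.inr ⟨a, rfl, Or.inl haK⟩)⟩
  push Not at hnew
  have hupdate : IsUpdate K i σ (σ.markFull (σ.pos i)) := by
    refine ⟨rfl, rfl, rfl, fun w hw => ?_⟩
    rcases Finset.mem_insert.1 hw with rfl | hw
    · exact Or.inr ⟨rfl, hnew⟩
    · exact Or.inl hw
  exact ((h.markFull (h.pos_mem i)).exists_isStep_or_subset_full he hk hf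
    (Finset.mem_insert_self _ _)).imp (fun ⟨τ, hτ⟩ => ⟨τ, hupdate.isStep hτ⟩)
      fun hsub w hw => hupdate.seenFull w (hsub hw)

end Valid

/-- All robots are at the root, which is the only visited node. -/
def init (k : ℕ) : Exploration k where
  visited := {[]}
  full := ∅
  closed := ∅
  pos := fun _ => []
  moves := 0
  tree := GameTree.start
  conf := fun v => if v = 1 then k else 0
  cost := 0
  loc := fun _ => []
  cover := fun v => if v = [] then 1 else 0

theorem isCovered_init : (init k).IsCovered v ↔ v = [] := by
  change Covered GameTree.start.leaves _ v ↔ _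
  simp [Covered, GameTree.leaves_start, init]

theorem not_interior_init : ¬ Interior (init k).tree.leaves (init k).loc v :=
  fun ⟨_, _, hv, hne⟩ => hne (List.suffix_nil.1 hv)

theorem mem_visited_init : v ∈ (init k).visited ↔ v = [] := Finset.mem_singleton

theorem isSearchState_init (k : ℕ) :
    IsSearchState (init k).visited (init k).full (init k).closed where
  root_mem := mem_visited_init.2 rfl
  parent_mem a v hv := absurd (mem_visited_init.1 hv) (List.cons_ne_nil a v)
  full_subset := Finset.empty_subset _
  closed_subset := subset_rfl
  closed_cons _ v hv := absurd hv (Finset.notMem_empty v)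

theorem isPlacement_init (k : ℕ) :
    IsPlacement (init k).visited (init k).full (init k).closed (init k).tree.leaves
      (init k).loc where
  loc_mem _ _ := mem_visited_init.2 rfl
  loc_not_closed _ _ := Finset.notMem_empty _
  loc_antichain l hl m hm _ := by
    rw [show (init k).tree.leaves = {1} from GameTree.leaves_start, Finset.mem_singleton] at hl hm
    rw [hl, hm]
  full_of_interior _ hv := absurd hv not_interior_init
  interior_cons _ hv := absurd hv not_interior_init

theorem isCover_init (k : ℕ) :
    IsCover (init k).closed (init k).tree.leaves (init k).loc (init k).cover where
  cover_nil := by simp [init]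
  cover_nonneg v := by
    simp only [init]
    split_ifs <;> norm_num
  cover_le_one v := by
    simp only [init]
    split_ifs <;> norm_num
  cover_closed v hv := absurd hv (Finset.notMem_empty v)
  cover_of_not_covered _ _ hv := if_neg fun h0 => hv (isCovered_init.2 h0)
  cover_of_interior _ hv := absurd hv not_interior_init

theorem valid_init (S : CTMStrategy k) (hk : 0 < k) : (init k).Valid S := by
  have herase : (init k).visited.erase [] = ∅ := by simp [init]
  refine { isSearchState_init k, isPlacement_init k, isCover_init k with
    reach := CTMStrategy.Reach.start
    playable := GameTree.isPlayable_start
    config := ⟨fun v hv => if_neg fun h1 => hv ?_, ?_⟩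
    pos_mem := fun _ => mem_visited_init.2 rfl
    robots_pos := fun v hv _ => ?_
    robots_eq_one := fun v hv _ hlt => ?_
    transport_eq := fun x x' _ _ => ?_
    depth_eq := fun l _ => ?_
    moves_le := ?_ }
  · rw [h1]
    exact Finset.mem_singleton_self 1 |> (GameTree.leaves_start ▸ ·)
  · rw [show (init k).tree.leaves = {1} from GameTree.leaves_start]
    simp [init]
  · rw [mem_visited_init.1 hv, robots, robotsBelow_nil]
    exact hk
  · exact absurd (mem_visited_init.1 hv ▸ (isCover_init k).cover_nil) hlt.ne
  · rw [loadDist, herase, Finset.sum_empty]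
    exact GameTree.transport_start x x'
  · rw [show (init k).tree.depth l = 0 from Finset.sum_eq_zero fun _ _ => rfl]
    simp [init]
  · rw [potential, herase]
    simp [init]

theorem eager_init (k : ℕ) : (init k).Eager := fun _ _ _ => (isCover_init k).cover_nil

theorem Valid.moves_le_of_depth_le (h : σ.Valid S) (hf : S.IsBounded f) {D : ℝ}
    (hD : ∃ l ∈ σ.tree.leaves, σ.tree.depth l ≤ D) :
    (σ.moves : ℝ) ≤ f D + 2 * ((σ.visited.erase []).card : ℝ) := by
  have hpot := potential_le (V := σ.visited) h.cover_nonneg h.cover_le_one σ.robots σ.load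
  linarith [h.moves_le, hf _ _ _ h.reach D hD]

end Exploration

namespace Exploration

variable {k : ℕ} {S : CTMStrategy k} {f : ℝ → ℝ} {K K' F V : Finset (List ℕ)} {i : Fin k}
  {σ τ υ : Exploration k}

/-- The team has explored a part of a tree whose set of nodes is `K`, except that the nodes of `F`
may have further children: none of them is recorded as full. -/
structure Knows (S : CTMStrategy k) (K F : Finset (List ℕ)) (σ : Exploration k) : Prop where
  valid : σ.Valid S
  eager : σ.Eager
  subset : σ.visited ⊆ K
  notMem_of_full : ∀ w ∈ σ.full, w ∉ F
  cons_mem_of_full : ∀ w ∈ σ.full, ∀ a, a :: w ∈ K → a :: w ∈ σ.visited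

theorem subset_of_cons_mem (hK : ∀ a v, a :: v ∈ K → v ∈ K) (hroot : [] ∈ V)
    (hcons : ∀ w ∈ V, ∀ a, a :: w ∈ K → a :: w ∈ V) : K ⊆ V := by
  intro w
  induction w with
  | nil => exact fun _ => hroot
  | cons a w ih => exact fun hw => hcons w (ih (hK a w hw)) a hw

theorem knows_init (S : CTMStrategy k) (hk : 0 < k) (hroot : [] ∈ K) (F : Finset (List ℕ)) :
    (init k).Knows S K F where
  valid := valid_init S hk
  eager := eager_init k
  subset := Finset.singleton_subset_iff.2 hroot
  notMem_of_full w hw := absurd hw (Finset.notMem_empty w)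
  cons_mem_of_full w hw := absurd hw (Finset.notMem_empty w)

theorem IsStep.pos_mem (h : IsStep S K' i σ τ) (hσ : σ.Knows S K F)
    (hK : ∀ a v, a :: v ∈ K → v ∈ K) (hK' : K' ⊆ K) : τ.pos i ∈ K := by
  rcases h.up_or_down with ⟨-, hup⟩ | ⟨a, hdown, hmem | hmem⟩
  · rw [hup]
    exact mem_of_suffix hK (List.tail_suffix _) (hσ.subset (hσ.valid.pos_mem i))
  · exact hdown ▸ hK' hmem
  · exact hdown ▸ hσ.subset hmem

theorem IsStep.knows (h : IsStep S K' i σ τ) (hσ : σ.Knows S K F)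
    (hK : ∀ a v, a :: v ∈ K → v ∈ K) (hK' : K' ⊆ K)
    (hi : ∀ a, a :: σ.pos i ∈ K → a :: σ.pos i ∈ K') (hF : σ.pos i ∉ F) : τ.Knows S K F where
  valid := h.valid
  eager := h.eager
  subset := by
    rw [h.visited]
    exact Finset.insert_subset (h.pos_mem hσ hK hK') hσ.subset
  notMem_of_full w hw := by
    rcases h.seenFull w hw with hw | ⟨rfl, -⟩
    · exact hσ.notMem_of_full w hw
    · exact hF
  cons_mem_of_full w hw a ha := by
    rw [h.visited]
    refine Finset.mem_insert_of_mem ?_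
    rcases h.seenFull w hw with hw | ⟨rfl, hw⟩
    · exact hσ.cons_mem_of_full w hw a ha
    · exact hw a (hi a ha)

theorem Knows.exists_isStep_or_visited_eq (h : σ.Knows S K F) (hk : 0 < k) (hf : S.IsBounded f)
    (hK : ∀ a v, a :: v ∈ K → v ∈ K) (hK' : K' ⊆ K)
    (hi : ∀ a, a :: σ.pos i ∈ K → a :: σ.pos i ∈ K') :
    (∃ τ, IsStep S K' i σ τ) ∨ (σ.visited = K ∧ ∀ w ∈ σ.visited, w ∈ F → w = σ.pos i) := by
  refine (h.valid.exists_isStep_or_seenFull h.eager hk hf fun hfull a ha =>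
    h.cons_mem_of_full _ hfull a (hK' ha)).imp_right fun hseen =>
      ⟨h.subset.antisymm (subset_of_cons_mem hK h.valid.root_mem fun w hw a ha => ?_),
        fun w hw hwF => ?_⟩
  · rcases hseen w hw with hw | ⟨rfl, hw⟩
    · exact h.cons_mem_of_full w hw a ha
    · exact hw a (hi a ha)
  · rcases hseen w hw with hw | ⟨rfl, -⟩
    · exact absurd hwF (h.notMem_of_full w hw)
    · rfl

theorem Knows.moves_le (h : σ.Knows S K F) (hk : 0 < k) (hf : S.IsBounded f) :
    (σ.moves : ℝ) ≤ f (K.sup List.length : ℕ) + 2 * K.card := by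
  obtain ⟨l, hl⟩ := h.valid.leaves_nonempty hk
  have hlen : ((σ.loc l).length : ℝ) ≤ (K.sup List.length : ℕ) := by
    exact_mod_cast Finset.le_sup (f := List.length) (h.subset (h.valid.loc_mem l hl))
  have hdepth : σ.tree.depth l ≤ (K.sup List.length : ℕ) := by
    linarith [h.valid.depth_eq l hl, h.valid.cover_le_one (σ.loc l)]
  have hcard : ((σ.visited.erase []).card : ℝ) ≤ K.card := by
    exact_mod_cast Finset.card_le_card ((Finset.erase_subset _ _).trans h.subset)
  linarith [h.valid.moves_le_of_depth_le hf ⟨l, hl, hdepth⟩]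

end Exploration

namespace Exploration

variable {k : ℕ} {S : CTMStrategy k} {f : ℝ → ℝ} {K : Finset (List ℕ)} {T : RTree} {i : Fin k}
  {s t : Finset (Fin k)} {u u' : List ℕ} {σ τ υ : Exploration k}

/-- A robot can go from `u` to `u'` in one round. -/
def Legal (T : RTree) (u u' : List ℕ) : Prop :=
  u' = u ∨ u' = u.tail ∨ ∃ a, u' = a :: u ∧ a :: u ∈ T.nodes

/-- The step that leads from `u` to `u'`. -/
def stepTo (u u' : List ℕ) : Step :=
  if u' = u then .stay else if u' = u.tail then .up else .down (u'.headD 0)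

theorem Legal.apply_stepTo (h : Legal T u u') : (stepTo u u').apply T u = u' := by
  unfold stepTo
  split_ifs with hstay hup
  · exact hstay.symm
  · exact hup.symm
  · obtain ⟨a, rfl, ha⟩ := (h.resolve_left hstay).resolve_left hup
    exact if_pos ha

/-- The robots of `s` have made one move each on the way from `σ` to `τ`, unless the tree `T` is
completely explored. -/
structure IsRound (S : CTMStrategy k) (T : RTree) (s : Finset (Fin k)) (σ τ : Exploration k) :
    Prop where
  knows : τ.Knows S T.nodes ∅
  pos_eq : ∀ i ∉ s, τ.pos i = σ.pos i
  legal : ∀ i ∈ s, Legal T (σ.pos i) (τ.pos i)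
  visited : τ.visited = σ.visited ∪ s.image τ.pos
  moves : τ.moves = σ.moves + s.card ∨ τ.visited = T.nodes

theorem IsRound.trans (h : IsRound S T s σ τ) (h' : IsRound S T t τ υ) (hst : Disjoint s t) :
    IsRound S T (s ∪ t) σ υ where
  knows := h'.knows
  pos_eq i hi := by
    rw [Finset.mem_union, not_or] at hi
    rw [h'.pos_eq i hi.2, h.pos_eq i hi.1]
  legal i hi := by
    rcases Finset.mem_union.1 hi with hi | hi
    · exact h'.pos_eq i (Finset.disjoint_left.1 hst hi) ▸ h.legal i hi
    · exact h.pos_eq i (Finset.disjoint_right.1 hst hi) ▸ h'.legal i hi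
  visited := by
    have himage : s.image τ.pos = s.image υ.pos :=
      Finset.image_congr fun i hi => (h'.pos_eq i (Finset.disjoint_left.1 hst hi)).symm
    rw [h'.visited, h.visited, himage, Finset.image_union, Finset.union_assoc]
  moves := by
    rcases h'.moves with h'moves | hall
    · refine h.moves.imp (fun hmoves => ?_) fun hall => ?_
      · rw [h'moves, hmoves, Finset.card_union_of_disjoint hst, add_assoc]
      · exact h'.knows.subset.antisymm (hall ▸ h'.visited ▸ Finset.subset_union_left)
    · exact Or.inr hall

/-- The robot `i` moves if it can. -/
def next (S : CTMStrategy k) (K : Finset (List ℕ)) (σ : Exploration k) (i : Fin k) :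
    Exploration k :=
  if h : ∃ τ, IsStep S K i σ τ then h.choose else σ

theorem IsStep.isRound (h : IsStep S K i σ τ) (hσ : σ.Knows S T.nodes ∅) (hK : K ⊆ T.nodes)
    (hi : ∀ a, a :: σ.pos i ∈ T.nodes → a :: σ.pos i ∈ K) : IsRound S T {i} σ τ where
  knows := h.knows hσ T.parent_mem hK hi (Finset.notMem_empty _)
  pos_eq j hj := by rw [h.pos, Function.update_of_ne (Finset.notMem_singleton.1 hj)]
  legal j hj := by
    rw [Finset.mem_singleton.1 hj]
    rcases h.up_or_down with ⟨-, hup⟩ | ⟨a, hdown, -⟩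
    · exact Or.inr (Or.inl hup)
    · exact Or.inr (Or.inr ⟨a, hdown, hdown ▸ h.pos_mem hσ T.parent_mem hK⟩)
  visited := by rw [h.visited, Finset.image_singleton, Finset.union_singleton]
  moves := Or.inl h.moves

theorem Knows.isRound_next (h : σ.Knows S T.nodes ∅) (hk : 0 < k) (hf : S.IsBounded f)
    (hK : K ⊆ T.nodes) (hi : ∀ a, a :: σ.pos i ∈ T.nodes → a :: σ.pos i ∈ K) :
    IsRound S T {i} σ (σ.next S K i) := by
  unfold Exploration.next
  split_ifs with hstep
  · exact hstep.choose_spec.isRound h hK hi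
  · obtain ⟨hall, -⟩ :=
      (h.exists_isStep_or_visited_eq hk hf T.parent_mem hK hi).resolve_left hstep
    exact
      { knows := h
        pos_eq := fun _ _ => rfl
        legal := fun _ _ => Or.inl rfl
        visited := by
          rw [Finset.image_singleton, Finset.union_singleton,
            Finset.insert_eq_of_mem (h.valid.pos_mem i)]
        moves := Or.inr hall }

theorem Knows.isRound_foldl (hk : 0 < k) (hf : S.IsBounded f) (hK : K ⊆ T.nodes)
    {l : List (Fin k)} (hl : l.Nodup) (h : σ.Knows S T.nodes ∅)
    (hi : ∀ i ∈ l, ∀ a, a :: σ.pos i ∈ T.nodes → a :: σ.pos i ∈ K) :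
    IsRound S T l.toFinset σ (l.foldl (next S K) σ) := by
  induction l generalizing σ with
  | nil => exact ⟨h, fun _ _ => rfl, by simp, by simp, Or.inl rfl⟩
  | cons i l ih =>
    obtain ⟨hil, hl⟩ := List.nodup_cons.1 hl
    have hround := h.isRound_next hk hf hK (hi i List.mem_cons_self)
    have hdisj : Disjoint {i} l.toFinset :=
      Finset.disjoint_singleton_left.2 fun hmem => hil (List.mem_toFinset.1 hmem)
    rw [List.toFinset_cons, List.foldl_cons, Finset.insert_eq]
    refine hround.trans (ih hl hround.knows fun j hj => ?_) hdisj
    rw [hround.pos_eq j (Finset.disjoint_right.1 hdisj (List.mem_toFinset.2 hj))]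
    exact hi j (List.mem_cons_of_mem i hj)

/-- The robots move one after the other. -/
def round (S : CTMStrategy k) (K : Finset (List ℕ)) (σ : Exploration k) : Exploration k :=
  (List.finRange k).foldl (next S K) σ

theorem Knows.isRound_round (h : σ.Knows S T.nodes ∅) (hk : 0 < k) (hf : S.IsBounded f)
    (hK : K ⊆ T.nodes) (hi : ∀ i a, a :: σ.pos i ∈ T.nodes → a :: σ.pos i ∈ K) :
    IsRound S T Finset.univ σ (σ.round S K) := by
  rw [← List.toFinset_finRange]
  exact h.isRound_foldl hk hf hK (List.nodup_finRange k) fun i _ => hi i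

/-- The state of the exploration, computed from the past views. -/
def ofViews (S : CTMStrategy k) : List (CTEView k) → Exploration k
  | [] => init k
  | v :: past => round S v.discovered (ofViews S past)

end Exploration

open Exploration

/-- The exploration algorithm derived from a strategy of the tree-mining game. All robots return to
the root once all the edges have been traversed. -/
def cteAlgorithm {k : ℕ} (S : CTMStrategy k) : CTEAlgorithm k := fun v past i =>
  if v.visited = v.discovered then .up
  else stepTo ((ofViews S past).pos i) ((ofViews S (v :: past)).pos i)

theorem RTree.tail_mem {T : RTree} {u : List ℕ} (hu : u ∈ T.nodes) : u.tail ∈ T.nodes :=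
  mem_of_suffix T.parent_mem (List.tail_suffix _) hu

namespace CTEAlgorithm

variable {k : ℕ} {A : CTEAlgorithm k} {S : CTMStrategy k} {f : ℝ → ℝ} {T : RTree} {t : ℕ}

theorem discovered_run (A : CTEAlgorithm k) (T : RTree) (t : ℕ) :
    (A.run T t).1.discovered = T.nodes.filter fun u => u.tail ∈ (A.run T t).1.visited := by
  cases t <;> rfl

theorem pos_run_mem_visited (A : CTEAlgorithm k) (T : RTree) (t : ℕ) (i : Fin k) :
    (A.run T t).1.pos i ∈ (A.run T t).1.visited := by
  cases t with
  | zero => exact Finset.mem_singleton_self _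
  | succ t => exact Finset.mem_union_right _ (Finset.mem_image_of_mem _ (Finset.mem_univ i))

theorem discovered_run_eq_nodes (h : (A.run T t).1.visited = T.nodes) :
    (A.run T t).1.discovered = T.nodes := by
  rw [discovered_run, h]
  exact Finset.filter_true_of_mem fun _ hu => T.tail_mem hu

theorem Finished.exists_runtime_eq (h : A.Finished T t) : ∃ s ≤ t, A.runtime T = s := by
  have hex : ∃ t, A.Finished T t := ⟨t, h⟩
  refine ⟨Nat.find hex, Nat.find_min' hex h,
    le_antisymm (sInf_le ⟨_, Nat.find_spec hex, rfl⟩) (le_sInf ?_)⟩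
  rintro _ ⟨s, hs, rfl⟩
  exact_mod_cast Nat.find_min' hex hs

theorem visited_and_length_pos_le_of_visited_eq
    (h : ((cteAlgorithm S).run T t).1.visited = T.nodes) (j : ℕ) :
    ((cteAlgorithm S).run T (t + j)).1.visited = T.nodes ∧
      ∀ i, (((cteAlgorithm S).run T (t + j)).1.pos i).length ≤ T.depth - j := by
  induction j with
  | zero =>
    exact ⟨h, fun i => Finset.le_sup (f := List.length) (h ▸ pos_run_mem_visited _ T t i)⟩
  | succ j ih =>
    obtain ⟨hvis, hlen⟩ := ih
    have hpos : ((cteAlgorithm S).run T (t + j + 1)).1.pos =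
        fun i => (((cteAlgorithm S).run T (t + j)).1.pos i).tail := by
      funext i
      simp only [run, cteAlgorithm, if_pos (hvis.trans (discovered_run_eq_nodes hvis).symm)]
      rfl
    refine ⟨?_, fun i => ?_⟩
    · change ((cteAlgorithm S).run T (t + j)).1.visited ∪
        Finset.univ.image ((cteAlgorithm S).run T (t + j + 1)).1.pos = _
      rw [hvis, hpos, Finset.union_eq_left, Finset.image_subset_iff]
      exact fun i _ => T.tail_mem (hvis ▸ pos_run_mem_visited _ T (t + j) i)
    · rw [← add_assoc, hpos, List.length_tail]
      have := hlen i
      omega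

theorem finished_add_depth (h : ((cteAlgorithm S).run T t).1.visited = T.nodes) :
    (cteAlgorithm S).Finished T (t + T.depth) := by
  obtain ⟨hvis, hlen⟩ := visited_and_length_pos_le_of_visited_eq h T.depth
  refine ⟨hvis, fun i => List.eq_nil_of_length_eq_zero (Nat.le_zero.1 ?_)⟩
  exact Nat.sub_self T.depth ▸ hlen i

/-- The state of the exploration after `t` rounds in the tree `T`. -/
def stateAt (S : CTMStrategy k) (T : RTree) (t : ℕ) : Exploration k :=
  ofViews S ((cteAlgorithm S).run T t).2

/-- After `t` rounds, all of which were devoted to the exploration of `T`, the robots are where the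
state of the exploration says they are. -/
structure Follows (S : CTMStrategy k) (T : RTree) (t : ℕ) : Prop where
  knows : (stateAt S T t).Knows S T.nodes ∅
  visited_eq : ((cteAlgorithm S).run T t).1.visited = (stateAt S T t).visited
  pos_eq : ((cteAlgorithm S).run T t).1.pos = (stateAt S T t).pos

theorem follows_zero (S : CTMStrategy k) (hk : 0 < k) (T : RTree) : Follows S T 0 :=
  ⟨knows_init S hk T.root_mem ∅, rfl, rfl⟩

theorem Follows.isRound_stateAt_succ (h : Follows S T t) (hk : 0 < k) (hf : S.IsBounded f) :
    IsRound S T Finset.univ (stateAt S T t) (stateAt S T (t + 1)) := by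
  refine h.knows.isRound_round hk hf (discovered_run (cteAlgorithm S) T t ▸
    Finset.filter_subset _ _) fun i a ha => ?_
  rw [discovered_run, Finset.mem_filter, h.visited_eq]
  exact ⟨ha, h.knows.valid.pos_mem i⟩

theorem Follows.visited_ne_discovered (h : Follows S T t)
    (hne : (stateAt S T t).visited ≠ T.nodes) :
    ((cteAlgorithm S).run T t).1.visited ≠ ((cteAlgorithm S).run T t).1.discovered := by
  intro heq
  rw [discovered_run, h.visited_eq] at heq
  refine hne (h.knows.subset.antisymm
    (subset_of_cons_mem T.parent_mem h.knows.valid.root_mem fun w hw a ha => ?_))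
  rw [heq, Finset.mem_filter]
  exact ⟨ha, hw⟩

theorem Follows.succ (h : Follows S T t) (hk : 0 < k) (hf : S.IsBounded f)
    (hne : (stateAt S T t).visited ≠ T.nodes) : Follows S T (t + 1) := by
  have hround := h.isRound_stateAt_succ hk hf
  have hpos : ((cteAlgorithm S).run T (t + 1)).1.pos = (stateAt S T (t + 1)).pos := by
    funext i
    change (cteAlgorithm S _ _ i).apply T (((cteAlgorithm S).run T t).1.pos i) = _
    rw [cteAlgorithm, if_neg (h.visited_ne_discovered hne), h.pos_eq]
    exact (hround.legal i (Finset.mem_univ i)).apply_stepTo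
  refine ⟨hround.knows, ?_, hpos⟩
  change ((cteAlgorithm S).run T t).1.visited ∪
    Finset.univ.image ((cteAlgorithm S).run T (t + 1)).1.pos = _
  rw [hpos, h.visited_eq, hround.visited]

theorem exists_visited_eq (S : CTMStrategy k) (hk : 0 < k) (hf : S.IsBounded f) (T : RTree) :
    ∃ s t : ℕ, s ≤ t + 1 ∧ ((cteAlgorithm S).run T s).1.visited = T.nodes ∧
      (k : ℝ) * t ≤ f T.depth + 2 * T.nodes.card := by
  by_contra! hne
  have hle {t : ℕ} (h : Follows S T t) (hmoves : (stateAt S T t).moves = k * t) :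
      (k : ℝ) * t ≤ f T.depth + 2 * T.nodes.card := by
    have := h.knows.moves_le hk hf
    rw [hmoves] at this
    exact_mod_cast this
  have hall (t : ℕ) : Follows S T t ∧ (stateAt S T t).moves = k * t := by
    induction t with
    | zero => exact ⟨follows_zero S hk T, rfl⟩
    | succ t ih =>
      obtain ⟨h, hmoves⟩ := ih
      have hsucc := h.succ hk hf fun heq =>
        (hne t t t.le_succ (h.visited_eq.trans heq)).not_ge (hle h hmoves)
      refine ⟨hsucc, ?_⟩
      rcases (h.isRound_stateAt_succ hk hf).moves with hmove | heq
      · rw [hmove, hmoves, Finset.card_univ, Fintype.card_fin, mul_add_one]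
      · exact absurd (hle h hmoves)
          (hne (t + 1) t le_rfl (hsucc.visited_eq.trans heq)).not_ge
  obtain ⟨t, ht⟩ := exists_nat_gt (f T.depth + 2 * T.nodes.card)
  have hone : (1 : ℝ) ≤ k := by exact_mod_cast hk
  have htk := hle (hall t).1 (hall t).2
  nlinarith [(Nat.cast_nonneg t : (0 : ℝ) ≤ t)]

theorem runtime_cteAlgorithm_le (hk : 0 < k) (hf : S.IsBounded f) (T : RTree) :
    ∃ t : ℕ, (cteAlgorithm S).runtime T = t ∧
      (t : ℝ) ≤ (2 * (T.nodes.card : ℝ) + f T.depth) / k + T.depth + 1 := by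
  obtain ⟨s, t, hst, hvis, ht⟩ := exists_visited_eq S hk hf T
  obtain ⟨r, hr, hrun⟩ := (finished_add_depth hvis).exists_runtime_eq
  have hdiv : (t : ℝ) ≤ (2 * (T.nodes.card : ℝ) + f T.depth) / k := by
    rw [le_div_iff₀ (Nat.cast_pos.2 hk)]
    linarith
  have hrt : (r : ℝ) ≤ t + 1 + T.depth := by
    exact_mod_cast hr.trans (Nat.add_le_add_right hst _)
  exact ⟨r, hrun, by linarith⟩

end CTEAlgorithm

/-- Contraction of the edges of length zero: the list of (the codes of) the lower ends of the edges
of positive length above a node. It is the node of the contracted tree to which that node goes. -/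
def contract (len : List ℕ → ℕ) : List ℕ → List ℕ
  | [] => []
  | a :: u =>
    if len (a :: u) = 0 then contract len u else Encodable.encode (a :: u) :: contract len u

section Contract

variable {len : List ℕ → ℕ} {a c : ℕ} {s u v w : List ℕ}

theorem contract_suffix_contract (len : List ℕ → ℕ) (h : u <:+ v) :
    contract len u <:+ contract len v := by
  induction v with
  | nil => rw [List.suffix_nil.1 h]
  | cons a v ih =>
    rcases List.suffix_cons_iff.1 h with rfl | h
    · exact List.suffix_rfl
    · rw [contract]
      split_ifs
      · exact ih h
      · exact (ih h).trans (List.suffix_cons _ _)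

theorem contract_of_len_ne_zero (hw : w ≠ []) (hlen : len w ≠ 0) :
    contract len w = Encodable.encode w :: contract len w.tail := by
  obtain ⟨a, u, rfl⟩ := List.exists_cons_of_ne_nil hw
  rw [contract, if_neg hlen, List.tail_cons]

theorem exists_suffix_of_cons_suffix_contract (h : c :: s <:+ contract len v) :
    ∃ w, w <:+ v ∧ w ≠ [] ∧ len w ≠ 0 ∧ Encodable.encode w = c ∧ contract len w.tail = s := by
  induction v with
  | nil => exact absurd (List.suffix_nil.1 h) (List.cons_ne_nil c s)
  | cons a v ih =>
    rw [contract] at h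
    split_ifs at h with hlen
    · exact (ih h).imp fun w => And.imp_left fun hw => hw.trans (List.suffix_cons a v)
    · rcases List.suffix_cons_iff.1 h with h | h
      · obtain ⟨hc, hs⟩ := List.cons_eq_cons.1 h
        exact ⟨a :: v, List.suffix_rfl, List.cons_ne_nil a v, hlen, hc.symm, hs.symm⟩
      · exact (ih h).imp fun w => And.imp_left fun hw => hw.trans (List.suffix_cons a v)

theorem suffix_of_contract_suffix (hw : w ≠ []) (hlen : len w ≠ 0)
    (h : contract len w <:+ contract len v) : w <:+ v := by
  rw [contract_of_len_ne_zero hw hlen] at h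
  obtain ⟨w', hw', -, -, hcode, -⟩ := exists_suffix_of_cons_suffix_contract h
  rwa [← Encodable.encode_injective hcode]

theorem contract_injOn : Set.InjOn (contract len) {w | w ≠ [] ∧ len w ≠ 0} := by
  rintro w ⟨hw, hlen⟩ w' ⟨hw', hlen'⟩ h
  rw [contract_of_len_ne_zero hw hlen, contract_of_len_ne_zero hw' hlen', List.cons_eq_cons] at h
  exact Encodable.encode_injective h.1

end Contract

/-- The number of edges between two nodes. -/
def edgeDist (u v : List ℕ) : ℕ := (symmDiff u.tails.toFinset v.tails.toFinset).card

theorem edgeDist_self (u : List ℕ) : edgeDist u u = 0 := by simp [edgeDist]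

theorem edgeDist_comm (u v : List ℕ) : edgeDist u v = edgeDist v u := by
  rw [edgeDist, edgeDist, symmDiff_comm]

theorem edgeDist_triangle (u v w : List ℕ) : edgeDist u w ≤ edgeDist u v + edgeDist v w :=
  (Finset.card_le_card (symmDiff_triangle _ _ _)).trans (Finset.card_union_le _ _)

theorem mem_symmDiff_tails {u v w : List ℕ} : w ∈ symmDiff u.tails.toFinset v.tails.toFinset ↔
    w <:+ u ∧ ¬ w <:+ v ∨ w <:+ v ∧ ¬ w <:+ u := by
  simp only [Finset.mem_symmDiff, List.mem_toFinset, List.mem_tails]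

theorem edgeDist_cons_le_one (a : ℕ) (u : List ℕ) : edgeDist u (a :: u) ≤ 1 := by
  refine Finset.card_le_one_iff_subset_singleton.2 ⟨a :: u, fun w hw => ?_⟩
  rw [mem_symmDiff_tails, List.suffix_cons_iff] at hw
  rw [Finset.mem_singleton]
  tauto

theorem sum_eq_card_filter_ne_zero {ι : Type*} (s : Finset ι) {g : ι → ℕ} (hg : ∀ i, g i ≤ 1) :
    ∑ i ∈ s, g i = (s.filter fun i => g i ≠ 0).card := by
  rw [Finset.card_filter]
  refine Finset.sum_congr rfl fun i _ => ?_
  have := hg i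
  split_ifs <;> omega

namespace LayeredTree

theorem dist_le_edgeDist (T : LayeredTree) (u v : List ℕ) :
    T.dist u v ≤ edgeDist (contract T.len u) (contract T.len v) := by
  rw [LayeredTree.dist, sum_eq_card_filter_ne_zero _ T.len_le_one]
  have hne : ∀ w ∈ (symmDiff u.tails.toFinset v.tails.toFinset).filter (fun w => T.len w ≠ 0),
      w ≠ [] ∧ T.len w ≠ 0 := by
    intro w hw
    obtain ⟨hw, hlen⟩ := Finset.mem_filter.1 hw
    refine ⟨?_, hlen⟩
    rintro rfl
    simp [mem_symmDiff_tails] at hw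
  refine Finset.card_le_card_of_injOn (contract T.len) (fun w hw => ?_) (contract_injOn.mono hne)
  obtain ⟨hroot, hlen⟩ := hne w hw
  have suffix_iff (x : List ℕ) : contract T.len w <:+ contract T.len x ↔ w <:+ x :=
    ⟨suffix_of_contract_suffix hroot hlen, contract_suffix_contract T.len⟩
  rw [Finset.mem_coe, mem_symmDiff_tails, suffix_iff, suffix_iff]
  exact mem_symmDiff_tails.1 (Finset.mem_filter.1 hw).1

theorem dist_nil_cons (T : LayeredTree) (a : ℕ) (u : List ℕ) :
    T.dist [] (a :: u) = T.len (a :: u) + T.dist [] u := by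
  have hinsert : symmDiff ([] : List ℕ).tails.toFinset (a :: u).tails.toFinset =
      insert (a :: u) (symmDiff ([] : List ℕ).tails.toFinset u.tails.toFinset) := by
    ext w
    have hcons : w = a :: u → w ≠ [] := fun h => h ▸ List.cons_ne_nil a u
    simp only [mem_symmDiff_tails, Finset.mem_insert, List.suffix_cons_iff, List.suffix_nil]
    constructor
    · rintro (⟨rfl, hw⟩ | hw)
      · exact absurd List.nil_suffix (not_or.1 hw).2
      · tauto
    · rintro (hw | ⟨rfl, hw⟩ | hw)
      · exact Or.inr ⟨Or.inl hw, hcons hw⟩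
      · exact absurd List.nil_suffix hw
      · exact Or.inr ⟨Or.inr hw.1, hw.2⟩
  rw [LayeredTree.dist, hinsert, Finset.sum_insert]
  · rfl
  · rw [mem_symmDiff_tails, not_or]
    exact ⟨fun h => List.cons_ne_nil a u (List.suffix_nil.1 h.1),
      fun h => not_cons_suffix_self a u h.1⟩

theorem length_contract (T : LayeredTree) (u : List ℕ) :
    (contract T.len u).length = T.dist [] u := by
  induction u with
  | nil => simp [contract, LayeredTree.dist]
  | cons a u ih =>
    rw [dist_nil_cons, ← ih, contract]
    have := T.len_le_one (a :: u)
    split_ifs with hlen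
    · rw [hlen, zero_add]
    · rw [List.length_cons]
      omega

end LayeredTree

namespace Exploration

variable {k : ℕ} {S : CTMStrategy k} {f : ℝ → ℝ} {K F : Finset (List ℕ)} {i : Fin k}
  {σ τ υ : Exploration k}

/-- From `σ` to `τ`, the robots go to nodes of `F`. -/
structure IsStage (S : CTMStrategy k) (K F : Finset (List ℕ)) (σ τ : Exploration k) : Prop where
  knows : τ.Knows S K F
  pos_mem : ∀ i, τ.pos i ∈ F
  sum_edgeDist_add_moves_le : ∑ i, edgeDist (σ.pos i) (τ.pos i) + σ.moves ≤ τ.moves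

theorem IsStep.sum_edgeDist_le_one (h : IsStep S K i σ τ) :
    ∑ j, edgeDist (σ.pos j) (τ.pos j) ≤ 1 := by
  rw [Fintype.sum_eq_single i fun j hj => by rw [h.pos, Function.update_of_ne hj, edgeDist_self]]
  rcases h.up_or_down with ⟨hne, hup⟩ | ⟨a, hdown, -⟩
  · obtain ⟨a, u, hau⟩ := List.exists_cons_of_ne_nil hne
    rw [hup, hau, List.tail_cons, edgeDist_comm]
    exact edgeDist_cons_le_one a u
  · rw [hdown]
    exact edgeDist_cons_le_one _ _

theorem IsStage.of_isStep (h : IsStep S K i σ τ) (h' : IsStage S K F τ υ) : IsStage S K F σ υ where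
  knows := h'.knows
  pos_mem := h'.pos_mem
  sum_edgeDist_add_moves_le := by
    have htri : ∑ j, edgeDist (σ.pos j) (υ.pos j) ≤
        ∑ j, edgeDist (σ.pos j) (τ.pos j) + ∑ j, edgeDist (τ.pos j) (υ.pos j) := by
      rw [← Finset.sum_add_distrib]
      exact Finset.sum_le_sum fun j _ => edgeDist_triangle _ _ _
    have := h.sum_edgeDist_le_one
    have := h'.sum_edgeDist_add_moves_le
    have := h.moves
    omega

theorem Knows.exists_isStep_knows (h : σ.Knows S K F) (hk : 0 < k) (hf : S.IsBounded f)
    (hK : ∀ a v, a :: v ∈ K → v ∈ K) (hF : F.Nonempty) (hFK : F ⊆ K) (hi : σ.pos i ∉ F) :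
    ∃ τ, IsStep S K i σ τ ∧ τ.Knows S K F := by
  rcases h.exists_isStep_or_visited_eq hk hf hK subset_rfl fun _ ha => ha with ⟨τ, hτ⟩ | ⟨hall, hF'⟩
  · exact ⟨τ, hτ, hτ.knows h hK subset_rfl (fun _ ha => ha) hi⟩
  · obtain ⟨w, hw⟩ := hF
    exact absurd (hF' w (hall ▸ hFK hw) hw ▸ hw) hi

theorem Knows.exists_isStage (h : σ.Knows S K F) (hk : 0 < k) (hf : S.IsBounded f)
    (hK : ∀ a v, a :: v ∈ K → v ∈ K) (hF : F.Nonempty) (hFK : F ⊆ K) :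
    ∃ τ, IsStage S K F σ τ := by
  obtain ⟨B, hB⟩ := exists_nat_ge (f ((K.sup List.length : ℕ) : ℝ) + 2 * K.card)
  have moves_le {τ : Exploration k} (hτ : τ.Knows S K F) : τ.moves ≤ B := by
    exact_mod_cast (hτ.moves_le hk hf).trans hB
  induction hN : B - σ.moves using Nat.strong_induction_on generalizing σ with
  | _ N ih =>
    by_cases hall : ∀ i, σ.pos i ∈ F
    · exact ⟨σ, h, hall, by simp [edgeDist_self]⟩
    obtain ⟨i, hi⟩ := not_forall.1 hall
    obtain ⟨τ, hστ, hτ⟩ := h.exists_isStep_knows hk hf hK hF hFK hi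
    have hmoves := hστ.moves
    have hle := moves_le hτ
    obtain ⟨υ, hυ⟩ := ih (B - τ.moves) (by omega) hτ rfl
    exact ⟨υ, hυ.of_isStep hστ⟩

/-- The robots move until they are all in `F`. -/
def stage (S : CTMStrategy k) (K F : Finset (List ℕ)) (σ : Exploration k) : Exploration k :=
  if h : ∃ τ, IsStage S K F σ τ then h.choose else σ

theorem isStage_stage (h : ∃ τ, IsStage S K F σ τ) : IsStage S K F σ (stage S K F σ) := by
  rw [stage, dif_pos h]
  exact h.choose_spec

end Exploration

namespace Exploration

variable {k : ℕ} {S : CTMStrategy k} {f : ℝ → ℝ} {K K' F F' : Finset (List ℕ)}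
  {p q : Fin k → List ℕ} {v : List ℕ} {σ τ : Exploration k}

theorem Knows.extend (h : σ.Knows S K F) (hKK' : K ⊆ K') (hF : ∀ w ∈ K, w ∉ F → w ∉ F')
    (hcons : ∀ w ∉ F, ∀ a, a :: w ∈ K' → a :: w ∈ K) : σ.Knows S K' F' where
  valid := h.valid
  eager := h.eager
  subset := h.subset.trans hKK'
  notMem_of_full w hw := hF w (h.subset (h.valid.full_subset hw)) (h.notMem_of_full w hw)
  cons_mem_of_full w hw a ha := h.cons_mem_of_full w hw a (hcons w (h.notMem_of_full w hw) a ha)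

theorem Valid.moves_le_of_pos_eq (h : σ.Valid S) (hk : 0 < k) (hf : S.IsBounded f)
    (hpos : ∀ i, σ.pos i = v) :
    (σ.moves : ℝ) ≤ f v.length + 2 * ((σ.visited.erase []).card : ℝ) := by
  obtain ⟨l, hl⟩ := h.leaves_nonempty hk
  obtain ⟨i, hi⟩ : (Finset.univ.filter fun i => σ.loc l <:+ σ.pos i).Nonempty :=
    Finset.card_pos.1 (h.robots_pos _ (h.loc_mem l hl) (h.loc_not_closed l hl))
  have hsuffix : σ.loc l <:+ v := hpos i ▸ (Finset.mem_filter.1 hi).2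
  have hlen : ((σ.loc l).length : ℝ) ≤ v.length := by exact_mod_cast hsuffix.length_le
  refine h.moves_le_of_depth_le hf ⟨l, hl, ?_⟩
  linarith [h.depth_eq l hl, h.cover_le_one (σ.loc l)]

theorem IsStage.sum_dist_add_moves_le (h : IsStage S K F σ τ) (T : LayeredTree)
    (hp : ∀ r, contract T.len (p r) = σ.pos r) (hq : ∀ r, contract T.len (q r) = τ.pos r) :
    ∑ r, T.dist (p r) (q r) + σ.moves ≤ τ.moves := by
  refine le_trans (Nat.add_le_add_right (Finset.sum_le_sum fun r _ => ?_) _)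
    h.sum_edgeDist_add_moves_le
  exact hp r ▸ hq r ▸ T.dist_le_edgeDist _ _

end Exploration

namespace LTTView

/-- The nodes of the contracted tree that occur in the layers `0, …, j`. -/
def known (w : LTTView) (j : ℕ) : Finset (List ℕ) :=
  (w.nodes.filter fun u => u.length ≤ j).image (contract w.len)

/-- The nodes of the contracted tree that occur in the layer `j`. -/
def front (w : LTTView) (j : ℕ) : Finset (List ℕ) :=
  (w.nodes.filter fun u => u.length = j).image (contract w.len)

/-- The index of the last layer of the view. -/
def lastIndex (w : LTTView) : ℕ := w.nodes.sup List.length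

/-- A node of the last layer which goes to `p` in the contracted tree; if there is none, an
arbitrary node of the last layer. -/
def pick (w : LTTView) (p : List ℕ) : List ℕ :=
  if h : ∃ u ∈ w.nodes, u.length = w.lastIndex ∧ contract w.len u = p then h.choose
  else if h : ∃ u ∈ w.nodes, u.length = w.lastIndex then h.choose else []

variable {w : LTTView}

theorem pick_mem (h : ∃ u ∈ w.nodes, u.length = w.lastIndex) (p : List ℕ) :
    w.pick p ∈ w.nodes ∧ (w.pick p).length = w.lastIndex := by
  unfold pick
  split_ifs with hp
  · exact ⟨hp.choose_spec.1, hp.choose_spec.2.1⟩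
  · exact h.choose_spec

theorem contract_pick {p : List ℕ}
    (h : ∃ u ∈ w.nodes, u.length = w.lastIndex ∧ contract w.len u = p) :
    contract w.len (w.pick p) = p := by
  rw [pick, dif_pos h]
  exact h.choose_spec.2.2

end LTTView

/-- The state of the exploration of the contracted tree when the layers `0, …, j` of the view have
been used. -/
def lttState {k : ℕ} (S : CTMStrategy k) (w : LTTView) : ℕ → Exploration k
  | 0 => init k
  | j + 1 => stage S (w.known (j + 1)) (w.front (j + 1)) (lttState S w j)

namespace LayeredTree

section Reveal

variable (T : LayeredTree) {i j : ℕ} {u : List ℕ}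

theorem exists_mem_length_eq (hj : j ≤ T.target.length) : ∃ u ∈ T.nodes, u.length = j := by
  refine ⟨T.target.drop (T.target.length - j),
    mem_of_suffix T.parent_mem (List.drop_suffix _ _) T.target_mem, ?_⟩
  rw [List.length_drop]
  omega

theorem mem_reveal : u ∈ (T.reveal i).nodes ↔ u ∈ T.nodes ∧ u.length ≤ i := Finset.mem_filter

theorem lastIndex_reveal (hi : i ≤ T.target.length) : (T.reveal i).lastIndex = i := by
  refine le_antisymm (Finset.sup_le fun u hu => (T.mem_reveal.1 hu).2) ?_
  obtain ⟨u, hu, rfl⟩ := T.exists_mem_length_eq hi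
  exact Finset.le_sup (f := List.length) (T.mem_reveal.2 ⟨hu, le_rfl⟩)

theorem contract_reveal (hu : u ∈ T.nodes) (hi : u.length ≤ i) :
    contract (T.reveal i).len u = contract T.len u := by
  induction u with
  | nil => rfl
  | cons a u ih =>
    have hlen : (T.reveal i).len (a :: u) = T.len (a :: u) := if_pos ⟨hu, hi⟩
    simp only [contract, hlen, ih (T.parent_mem a u hu) ((Nat.le_succ _).trans hi)]

/-- The whole tree as a view. -/
def fullView : LTTView := ⟨T.nodes, T.len⟩

theorem image_contract_reveal {p : ℕ → Prop} [DecidablePred p] (hp : ∀ n, p n → n ≤ i) :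
    ((T.reveal i).nodes.filter fun u => p u.length).image (contract (T.reveal i).len) =
      (T.nodes.filter fun u => p u.length).image (contract T.len) := by
  have hfilter : (T.reveal i).nodes.filter (fun u => p u.length) =
      T.nodes.filter fun u => p u.length := by
    ext u
    rw [Finset.mem_filter, Finset.mem_filter, mem_reveal]
    exact ⟨fun h => ⟨h.1.1, h.2⟩, fun h => ⟨⟨h.1, hp _ h.2⟩, h.2⟩⟩
  rw [hfilter]
  refine Finset.image_congr fun u hu => ?_
  obtain ⟨hu, hpu⟩ := Finset.mem_filter.1 hu
  exact T.contract_reveal hu (hp _ hpu)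

theorem lttState_reveal {k : ℕ} (S : CTMStrategy k) (hij : j ≤ i) :
    lttState S (T.reveal i) j = lttState S T.fullView j := by
  induction j with
  | zero => rfl
  | succ j ih =>
    have hknown : (T.reveal i).known (j + 1) = T.fullView.known (j + 1) :=
      T.image_contract_reveal (p := (· ≤ j + 1)) fun _ hn => hn.trans hij
    have hfront : (T.reveal i).front (j + 1) = T.fullView.front (j + 1) :=
      T.image_contract_reveal (p := (· = j + 1)) fun _ hn => hn.le.trans hij
    rw [lttState, lttState, ih ((Nat.le_succ j).trans hij), hknown, hfront]

end Reveal

section Contract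

variable {T : LayeredTree} {a j : ℕ} {u w : List ℕ}

theorem mem_known : w ∈ T.fullView.known j ↔
    ∃ u ∈ T.nodes, u.length ≤ j ∧ contract T.len u = w := by
  simp only [LTTView.known, fullView, Finset.mem_image, Finset.mem_filter, and_assoc]

theorem mem_front : w ∈ T.fullView.front j ↔
    ∃ u ∈ T.nodes, u.length = j ∧ contract T.len u = w := by
  simp only [LTTView.front, fullView, Finset.mem_image, Finset.mem_filter, and_assoc]

theorem mem_known_of_cons_mem (a : ℕ) (w : List ℕ) (h : a :: w ∈ T.fullView.known j) :
    w ∈ T.fullView.known j := by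
  obtain ⟨u, hu, huj, huw⟩ := mem_known.1 h
  obtain ⟨v, hv, -, -, -, hvw⟩ :=
    exists_suffix_of_cons_suffix_contract (huw ▸ List.suffix_rfl : a :: w <:+ contract T.len u)
  have htail : v.tail <:+ u := (List.tail_suffix v).trans hv
  exact mem_known.2 ⟨v.tail, mem_of_suffix T.parent_mem htail hu, htail.length_le.trans huj, hvw⟩

theorem known_subset_known_succ (T : LayeredTree) (j : ℕ) :
    T.fullView.known j ⊆ T.fullView.known (j + 1) := by
  intro w hw
  obtain ⟨u, hu, huj, huw⟩ := mem_known.1 hw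
  exact mem_known.2 ⟨u, hu, huj.trans j.le_succ, huw⟩

theorem front_subset_known (T : LayeredTree) (j : ℕ) :
    T.fullView.front j ⊆ T.fullView.known j := by
  intro w hw
  obtain ⟨u, hu, huj, huw⟩ := mem_front.1 hw
  exact mem_known.2 ⟨u, hu, huj.le, huw⟩

theorem front_nonempty (hj : j ≤ T.target.length) : (T.fullView.front j).Nonempty := by
  obtain ⟨u, hu, huj⟩ := T.exists_mem_length_eq hj
  exact ⟨_, mem_front.2 ⟨u, hu, huj, rfl⟩⟩

theorem exists_eq_cons_of_length_eq_succ (hu : u ∈ T.nodes) (huj : u.length = j + 1) :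
    ∃ b v, u = b :: v ∧ v ∈ T.nodes ∧ v.length = j := by
  obtain ⟨b, v, rfl⟩ := List.exists_cons_of_length_eq_add_one huj
  exact ⟨b, v, rfl, T.parent_mem b v hu, Nat.succ_injective huj⟩

theorem notMem_front_succ (hw : w ∈ T.fullView.known j) (hwF : w ∉ T.fullView.front j) :
    w ∉ T.fullView.front (j + 1) := by
  intro hw'
  obtain ⟨u, hu, huj, huw⟩ := mem_front.1 hw'
  obtain ⟨b, v, rfl, hv, hvj⟩ := exists_eq_cons_of_length_eq_succ hu huj
  by_cases hlen : T.len (b :: v) = 0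
  · rw [contract, if_pos hlen] at huw
    exact hwF (mem_front.2 ⟨v, hv, hvj, huw⟩)
  · obtain ⟨x, -, hxj, hxw⟩ := mem_known.1 hw
    have hsuffix := suffix_of_contract_suffix (List.cons_ne_nil b v) hlen
      (by rw [huw, hxw] : contract T.len (b :: v) <:+ contract T.len x)
    have := hsuffix.length_le
    omega

theorem cons_mem_known_of_cons_mem_known_succ (hwF : w ∉ T.fullView.front j)
    (ha : a :: w ∈ T.fullView.known (j + 1)) : a :: w ∈ T.fullView.known j := by
  obtain ⟨u, hu, huj, huw⟩ := mem_known.1 ha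
  rcases Nat.le_succ_iff.1 huj with huj | huj
  · exact mem_known.2 ⟨u, hu, huj, huw⟩
  · obtain ⟨b, v, rfl, hv, hvj⟩ := exists_eq_cons_of_length_eq_succ hu huj
    rw [contract] at huw
    split_ifs at huw
    · exact mem_known.2 ⟨v, hv, hvj.le, huw⟩
    · exact absurd (mem_front.2 ⟨v, hv, hvj, (List.cons_eq_cons.1 huw).2⟩) hwF

theorem card_known_erase_le (T : LayeredTree) (j : ℕ) :
    ((T.fullView.known j).erase []).card ≤ T.length := by
  rw [LayeredTree.length, sum_eq_card_filter_ne_zero _ T.len_le_one]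
  refine (Finset.card_le_card fun w hw => ?_).trans (Finset.card_image_le (f := contract T.len))
  obtain ⟨hne, hw⟩ := Finset.mem_erase.1 hw
  obtain ⟨u, hu, -, huw⟩ := mem_known.1 hw
  obtain ⟨c, s, rfl⟩ := List.exists_cons_of_ne_nil hne
  obtain ⟨v, hv, hv0, hlen, hcode, htail⟩ :=
    exists_suffix_of_cons_suffix_contract (huw ▸ List.suffix_rfl : c :: s <:+ contract T.len u)
  refine Finset.mem_image.2 ⟨v, ?_, ?_⟩
  · rw [Finset.mem_filter, Finset.mem_erase]
    exact ⟨⟨hv0, mem_of_suffix T.parent_mem hv hu⟩, hlen⟩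
  · rw [contract_of_len_ne_zero hv0 hlen, hcode, htail]

end Contract

end LayeredTree

/-- The searcher imitates the robot `r`. -/
def lttAlgorithm {k : ℕ} (S : CTMStrategy k) (r : Fin k) : LTTAlgorithm where
  next w _ := w.pick ((lttState S w w.lastIndex).pos r)
  next_mem := by
    intro T i u hi _
    have hlast := T.lastIndex_reveal (i := i + 1) hi
    obtain ⟨v, hv, hvi⟩ := T.exists_mem_length_eq (j := i + 1) hi
    obtain ⟨hmem, hlen⟩ := LTTView.pick_mem
      ⟨v, T.mem_reveal.2 ⟨hv, hvi.le⟩, hvi.trans hlast.symm⟩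
      ((lttState S (T.reveal (i + 1)) (T.reveal (i + 1)).lastIndex).pos r)
    exact Finset.mem_filter.2 ⟨(T.mem_reveal.1 hmem).1, hlen.trans hlast⟩

namespace LayeredTree

variable {T : LayeredTree} {k : ℕ} {S : CTMStrategy k} {f : ℝ → ℝ} {j : ℕ}

theorem isStage_lttState_succ (hk : 0 < k) (hf : S.IsBounded f) (hj : j < T.target.length)
    (h : (lttState S T.fullView j).Knows S (T.fullView.known j) (T.fullView.front j)) :
    IsStage S (T.fullView.known (j + 1)) (T.fullView.front (j + 1)) (lttState S T.fullView j)
      (lttState S T.fullView (j + 1)) :=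
  isStage_stage ((h.extend (T.known_subset_known_succ j) (fun _ => notMem_front_succ)
    fun _ hw _ => cons_mem_known_of_cons_mem_known_succ hw).exists_isStage hk hf
      mem_known_of_cons_mem (front_nonempty hj) (T.front_subset_known (j + 1)))

theorem knows_lttState (hk : 0 < k) (hf : S.IsBounded f) (hj : j ≤ T.target.length) :
    (lttState S T.fullView j).Knows S (T.fullView.known j) (T.fullView.front j) := by
  induction j with
  | zero => exact knows_init S hk (mem_known.2 ⟨[], T.root_mem, le_rfl, rfl⟩) _
  | succ j ih => exact (isStage_lttState_succ hk hf hj (ih (j.le_succ.trans hj))).knows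

theorem pos_lttState_mem_front (hk : 0 < k) (hf : S.IsBounded f) (hj : j ≤ T.target.length)
    (r : Fin k) : (lttState S T.fullView j).pos r ∈ T.fullView.front j := by
  cases j with
  | zero => exact mem_front.2 ⟨[], T.root_mem, rfl, rfl⟩
  | succ j =>
    exact (isStage_lttState_succ hk hf hj (knows_lttState hk hf (j.le_succ.trans hj))).pos_mem r

theorem contract_pos_lttAlgorithm (hk : 0 < k) (hf : S.IsBounded f) (hj : j ≤ T.target.length)
    (r : Fin k) :
    contract T.len ((lttAlgorithm S r).pos T j) = (lttState S T.fullView j).pos r := by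
  cases j with
  | zero => rfl
  | succ j =>
    have hlast := T.lastIndex_reveal hj
    have hpos : (lttAlgorithm S r).pos T (j + 1) =
        (T.reveal (j + 1)).pick ((lttState S T.fullView (j + 1)).pos r) := by
      change LTTView.pick _ ((lttState S _ (T.reveal (j + 1)).lastIndex).pos r) = _
      rw [hlast, T.lttState_reveal S le_rfl]
    obtain ⟨u, hu, huj, hur⟩ := mem_front.1 (pos_lttState_mem_front (S := S) hk hf hj r)
    have hu' := T.mem_reveal.2 ⟨hu, huj.le⟩
    have hlen := huj.trans hlast.symm
    obtain ⟨hmem, hle⟩ := T.mem_reveal.1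
      (LTTView.pick_mem ⟨u, hu', hlen⟩ ((lttState S T.fullView (j + 1)).pos r)).1
    rw [hpos, ← T.contract_reveal hmem hle]
    exact LTTView.contract_pick ⟨u, hu', hlen, (T.contract_reveal hu huj.le).trans hur⟩

theorem sum_dist_pos_le_moves (hk : 0 < k) (hf : S.IsBounded f) (hj : j ≤ T.target.length) :
    ∑ r : Fin k, ∑ i ∈ Finset.range j,
      T.dist ((lttAlgorithm S r).pos T i) ((lttAlgorithm S r).pos T (i + 1)) ≤
        (lttState S T.fullView j).moves := by
  induction j with
  | zero => simp
  | succ j ih =>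
    have hj' := j.le_succ.trans hj
    have hstage := (isStage_lttState_succ hk hf hj
      (knows_lttState (S := S) hk hf hj')).sum_dist_add_moves_le T
        (contract_pos_lttAlgorithm hk hf hj') (contract_pos_lttAlgorithm hk hf hj)
    have := ih hj'
    simp only [Finset.sum_range_succ, Finset.sum_add_distrib]
    omega

/-- After the last layer has been revealed, the robots go on until all of them have reached the
target in the contracted tree. -/
theorem exists_isStage_target (hk : 0 < k) (hf : S.IsBounded f) (T : LayeredTree) :
    ∃ τ, IsStage S (T.fullView.known T.target.length) {contract T.len T.target}
      (lttState S T.fullView T.target.length) τ := by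
  have htarget : {contract T.len T.target} ⊆ T.fullView.front T.target.length :=
    Finset.singleton_subset_iff.2 (mem_front.2 ⟨_, T.target_mem, rfl, rfl⟩)
  exact ((knows_lttState hk hf le_rfl).extend subset_rfl (fun _ _ hw hw' => hw (htarget hw'))
    fun _ _ _ => id).exists_isStage hk hf mem_known_of_cons_mem (Finset.singleton_nonempty _)
      (htarget.trans (T.front_subset_known _))

theorem sum_cost_le (hk : 0 < k) (hf : S.IsBounded f) (T : LayeredTree) :
    ((∑ r : Fin k, (lttAlgorithm S r).cost T : ℕ) : ℝ) ≤ 2 * (T.length : ℝ) + f T.depth := by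
  obtain ⟨τ, hτ⟩ := exists_isStage_target (S := S) hk hf T
  have hpos (r : Fin k) : τ.pos r = contract T.len T.target := Finset.mem_singleton.1 (hτ.pos_mem r)
  have hcost : ∑ r : Fin k, (lttAlgorithm S r).cost T ≤ τ.moves := by
    have hlast := hτ.sum_dist_add_moves_le T (contract_pos_lttAlgorithm hk hf le_rfl)
      (q := fun _ => T.target) fun r => (hpos r).symm
    have := sum_dist_pos_le_moves (S := S) hk hf (le_refl T.target.length)
    simp only [LTTAlgorithm.cost, Finset.sum_add_distrib]
    omega
  have hmoves := hτ.knows.valid.moves_le_of_pos_eq hk hf hpos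
  rw [T.length_contract] at hmoves
  have hcard : ((τ.visited.erase []).card : ℝ) ≤ T.length := by
    exact_mod_cast (Finset.card_le_card (Finset.erase_subset_erase _ hτ.knows.subset)).trans
      (T.card_known_erase_le _)
  calc ((∑ r : Fin k, (lttAlgorithm S r).cost T : ℕ) : ℝ)
      ≤ τ.moves := by exact_mod_cast hcost
    _ ≤ f T.depth + 2 * ((τ.visited.erase []).card : ℝ) := hmoves
    _ ≤ 2 * (T.length : ℝ) + f T.depth := by linarith

end LayeredTree

/-- The searcher imitates a robot that is chosen uniformly at random. -/
def randomizedLTTAlgorithm {k : ℕ} [NeZero k] (S : CTMStrategy k) : RandomizedLTTAlgorithm :=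
  (PMF.uniformOfFintype (Fin k)).map (lttAlgorithm S)

theorem expectedCost_map_uniformOfFintype {ι : Type*} [Fintype ι] [Nonempty ι]
    (B : ι → LTTAlgorithm) (T : LayeredTree) :
    RandomizedLTTAlgorithm.expectedCost ((PMF.uniformOfFintype ι).map B) T =
      (Fintype.card ι : ℝ≥0∞)⁻¹ * ((∑ i, (B i).cost T : ℕ) : ℝ≥0∞) := by
  simp only [RandomizedLTTAlgorithm.expectedCost, PMF.map_apply, PMF.uniformOfFintype_apply,
    tsum_fintype, Finset.sum_mul]
  rw [Summable.tsum_finsetSum fun _ _ => ENNReal.summable, Nat.cast_sum, Finset.mul_sum]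
  refine Finset.sum_congr rfl fun i _ => ?_
  rw [tsum_eq_single (B i) fun C hC => by rw [if_neg hC, zero_mul], if_pos rfl]

theorem expectedCost_randomizedLTTAlgorithm_le {k : ℕ} [NeZero k] {S : CTMStrategy k}
    {f : ℝ → ℝ} (hf : S.IsBounded f) (T : LayeredTree) :
    (randomizedLTTAlgorithm S).expectedCost T ≤
      ENNReal.ofReal ((2 * (T.length : ℝ) + f T.depth) / k + 1) := by
  have hk : 0 < k := NeZero.pos k
  have hk' : (0 : ℝ) < k := Nat.cast_pos.2 hk
  rw [randomizedLTTAlgorithm, expectedCost_map_uniformOfFintype, Fintype.card_fin, mul_comm,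
    ← div_eq_mul_inv, ← ENNReal.ofReal_natCast, ← ENNReal.ofReal_natCast,
    ← ENNReal.ofReal_div_of_pos hk']
  refine ENNReal.ofReal_le_ofReal ?_
  linarith [div_le_div_of_nonneg_right (LayeredTree.sum_cost_le hk hf T) hk'.le]

end TreeMining

end

theorem mainTheorem6 (f : ℕ → ℝ → ℝ) (k : ℕ) (hk : 2 ≤ k)
    (S : TreeMining.CTMStrategy k) (hS : S.IsBounded (f k)) :
    (∃ A : TreeMining.CTEAlgorithm k, ∀ T : TreeMining.RTree,
      ∃ t : ℕ, A.runtime T = t ∧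
        (t : ℝ) ≤ (2 * (T.nodes.card : ℝ) + f k (T.depth : ℝ)) / (k : ℝ) + (T.depth : ℝ) + 1) ∧
    (∃ A : TreeMining.RandomizedLTTAlgorithm, ∀ T : TreeMining.LayeredTree,
      A.expectedCost T ≤
        ENNReal.ofReal ((2 * (T.length : ℝ) + f k (T.depth : ℝ)) / (k : ℝ) + 1)) := by
  have : NeZero k := ⟨by omega⟩
  exact ⟨⟨TreeMining.cteAlgorithm S, TreeMining.CTEAlgorithm.runtime_cteAlgorithm_le (by omega) hS⟩,
    TreeMining.randomizedLTTAlgorithm S, TreeMining.expectedCost_randomizedLTTAlgorithm_le hS⟩
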